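/- Let $\Omega=(-1,1)^2\subset\mathbb R^2$, let $a(x)=1$ if $|x_1|<|x_2|$ and $a(x)=0$ otherwise, and let $\Phi(x,t)=\varphi(t)+a(x)\psi(t)$. Here $\varphi,\psi:[0,\infty)\to[0,\infty)$ are Orlicz functions (convex, left-continuous, vanishing at $0$, tending to $0$ at $0$ and to $\infty$ at $\infty$) such that $\varphi,\psi$ and their conjugates $\varphi^*,\psi^*$, where $\varphi^*(s)=\sup_{t\ge 0}(st-\varphi(t))$, satisfy the $\Delta_2$-condition (a function $\Psi$ satisfies it if there is $c\ge2$ with $\Psi(2t)\le c\,\Psi(t)$ for all $t\ge 0$). Assume that for some $1<p_-\le p_+<\infty$ both $\varphi$ and $\psi$ satisfy $-c_0+c_1t^{p_-}\le \varphi(t),\psi(t)\le c_2t^{p_+}+c_0$ for all $t\ge0$ with constants $c_0\ge0$, $c_1,c_2>0$, that $\varphi\le c_3\psi+c_4$ on $[0,\infty)$ for some constants $c_3,c_4$, and that $\varphi(t)/\psi(t)\to0$ as $t\to\infty$. Let $\|f\|_{L^{\Phi(\cdot)}(\Omega)}=\inf\{\gamma>0:\int_\Omega\Phi(x,|f(x)|/\gamma)\,dx\le1\}$,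 let $L^{\Phi(\cdot)}(\Omega)$ be the set of measurable $f$ for which this is finite, let $W^{1,\Phi(\cdot)}_0(\Omega)=\{w\in W^{1,1}_0(\Omega):\nabla w\in L^{\Phi(\cdot)}(\Omega)\}$ with the norm $\|\nabla w\|_{L^{\Phi(\cdot)}(\Omega)}$, and let $H^{1,\Phi(\cdot)}_0(\Omega)$ be the closure of $C^\infty_0(\Omega)$ in $W^{1,\Phi(\cdot)}_0(\Omega)$. Then $H^{1,\Phi(\cdot)}_0(\Omega)=W^{1,\Phi(\cdot)}_0(\Omega)$ in each of the following two cases: 1. $\displaystyle\int_0\psi^*\!\left(\frac1r\right)r\,dr=+\infty$; 2. $\displaystyle\int_0\varphi\!\left(\frac1r\right)r\,dr=+\infty$. (Here $\int_0 f\,dr=+\infty$ means that $\int_0^\delta f\,dr=+\infty$ for every $\delta>0$.) -/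

import Mathlib

open MeasureTheory Set Filter Topology
open scoped ENNReal

namespace Checkerboard

noncomputable section

/-! ### Orlicz functions

An Orlicz function is represented by a function `φ : ℝ → ℝ` of which only the values on `[0, ∞)`
matter. (Finiteness is no restriction here: all Orlicz functions in use have an upper power
bound.) -/

/-- `φ` is a (finite) Orlicz function on `[0, ∞)`: convex, left-continuous, nonnegative,
`φ 0 = 0`, `φ t → 0` as `t → 0+` and `φ t → ∞` as `t → ∞`. -/
structure IsOrlicz (φ : ℝ → ℝ) : Prop where
  nonneg : ∀ t, 0 ≤ t → 0 ≤ φ t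
  convexOn : ConvexOn ℝ (Ici 0) φ
  leftCont : ∀ t, 0 < t → ContinuousWithinAt φ (Iic t) t
  map_zero : φ 0 = 0
  tendsto_zero : Tendsto φ (𝓝[>] 0) (𝓝 0)
  tendsto_atTop : Tendsto φ atTop atTop

/-- The conjugate function `φ^*(s) = sup_{t ≥ 0} (s t - φ t)`, for `s ≥ 0`, with values in
`[0, ∞]`. The term `t = 0` of the supremum is `0` if `φ 0 = 0`, so cutting the negative terms
at `0` does not change the supremum. -/
def conj (φ : ℝ → ℝ) (s : ℝ) : ℝ≥0∞ :=
  ⨆ (t : ℝ) (_ : 0 ≤ t), ENNReal.ofReal (s * t - φ t)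

/-- The `Δ₂`-condition for a `[0, ∞]`-valued function on `[0, ∞)`. -/
def DeltaTwo (Ψ : ℝ → ℝ≥0∞) : Prop :=
  ∃ c : ℝ, 2 ≤ c ∧ ∀ t, 0 ≤ t → Ψ (2 * t) ≤ ENNReal.ofReal c * Ψ t

/-- `φ` satisfies both the `Δ₂`-condition and the `∇₂`-condition (the `Δ₂`-condition for the
conjugate function). -/
def DeltaNablaTwo (φ : ℝ → ℝ) : Prop :=
  DeltaTwo (fun t => ENNReal.ofReal (φ t)) ∧ DeltaTwo (conj φ)

/-- Power growth between the exponents `pm` and `pp`: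
`-c₀ + c₁ t^pm ≤ φ t ≤ c₂ t^pp + c₀` on `[0, ∞)`. -/
def HasGrowth (pm pp : ℝ) (φ : ℝ → ℝ) : Prop :=
  ∃ c₀ c₁ c₂ : ℝ, 0 ≤ c₀ ∧ 0 < c₁ ∧ 0 < c₂ ∧
    ∀ t, 0 ≤ t → -c₀ + c₁ * t ^ pm ≤ φ t ∧ φ t ≤ c₂ * t ^ pp + c₀

/-- `∫_0 f(r) dr = ∞`: the integral of `f ≥ 0` diverges on every interval `(0, δ)`. -/
def DivergesAtZero (f : ℝ → ℝ≥0∞) : Prop :=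
  ∀ δ : ℝ, 0 < δ → ∫⁻ r in Ioo 0 δ, f r = ∞

/-! ### The square, the weight and the integrand -/

/-- The Euclidean plane. -/
abbrev Plane : Type := EuclideanSpace ℝ (Fin 2)

/-- The open square `Ω = (-1, 1)²`. -/
def square : TopologicalSpace.Opens Plane where
  carrier := {x | ∀ i, x i ∈ Ioo (-1 : ℝ) 1}
  is_open' := by
    simp only [ofPred_forall]
    exact isOpen_iInter_of_finite fun i => isOpen_Ioo.preimage (by fun_prop)

/-- The checkerboard weight: `1` where `|x₁| < |x₂|`, and `0` elsewhere. -/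
def weight (x : Plane) : ℝ := if |x 0| < |x 1| then 1 else 0

/-- The double phase integrand `Φ(x, t) = φ(t) + a(x) ψ(t)` with the checkerboard weight. -/
def integrand (φ ψ : ℝ → ℝ) (x : Plane) (t : ℝ) : ℝ := φ t + weight x * ψ t

/-! ### Generalized Orlicz and Orlicz-Sobolev spaces on an open set of the plane -/

/-- The Luxemburg norm of a vector field `f` in `L^{Φ(·)}(Ω)`:
`inf {γ > 0 : ∫_Ω Φ(x, |f(x)| / γ) dx ≤ 1}`, equal to `∞` if there is no such `γ`. -/
def luxemburgNorm (Φ : Plane → ℝ → ℝ) (Ω : TopologicalSpace.Opens Plane) (f : Plane → Plane) :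
    ℝ≥0∞ :=
  ⨅ (γ : ℝ) (_ : 0 < γ) (_ : ∫⁻ x in Ω, ENNReal.ofReal (Φ x (‖f x‖ / γ)) ≤ 1), ENNReal.ofReal γ

/-- Membership of a vector field in `L^{Φ(·)}(Ω)`. -/
def MemLPhi (Φ : Plane → ℝ → ℝ) (Ω : TopologicalSpace.Opens Plane) (f : Plane → Plane) : Prop :=
  AEStronglyMeasurable f (volume.restrict Ω) ∧ luxemburgNorm Φ Ω f < ∞

/-- `w ∈ W^{1,1}(Ω)`, with weak gradient `g`: both are integrable on `Ω`, and
`∫_Ω w ∇η = -∫_Ω η g` for all `η ∈ C_0^∞(Ω)`. -/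
def IsSobolevOneOne (Ω : TopologicalSpace.Opens Plane) (w : Plane → ℝ) (g : Plane → Plane) :
    Prop :=
  IntegrableOn w Ω ∧ IntegrableOn g Ω ∧
    ∀ η : TestFunction Ω ℝ ⊤, ∫ x in Ω, w x • gradient η x = -∫ x in Ω, η x • g x

/-- `w ∈ W_0^{1,1}(Ω)`, with weak gradient `g`: `w` is in the closure of `C_0^∞(Ω)` in
`W^{1,1}(Ω)`. -/
def IsSobolevOneOneZero (Ω : TopologicalSpace.Opens Plane) (w : Plane → ℝ) (g : Plane → Plane) :
    Prop :=
  IsSobolevOneOne Ω w g ∧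
    ∀ ε : ℝ, 0 < ε → ∃ η : TestFunction Ω ℝ ⊤,
      (∫ x in Ω, |w x - η x|) + ∫ x in Ω, ‖g x - gradient η x‖ < ε

/-- `W_0^{1,Φ(·)}(Ω)`: the functions `w ∈ W_0^{1,1}(Ω)` with `∇w ∈ L^{Φ(·)}(Ω)`
(as functions, not as classes modulo equality almost everywhere on `Ω`). -/
def sobolevW (Φ : Plane → ℝ → ℝ) (Ω : TopologicalSpace.Opens Plane) : Set (Plane → ℝ) :=
  {w | ∃ g, IsSobolevOneOneZero Ω w g ∧ MemLPhi Φ Ω g}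

/-- `H_0^{1,Φ(·)}(Ω)`: the closure of `C_0^∞(Ω)` in `W_0^{1,Φ(·)}(Ω)` for the norm
`‖∇w‖_{L^{Φ(·)}(Ω)}`. -/
def sobolevH (Φ : Plane → ℝ → ℝ) (Ω : TopologicalSpace.Opens Plane) : Set (Plane → ℝ) :=
  {w | ∃ g, IsSobolevOneOneZero Ω w g ∧ MemLPhi Φ Ω g ∧
    ∀ ε : ℝ≥0∞, 0 < ε → ∃ η : TestFunction Ω ℝ ⊤,
      luxemburgNorm Φ Ω (fun x => g x - gradient η x) < ε}

end

end Checkerboard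

/-! Only the origin can obstruct density. Take a function of the energy space, extended by zero,
with gradient `g`. Linear maps near the identity which expand the square and push the region `|x₀| <
|x₁|` into itself do not decrease the integrand along orbits, so pulling back along them is
continuous in the modular and moves the support into the interior. The maps `expansion δ y` carry a
parameter `y` from the unit disc such that, for fixed `x ≠ 0`, `y ↦ expansion δ y x` is an affine
bijection of the plane. Averaging over `y` yields (`YoungFamily.exists_smoothing`) an approximation
`v` that is smooth off the origin and satisfies the mean value bound `|x| |Dv(x)| ≤ B ∫ |g(z)|/|z|
dz`, the integral being over those `z` with `|z| ≤ 2|x|` whose weight is at least that of `x`.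

It remains to remove the singularity of `v`. If `∫₀ ψ*(1/r) r dr` diverges, points have zero
`ψ`-capacity (`IsOrlicz.exists_cutoff`): after truncation to a bounded function, `v` is multiplied
by `1 - η` with cutoffs `η` of small energy.

If that integral converges, Young's inequality `|g|/|x| ≤ ψ(|g|) + ψ*(1/|x|)` makes `|g|/|x|` and
`|Dv|/|x|` integrable near the origin in the region of weight one. Together with the mean value
bound this gives `v` a limit at the vertex of each of the two cones of that region
(`exists_coneLimit`). If the limits differed, the jump of `v` across the cone between them at
distance `t` would force a mean gradient of order `1/t` there, and by Jensen's inequality the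
`φ`-energy would dominate a multiple of `∫₀ φ(1/r) r dr = ∞` (`ConeLimit.eq_of_diverges`). So there
is a common limit `c`. Composition with functions which are constant near `c` and have derivative
one away from it (`Admissible.approximable_of_flattening`) reduces to functions constant near the
origin in the region of weight one. Now either `∫₀ φ*(1/r) r dr` diverges, and cutoffs of small
`φ`-energy suffice; or it converges, `v` has limits along the side cones too, all limits agree along
the diagonals, and the flattened function is constant near the origin. -/

namespace Checkerboard

/-! ### Young functions, conjugate functions, and the doubling conditions -/

/-- A continuous nondecreasing function on the line, convex on `[0, ∞)` and vanishing on
`(-∞, 0]`, with the `Δ₂`-condition with constant `K`. -/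
structure Young (φ : ℝ → ℝ) (K : ℝ) : Prop where
  cont : Continuous φ
  mono : Monotone φ
  convexOn : ConvexOn ℝ (Ici 0) φ
  zero : ∀ t, t ≤ 0 → φ t = 0
  one_le : 1 ≤ K
  doubling : ∀ t, φ (2 * t) ≤ K * φ t

namespace Young

variable {φ ψ : ℝ → ℝ} {K L : ℝ}

theorem nonneg (h : Young φ K) (t : ℝ) : 0 ≤ φ t := by
  rcases le_total t 0 with ht | ht
  · exact (h.zero t ht).ge
  · rw [← h.zero 0 le_rfl]; exact h.mono ht

theorem map_mul_le (h : Young φ K) {R : ℝ} {n : ℕ} (hR : R ≤ 2 ^ n) {t : ℝ} (ht : 0 ≤ t) :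
    φ (R * t) ≤ K ^ n * φ t := by
  refine (h.mono (mul_le_mul_of_nonneg_right hR ht)).trans ?_
  clear hR
  induction n with
  | zero => simp
  | succ n ih =>
    rw [pow_succ', pow_succ', mul_assoc, mul_assoc]
    exact (h.doubling _).trans (mul_le_mul_of_nonneg_left ih (by linarith [h.one_le]))

theorem exists_map_mul_le (h : Young φ K) (R : ℝ) :
    ∃ M, 1 ≤ M ∧ ∀ t, 0 ≤ t → φ (R * t) ≤ M * φ t := by
  obtain ⟨n, hn⟩ := pow_unbounded_of_one_lt R (one_lt_two)
  exact ⟨K ^ n, one_le_pow₀ h.one_le, fun t ht => h.map_mul_le hn.le ht⟩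

theorem map_add_le (h : Young φ K) (s t : ℝ) : φ (s + t) ≤ K * (φ s + φ t) := by
  have hK := h.one_le
  wlog hst : s ≤ t generalizing s t
  · rw [add_comm s, add_comm (φ s)]; exact this t s (le_of_not_ge hst)
  calc φ (s + t) ≤ φ (2 * t) := h.mono (by linarith)
    _ ≤ K * φ t := h.doubling t
    _ ≤ K * (φ s + φ t) := by
      apply mul_le_mul_of_nonneg_left _ (by linarith)
      linarith [h.nonneg s]

theorem map_mul_le_of_le_one (h : Young φ K) {q t : ℝ} (hq : 0 ≤ q) (hq1 : q ≤ 1) (ht : 0 ≤ t) :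
    φ (q * t) ≤ q * φ t := by
  have := h.convexOn.2 (mem_Ici.2 ht) (mem_Ici.2 le_rfl) hq (sub_nonneg.2 hq1) (by ring)
  simpa [h.zero 0 le_rfl] using this

theorem add (h : Young φ K) (h' : Young ψ L) : Young (fun t => φ t + ψ t) (max K L) where
  cont := h.cont.add h'.cont
  mono := h.mono.add h'.mono
  convexOn := h.convexOn.add h'.convexOn
  zero t ht := by simp [h.zero t ht, h'.zero t ht]
  one_le := h.one_le.trans (le_max_left _ _)
  doubling t := by
    have h1 := h.doubling t
    have h2 := h'.doubling t
    have h3 := mul_le_mul_of_nonneg_right (le_max_left K L) (h.nonneg t)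
    have h4 := mul_le_mul_of_nonneg_right (le_max_right K L) (h'.nonneg t)
    linarith

theorem of_le (h : Young φ K) (hL : K ≤ L) : Young φ L where
  cont := h.cont
  mono := h.mono
  convexOn := h.convexOn
  zero := h.zero
  one_le := h.one_le.trans hL
  doubling t := (h.doubling t).trans (mul_le_mul_of_nonneg_right hL (h.nonneg t))

/-- Jensen's inequality. -/
theorem ofReal_norm_integral_le (h : Young φ K) {α E : Type*} [MeasurableSpace α]
    [NormedAddCommGroup E] [NormedSpace ℝ E] {μ : Measure α} [IsProbabilityMeasure μ]
    {F : α → E} (hF : Integrable F μ) :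
    ENNReal.ofReal (φ ‖∫ a, F a ∂μ‖) ≤ ∫⁻ a, ENNReal.ofReal (φ ‖F a‖) ∂μ := by
  have hm : AEStronglyMeasurable (φ ∘ fun a => ‖F a‖) μ :=
    h.cont.comp_aestronglyMeasurable hF.norm.aestronglyMeasurable
  by_cases hi : Integrable (φ ∘ fun a => ‖F a‖) μ
  · have h0 := h.convexOn.map_integral_le h.cont.continuousOn isClosed_Ici
      (ae_of_all _ fun a => mem_Ici.2 (norm_nonneg (F a))) hF.norm hi
    have h1 := ofReal_integral_eq_lintegral_ofReal hi (ae_of_all _ fun a => h.nonneg _)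
    simp only [Function.comp] at h1
    rw [← h1]
    exact ENNReal.ofReal_le_ofReal ((h.mono (norm_integral_le_integral_norm F)).trans h0)
  · have : ∫⁻ a, ENNReal.ofReal (φ ‖F a‖) ∂μ = ∞ := by
      by_contra hne
      refine hi ⟨hm, ?_⟩
      exact (hasFiniteIntegral_iff_ofReal (ae_of_all _ fun a => h.nonneg _)).2
        (lt_top_iff_ne_top.2 hne)
    rw [this]; exact le_top

end Young

theorem conj_congr {φ ψ : ℝ → ℝ} (h : ∀ t, 0 ≤ t → φ t = ψ t) (s : ℝ) : conj φ s = conj ψ s := by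
  unfold conj
  exact iSup_congr fun t => iSup_congr fun ht => by rw [h t ht]

theorem conj_mono (φ : ℝ → ℝ) : Monotone (conj φ) := fun s s' hs =>
  iSup_mono fun t => iSup_mono fun ht =>
    ENNReal.ofReal_le_ofReal (by have := mul_le_mul_of_nonneg_right hs ht; linarith)

theorem ofReal_le_conj (φ : ℝ → ℝ) (s : ℝ) {t : ℝ} (ht : 0 ≤ t) :
    ENNReal.ofReal (s * t - φ t) ≤ conj φ s :=
  le_iSup₂ (f := fun (t : ℝ) (_ : 0 ≤ t) => ENNReal.ofReal (s * t - φ t)) t ht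

/-- Young's inequality. -/
theorem ofReal_mul_le (φ : ℝ → ℝ) (s : ℝ) {t : ℝ} (ht : 0 ≤ t) :
    ENNReal.ofReal (s * t) ≤ ENNReal.ofReal (φ t) + conj φ s := by
  calc ENNReal.ofReal (s * t) = ENNReal.ofReal (φ t + (s * t - φ t)) := by ring_nf
    _ ≤ _ := ENNReal.ofReal_add_le.trans (add_le_add le_rfl (ofReal_le_conj φ s ht))

namespace IsOrlicz

variable {φ : ℝ → ℝ}

theorem monotoneOn (h : IsOrlicz φ) : MonotoneOn φ (Ici 0) := by
  intro s hs t ht hst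
  rcases eq_or_lt_of_le (mem_Ici.1 ht) with h0 | h0
  · have : s = t := le_antisymm hst (h0 ▸ hs)
    rw [this]
  have hq : 0 ≤ s / t := div_nonneg hs h0.le
  have hq1 : s / t ≤ 1 := div_le_one_of_le₀ hst h0.le
  have := h.convexOn.2 ht (mem_Ici.2 le_rfl) hq (sub_nonneg.2 hq1) (by ring)
  simp only [smul_eq_mul, mul_zero, add_zero, h.map_zero, div_mul_cancel₀ _ h0.ne'] at this
  exact this.trans (mul_le_of_le_one_left (h.nonneg t ht) hq1)

theorem continuous_max (h : IsOrlicz φ) : Continuous fun t => φ (max t 0) := by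
  have hc : ContinuousOn φ (Ici 0) := by
    intro t ht
    rcases eq_or_lt_of_le (mem_Ici.1 ht) with h0 | h0
    · subst h0
      rw [← Ioi_insert, continuousWithinAt_insert_self]
      simpa [ContinuousWithinAt, h.map_zero] using h.tendsto_zero
    · have := h.convexOn.continuousOn_interior
      rw [interior_Ici] at this
      exact (this.continuousAt (Ioi_mem_nhds h0)).continuousWithinAt
  exact hc.comp_continuous (by fun_prop) fun t => mem_Ici.2 (le_max_right t 0)

theorem exists_young (h : IsOrlicz φ) (h2 : DeltaTwo fun t => ENNReal.ofReal (φ t)) :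
    ∃ K, Young (fun t => φ (max t 0)) K := by
  obtain ⟨c, hc, h2⟩ := h2
  refine ⟨c, h.continuous_max, ?_, ?_, ?_, by linarith, ?_⟩
  · exact fun s t hst => h.monotoneOn (mem_Ici.2 (le_max_right _ _)) (mem_Ici.2 (le_max_right _ _))
      (max_le_max_right 0 hst)
  · exact h.convexOn.congr fun t ht => by rw [max_eq_left (mem_Ici.1 ht)]
  · intro t ht; rw [max_eq_right ht, h.map_zero]
  · intro t
    have h0 : 0 ≤ max t 0 := le_max_right _ _
    have := h2 _ h0
    rw [← ENNReal.ofReal_mul (by linarith), ENNReal.ofReal_le_ofReal_iff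
      (mul_nonneg (by linarith) (h.nonneg _ h0))] at this
    rwa [mul_max_of_nonneg _ _ (by norm_num : (0:ℝ) ≤ 2), mul_zero] at this

/-- The `∇₂`-condition in terms of the function itself. -/
theorem exists_pow_mul_le (h : IsOrlicz φ) (h2 : DeltaTwo (conj φ)) :
    ∃ c : ℝ, 2 ≤ c ∧ ∀ (m : ℕ) (t : ℝ), 0 ≤ t → c ^ m * φ t ≤ φ ((c / 2) ^ m * t) := by
  obtain ⟨c, hc, h2⟩ := h2
  have key : ∀ t, 0 ≤ t → c * φ t ≤ φ (c / 2 * t) := by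
    intro t ht
    rcases eq_or_lt_of_le ht with rfl | h0
    · simp [h.map_zero]
    have hi : t ∈ interior (Ici (0 : ℝ)) := by rw [interior_Ici]; exact h0
    -- `s` is a subgradient at `t`, so the supremum defining `conj φ s` is attained at `t`. Testing
    -- `conj φ (2 * s)` with the point `c / 2 * t` makes the terms containing `s * t` cancel.
    set s := derivWithin φ (Ioi t) t
    have hs : ∀ x, 0 ≤ x → s * x - φ x ≤ s * t - φ t := by
      intro x hx
      rcases lt_trichotomy x t with hxt | rfl | hxt
      · have h1 := h.convexOn.slope_le_leftDeriv_of_mem_interior (mem_Ici.2 hx) hi hxt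
        have h2 := h.convexOn.leftDeriv_le_rightDeriv_of_mem_interior hi
        have h3 := h1.trans h2
        rw [slope_def_field, div_le_iff₀ (by linarith)] at h3
        linarith
      · exact le_rfl
      · have h1 := h.convexOn.rightDeriv_le_slope_of_mem_interior hi (mem_Ici.2 hx) hxt
        rw [slope_def_field, le_div_iff₀ (by linarith)] at h1
        linarith
    have hs0 : 0 ≤ s := by
      have := hs 0 le_rfl
      have h3 := h.nonneg t ht
      simp only [mul_zero, h.map_zero] at this
      by_contra hneg
      nlinarith [mul_neg_of_neg_of_pos (not_le.1 hneg) h0]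
    have hst : 0 ≤ s * t - φ t := by simpa [h.map_zero] using hs 0 le_rfl
    have h1 : conj φ s ≤ ENNReal.ofReal (s * t - φ t) :=
      iSup₂_le fun x hx => ENNReal.ofReal_le_ofReal (hs x hx)
    have h3 := (ofReal_le_conj φ (2 * s) (t := c / 2 * t) (by positivity)).trans (h2 s hs0)
    have h4 := h3.trans (mul_le_mul_right h1 _)
    rw [← ENNReal.ofReal_mul (by linarith), ENNReal.ofReal_le_ofReal_iff
      (mul_nonneg (by linarith) hst)] at h4
    linarith
  refine ⟨c, hc, fun m => ?_⟩
  induction m with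
  | zero => simp
  | succ m ih =>
    intro t ht
    calc c ^ (m + 1) * φ t = c ^ m * (c * φ t) := by ring
      _ ≤ c ^ m * φ (c / 2 * t) := by gcongr; exact key t ht
      _ ≤ φ ((c / 2) ^ m * (c / 2 * t)) := ih _ (by positivity)
      _ = _ := by ring_nf

end IsOrlicz

/-- A measurable family of Young functions with a common doubling constant. -/
structure YoungFamily (Φ : Plane → ℝ → ℝ) (K : ℝ) : Prop where
  meas : Measurable (Function.uncurry Φ)
  young : ∀ x, Young (Φ x) K

theorem measurable_weight : Measurable weight := by
  unfold weight
  refine Measurable.ite (measurableSet_lt ?_ ?_) measurable_const measurable_const <;> fun_prop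

theorem weight_eq (x : Plane) : weight x = 0 ∨ weight x = 1 := by
  unfold weight; split_ifs <;> simp

theorem weight_nonneg (x : Plane) : 0 ≤ weight x := by
  rcases weight_eq x with h | h <;> simp [h]

theorem weight_le_one (x : Plane) : weight x ≤ 1 := by
  rcases weight_eq x with h | h <;> simp [h]

theorem Young.youngFamily_integrand {φ ψ : ℝ → ℝ} {K L : ℝ} (h : Young φ K) (h' : Young ψ L) :
    YoungFamily (integrand φ ψ) (max K L) where
  meas := by
    have h1 := h.cont.measurable
    have h2 := h'.cont.measurable
    have h3 := measurable_weight
    unfold integrand Function.uncurry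
    fun_prop
  young x := by
    unfold integrand
    rcases weight_eq x with hx | hx
    · simpa [hx] using h.of_le (le_max_left K L)
    · simpa [hx] using h.add h'

end Checkerboard

/-! ### Continuity of linear changes of variables in `L¹` and in the modular -/

namespace Checkerboard

theorem map_volume_eq (A : Plane →L[ℝ] Plane) (hA : A.det ≠ 0) :
    Measure.map A (volume : Measure Plane) = ENNReal.ofReal |A.det⁻¹| • volume :=
  Measure.map_linearMap_addHaar_eq_smul_addHaar volume (f := (A : Plane →ₗ[ℝ] Plane)) hA

theorem lintegral_comp_clm (A : Plane →L[ℝ] Plane) (hA : A.det ≠ 0) {f : Plane → ℝ≥0∞}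
    (hf : AEMeasurable f) :
    ∫⁻ x, f (A x) = ENNReal.ofReal |A.det⁻¹| * ∫⁻ x, f x := by
  have h := map_volume_eq A hA
  have h1 : AEMeasurable f (Measure.map A volume) := by
    rw [h]; exact hf.smul_measure _
  rw [← lintegral_map' h1 A.continuous.aemeasurable, h, lintegral_smul_measure, smul_eq_mul]

theorem quasiMeasurePreserving_clm (A : Plane →L[ℝ] Plane) (hA : A.det ≠ 0) :
    Measure.QuasiMeasurePreserving A (volume : Measure Plane) volume :=
  ⟨A.continuous.measurable, by
    rw [map_volume_eq A hA]; exact Measure.smul_absolutelyContinuous⟩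

theorem eventually_det_bounds :
    ∀ᶠ A : Plane →L[ℝ] Plane in 𝓝 1, A.det ≠ 0 ∧ |A.det⁻¹| ≤ 2 ∧ ‖A‖ ≤ 2 ∧
      ∀ x, ‖x‖ ≤ 2 * ‖A x‖ := by
  have h1 : Tendsto (fun A : Plane →L[ℝ] Plane => A.det) (𝓝 1) (𝓝 1) := by
    have h : (1 : Plane →L[ℝ] Plane).det = 1 := by
      rw [ContinuousLinearMap.det]; exact LinearMap.det_id
    have hc : Continuous fun A : Plane →L[ℝ] Plane => A.det := ContinuousLinearMap.continuous_det
    simpa [h] using hc.tendsto 1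
  have h2 : Tendsto (fun A : Plane →L[ℝ] Plane => |A.det⁻¹|) (𝓝 1) (𝓝 1) := by
    simpa using (h1.inv₀ one_ne_zero).abs
  have h3 : Tendsto (fun A : Plane →L[ℝ] Plane => ‖A - 1‖) (𝓝 1) (𝓝 0) := by
    have : Continuous fun A : Plane →L[ℝ] Plane => ‖A - 1‖ := by fun_prop
    simpa using this.tendsto 1
  filter_upwards [h1.eventually_ne one_ne_zero, h2.eventually_le_const (by norm_num : (1:ℝ) < 2),
    h3.eventually_le_const (by norm_num : (0:ℝ) < 1 / 2)] with A ha hb hc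
  refine ⟨ha, hb, ?_, fun x => ?_⟩
  · have : ‖A‖ ≤ ‖A - 1‖ + ‖(1 : Plane →L[ℝ] Plane)‖ := by
      simpa using norm_add_le (A - 1) 1
    have h4 : ‖(1 : Plane →L[ℝ] Plane)‖ ≤ 1 := ContinuousLinearMap.norm_id_le
    linarith
  · have h4 := (A - 1).le_opNorm x
    have h5 : ‖x‖ ≤ ‖A x‖ + ‖(A - 1) x‖ := by
      have := norm_sub_le (A x) ((A - 1) x)
      simpa using this
    nlinarith [norm_nonneg x]

/-- Dilations are continuous in `L¹`. -/
theorem tendsto_lintegral_comp_clm_sub {E : Type*} [NormedAddCommGroup E] [NormedSpace ℝ E]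
    {h : Plane → E} (hh : Integrable h) :
    Tendsto (fun A : Plane →L[ℝ] Plane => ∫⁻ x, ‖h (A x) - h x‖ₑ) (𝓝 1) (𝓝 0) := by
  have key : ∀ k : Plane → E, HasCompactSupport k → Continuous k →
      Tendsto (fun A : Plane →L[ℝ] Plane => ∫⁻ x, ‖k (A x) - k x‖ₑ) (𝓝 1) (𝓝 0) := by
    intro k hk hkc
    obtain ⟨M, hM⟩ := hkc.bounded_above_of_compact_support hk
    have hM0 : 0 ≤ M := (norm_nonneg _).trans (hM 0)
    obtain ⟨R, hR⟩ := hk.isBounded.subset_closedBall (0 : Plane)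
    have hkR : ∀ x, R < ‖x‖ → k x = 0 := by
      intro x hx
      by_contra hne
      have := hR (subset_tsupport _ hne)
      simp at this; linarith
    have hlim : ∫⁻ _ : Plane, (0 : ℝ≥0∞) = 0 := by simp
    rw [← hlim]
    refine tendsto_lintegral_filter_of_dominated_convergence
      ((Metric.closedBall (0 : Plane) (2 * max R 0)).indicator
        fun _ => ENNReal.ofReal (2 * M)) ?_ ?_ ?_ ?_
    · exact Eventually.of_forall fun A => by
        have : Continuous fun x => ‖k (A x) - k x‖ₑ :=
          ((hkc.comp A.continuous).sub hkc).enorm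
        exact this.measurable
    · filter_upwards [eventually_det_bounds] with A hA
      refine ae_of_all _ fun x => ?_
      by_cases hx : x ∈ Metric.closedBall (0 : Plane) (2 * max R 0)
      · rw [indicator_of_mem hx, ← ofReal_norm]
        refine ENNReal.ofReal_le_ofReal ((norm_sub_le _ _).trans ?_)
        linarith [hM (A x), hM x]
      · have hx' : 2 * max R 0 < ‖x‖ := by simpa using hx
        have h1 := hA.2.2.2 x
        have h2 : R < ‖A x‖ := by linarith [le_max_left R 0]
        have h3 : R < ‖x‖ := by linarith [le_max_left R 0, le_max_right R 0]
        simp [hkR _ h2, hkR _ h3]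
    · rw [lintegral_indicator (Metric.isClosed_closedBall.measurableSet)]
      rw [setLIntegral_const]
      exact ENNReal.mul_ne_top ENNReal.ofReal_ne_top measure_closedBall_lt_top.ne
    · refine ae_of_all _ fun x => ?_
      have h1 : Continuous fun A : Plane →L[ℝ] Plane => ‖k (A x) - k x‖ₑ := by
        have : Continuous fun A : Plane →L[ℝ] Plane => A x := by fun_prop
        exact ((hkc.comp this).sub continuous_const).enorm
      simpa using h1.tendsto 1
  rw [ENNReal.tendsto_nhds_zero]
  intro ε hε
  -- The composed error `h ∘ A - k ∘ A` costs the Jacobian bound `2`, so the three errors add up to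
  -- `2 + 1 + 1` quarters of `ε`.
  have hε8 : ε / 4 ≠ 0 := by simp [hε.ne']
  obtain ⟨k, hk, hkε, hkc, hki⟩ := hh.exists_hasCompactSupport_lintegral_sub_le hε8
  have hd : AEMeasurable fun x => ‖h x - k x‖ₑ :=
    (hh.aestronglyMeasurable.sub hki.aestronglyMeasurable).enorm
  filter_upwards [eventually_det_bounds,
    (ENNReal.tendsto_nhds_zero.1 (key k hk hkc)) (ε / 4) (pos_iff_ne_zero.2 hε8)] with A hA hA2
  have hdA : AEMeasurable fun x => ‖h (A x) - k (A x)‖ₑ :=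
    hd.comp_quasiMeasurePreserving (quasiMeasurePreserving_clm A hA.1)
  have hkA : Measurable fun x => ‖k (A x) - k x‖ₑ :=
    ((hkc.comp A.continuous).sub hkc).enorm.measurable
  calc ∫⁻ x, ‖h (A x) - h x‖ₑ
      ≤ ∫⁻ x, (‖h (A x) - k (A x)‖ₑ + ‖k (A x) - k x‖ₑ + ‖h x - k x‖ₑ) := by
        refine lintegral_mono fun x => ?_
        have h1 : h (A x) - h x = (h (A x) - k (A x)) + (k (A x) - k x) - (h x - k x) := by abel
        rw [h1]
        exact (enorm_sub_le).trans (add_le_add (enorm_add_le _ _) le_rfl)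
    _ = (∫⁻ x, ‖h (A x) - k (A x)‖ₑ) + (∫⁻ x, ‖k (A x) - k x‖ₑ) + ∫⁻ x, ‖h x - k x‖ₑ := by
        rw [lintegral_add_right' _ hd, lintegral_add_left' hdA]
    _ ≤ 2 * (ε / 4) + ε / 4 + ε / 4 := by
        refine add_le_add (add_le_add ?_ hA2) hkε
        rw [lintegral_comp_clm A hA.1 hd]
        refine mul_le_mul' ?_ hkε
        simpa using ENNReal.ofReal_le_ofReal hA.2.1
    _ = ε := by
        have : 2 * (ε / 4) + ε / 4 + ε / 4 = 4 * (ε / 4) := by ring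
        rw [this, ENNReal.mul_div_cancel (by norm_num) (by norm_num)]

/-- Dominated convergence with `L¹`-convergent majorants. -/
theorem tendsto_lintegral_zero_of_le {α : Type*} [MeasurableSpace α] {μ : Measure α}
    {f e : ℕ → α → ℝ≥0∞} {h : α → ℝ≥0∞} (hf : ∀ n, AEMeasurable (f n) μ)
    (he : ∀ n, AEMeasurable (e n) μ)
    (hle : ∀ n, ∀ᵐ x ∂μ, f n x ≤ e n x + h x) (hh : ∫⁻ x, h x ∂μ ≠ ∞)
    (he0 : Tendsto (fun n => ∫⁻ x, e n x ∂μ) atTop (𝓝 0))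
    (hf0 : ∀ᵐ x ∂μ, Tendsto (fun n => f n x) atTop (𝓝 0)) :
    Tendsto (fun n => ∫⁻ x, f n x ∂μ) atTop (𝓝 0) := by
  -- The truncated difference `f n - e n` has the fixed majorant `h`; what it loses is at most `e
  -- n`, whose integral tends to zero.
  have h1 : Tendsto (fun n => ∫⁻ x, (f n x - e n x) ∂μ) atTop (𝓝 0) := by
    have hlim : ∫⁻ _ : α, (0 : ℝ≥0∞) ∂μ = 0 := by simp
    rw [← hlim]
    refine tendsto_lintegral_of_dominated_convergence' h (fun n => (hf n).sub (he n)) ?_ hh ?_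
    · intro n
      filter_upwards [hle n] with x hx
      exact tsub_le_iff_left.2 hx
    · filter_upwards [hf0] with x hx
      exact tendsto_of_tendsto_of_tendsto_of_le_of_le tendsto_const_nhds hx
        (fun _ => zero_le) fun n => tsub_le_self
  refine tendsto_of_tendsto_of_tendsto_of_le_of_le tendsto_const_nhds
    (by simpa using he0.add h1) (fun _ => zero_le) fun n => ?_
  dsimp only
  rw [← lintegral_add_left' (he n)]
  exact lintegral_mono fun x => le_add_tsub

variable {Φ : Plane → ℝ → ℝ} {K : ℝ}

theorem YoungFamily.aemeasurable (hΦ : YoungFamily Φ K) {E : Type*} [NormedAddCommGroup E]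
    {f : Plane → E} {μ : Measure Plane} (hf : AEStronglyMeasurable f μ) :
    AEMeasurable (fun x => ENNReal.ofReal (Φ x ‖f x‖)) μ :=
  (hΦ.meas.comp_aemeasurable (aemeasurable_id.prodMk hf.norm.aemeasurable)).ennreal_ofReal

/-- Continuity in the modular of those dilations along which the integrand does not decrease. -/
theorem YoungFamily.tendsto_lintegral_comp_clm_sub (hΦ : YoungFamily Φ K)
    {g : Plane → Plane →L[ℝ] ℝ} (hg : Integrable g)
    (hgΦ : ∫⁻ x, ENNReal.ofReal (Φ x ‖g x‖) ≠ ∞) :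
    Tendsto (fun A : Plane →L[ℝ] Plane =>
      ∫⁻ x, ENNReal.ofReal (Φ x ‖(g (A x)).comp A - g x‖))
      (𝓝 1 ⊓ 𝓟 {A | ∀ x t, Φ x t ≤ Φ (A x) t}) (𝓝 0) := by
  -- Convergence of `g ∘ A n` to `g` in `L¹` gives almost everywhere convergence only along a
  -- subsequence.
  refine tendsto_of_subseq_tendsto fun A hA => ?_
  have hA1 : Tendsto A atTop (𝓝 1) := hA.mono_right inf_le_left
  have hA2 : ∀ᶠ n in atTop, ∀ x t, Φ x t ≤ Φ (A n x) t :=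
    tendsto_principal.1 (hA.mono_right inf_le_right)
  obtain ⟨N, hN⟩ := eventually_atTop.1 (hA2.and (hA1.eventually eventually_det_bounds))
  have hS : Tendsto (fun n : ℕ => n + N) atTop atTop := tendsto_add_atTop_nat N
  set B : ℕ → Plane →L[ℝ] Plane := fun n => A (n + N) with hB
  have hB1 : Tendsto B atTop (𝓝 1) := hA1.comp hS
  have hBN : ∀ n, (∀ x t, Φ x t ≤ Φ (B n x) t) ∧ _ := fun n => hN (n + N) (Nat.le_add_left _ _)
  have hgB : ∀ n, AEStronglyMeasurable (fun x => g (B n x)) volume := fun n =>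
    hg.aestronglyMeasurable.comp_quasiMeasurePreserving
      (quasiMeasurePreserving_clm (B n) (hBN n).2.1)
  have htm : TendstoInMeasure volume (fun n x => g (B n x)) atTop g := by
    refine tendstoInMeasure_of_tendsto_eLpNorm one_ne_zero hgB hg.aestronglyMeasurable ?_
    simp only [eLpNorm_one_eq_lintegral_enorm]
    exact (Checkerboard.tendsto_lintegral_comp_clm_sub hg).comp hB1
  obtain ⟨ns, hns, hae⟩ := htm.exists_seq_tendsto_ae
  refine ⟨fun n => ns n + N, ?_⟩
  have hK := (hΦ.young 0).one_le
  set h : Plane → ℝ := fun x => Φ x ‖g x‖ with hh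
  have hhm : AEStronglyMeasurable h volume :=
    (hΦ.meas.comp_aemeasurable
      (aemeasurable_id.prodMk hg.aestronglyMeasurable.norm.aemeasurable)).aestronglyMeasurable
  have hhi : Integrable h := ⟨hhm, by
    rw [hasFiniteIntegral_iff_ofReal (ae_of_all _ fun a => (hΦ.young _).nonneg _)]
    exact lt_top_iff_ne_top.2 hgΦ⟩
  have hBs : Tendsto (fun n => B (ns n)) atTop (𝓝 1) := hB1.comp hns.tendsto_atTop
  have hhB : ∀ n, AEStronglyMeasurable (fun x => h (B n x)) volume := fun n =>
    hhm.comp_quasiMeasurePreserving (quasiMeasurePreserving_clm (B n) (hBN n).2.1)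
  have hcm : ∀ n, AEStronglyMeasurable (fun x => (g (B n x)).comp (B n) - g x) volume := fun n =>
    ((((ContinuousLinearMap.compL ℝ Plane Plane ℝ).flip (B n)).continuous.comp_aestronglyMeasurable
      (hgB n)).sub hg.aestronglyMeasurable)
  -- Since `Φ x ≤ Φ (A x)`, the value `Φ x ‖g (A x)‖` is at most `h (A x)`, and `h ∘ A` tends to `h`
  -- in `L¹`. The majorant is thus a multiple of `h` plus an error vanishing in `L¹`.
  refine tendsto_lintegral_zero_of_le
    (e := fun n x => ENNReal.ofReal (K * K) * ‖h (B (ns n) x) - h x‖ₑ)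
    (h := fun x => ENNReal.ofReal (K * K + K * K + K) * ENNReal.ofReal (h x)) ?_ ?_ ?_ ?_ ?_ ?_
  · exact fun n => hΦ.aemeasurable (hcm (ns n))
  · exact fun n => ((hhB _).sub hhm).enorm.const_mul _
  · refine fun n => ae_of_all _ fun x => ?_
    rw [← ofReal_norm, ← ENNReal.ofReal_mul (by positivity), ← ENNReal.ofReal_mul (by positivity),
      ← ENNReal.ofReal_add (by positivity) (mul_nonneg (by positivity) ((hΦ.young _).nonneg _))]
    refine ENNReal.ofReal_le_ofReal ?_
    obtain ⟨hmono, hdet, hinv, hnorm, -⟩ := hBN (ns n)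
    have hy := hΦ.young x
    have h1 : ‖(g (B (ns n) x)).comp (B (ns n)) - g x‖ ≤ 2 * ‖g (B (ns n) x)‖ + ‖g x‖ := by
      refine (norm_sub_le _ _).trans (add_le_add ?_ le_rfl)
      refine (ContinuousLinearMap.opNorm_comp_le _ _).trans ?_
      rw [mul_comm]; gcongr
    have h2 : Φ x ‖g (B (ns n) x)‖ ≤ h (B (ns n) x) := hmono _ _
    have h3 : h (B (ns n) x) ≤ h x + ‖h (B (ns n) x) - h x‖ := by
      have := le_abs_self (h (B (ns n) x) - h x)
      rw [Real.norm_eq_abs]; linarith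
    have h4 : Φ x (2 * ‖g (B (ns n) x)‖) ≤ K * (h x + ‖h (B (ns n) x) - h x‖) :=
      (hy.doubling _).trans (mul_le_mul_of_nonneg_left (h2.trans h3) (by linarith))
    have h5 : 0 ≤ h x := hy.nonneg _
    calc Φ x ‖(g (B (ns n) x)).comp (B (ns n)) - g x‖
        ≤ K * (Φ x (2 * ‖g (B (ns n) x)‖) + h x) := (hy.mono h1).trans (hy.map_add_le _ _)
      _ ≤ K * (K * (h x + ‖h (B (ns n) x) - h x‖) + h x) := by gcongr
      _ ≤ _ := by nlinarith [mul_nonneg (mul_nonneg (by linarith : 0 ≤ K) (by linarith : 0 ≤ K)) h5]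
  · rw [lintegral_const_mul' _ _ ENNReal.ofReal_ne_top]
    exact ENNReal.mul_ne_top ENNReal.ofReal_ne_top hgΦ
  · simp only [lintegral_const_mul' _ _ ENNReal.ofReal_ne_top]
    have := ENNReal.Tendsto.const_mul
      ((Checkerboard.tendsto_lintegral_comp_clm_sub hhi).comp hBs)
      (Or.inr (ENNReal.ofReal_ne_top (r := K * K)))
    simpa using this
  · filter_upwards [hae] with x hx
    have h1 : Tendsto (fun n => (g (B (ns n) x)).comp (B (ns n)) - g x) atTop (𝓝 0) := by
      have h2 : Continuous fun p : (Plane →L[ℝ] ℝ) × (Plane →L[ℝ] Plane) => p.1.comp p.2 - g x := by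
        fun_prop
      have h3 := (h2.tendsto (g x, 1)).comp (hx.prodMk_nhds hBs)
      have h4 : (g x).comp (1 : Plane →L[ℝ] Plane) - g x = 0 := by ext; simp
      simpa [h4, Function.comp_def] using h3
    have h5 : Tendsto (fun n => Φ x ‖(g (B (ns n) x)).comp (B (ns n)) - g x‖) atTop (𝓝 0) := by
      have := ((hΦ.young x).cont.tendsto 0).comp (by simpa using h1.norm)
      rwa [(hΦ.young x).zero 0 le_rfl] at this
    simpa using ENNReal.tendsto_ofReal h5

end Checkerboard

/-! ### The expansions and their dependence on the parameter -/

namespace Checkerboard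

noncomputable section

/-- The diagonal linear map with entries `a`, `b`. -/
def diagonal (a b : ℝ) : Plane →L[ℝ] Plane :=
  a • (EuclideanSpace.proj (0 : Fin 2)).smulRight (EuclideanSpace.single (0 : Fin 2) (1 : ℝ)) +
    b • (EuclideanSpace.proj (1 : Fin 2)).smulRight (EuclideanSpace.single (1 : Fin 2) (1 : ℝ))

/-- The rotation by a right angle. -/
def rotation : Plane →L[ℝ] Plane :=
  (EuclideanSpace.proj (0 : Fin 2)).smulRight (EuclideanSpace.single (1 : Fin 2) (1 : ℝ)) -
    (EuclideanSpace.proj (1 : Fin 2)).smulRight (EuclideanSpace.single (0 : Fin 2) (1 : ℝ))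

/-- Complex multiplication. -/
def cmul : Plane →L[ℝ] Plane →L[ℝ] Plane :=
  (EuclideanSpace.proj (0 : Fin 2)).smulRight 1 +
    (EuclideanSpace.proj (1 : Fin 2)).smulRight rotation

/-- A perturbation of the identity which expands the plane, pushes the cone `|x₀| < |x₁|`
into itself, and depends on a further parameter `y`. -/
def expansion (δ : ℝ) (y : Plane) : Plane →L[ℝ] Plane :=
  (diagonal (1 + δ) (1 + 3 * δ)).comp (1 + (δ / 8) • cmul y)

@[simp] theorem diagonal_apply_zero (a b : ℝ) (x : Plane) : diagonal a b x 0 = a * x 0 := by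
  simp [diagonal]

@[simp] theorem diagonal_apply_one (a b : ℝ) (x : Plane) : diagonal a b x 1 = b * x 1 := by
  simp [diagonal]

@[simp] theorem cmul_apply_zero (y x : Plane) : cmul y x 0 = y 0 * x 0 - y 1 * x 1 := by
  simp [cmul, rotation]; ring

@[simp] theorem cmul_apply_one (y x : Plane) : cmul y x 1 = y 0 * x 1 + y 1 * x 0 := by
  simp [cmul, rotation]

theorem cmul_comm (y x : Plane) : cmul y x = cmul x y := by
  ext i; fin_cases i <;> simp <;> ring

theorem norm_sq_eq (x : Plane) : ‖x‖ ^ 2 = x 0 ^ 2 + x 1 ^ 2 := by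
  rw [EuclideanSpace.norm_sq_eq]; simp

theorem abs_apply_le_norm (x : Plane) (i : Fin 2) : |x i| ≤ ‖x‖ := by
  simpa using PiLp.norm_apply_le x i

/-- Commutativity of complex multiplication makes the image of `x` an affine function of `y`. Its
linear part is multiplication by `x` followed by a diagonal map, hence invertible for `x ≠ 0` and `δ
> 0`. -/
theorem expansion_apply (δ : ℝ) (y x : Plane) :
    expansion δ y x = diagonal (1 + δ) (1 + 3 * δ) x +
      ((δ / 8) • (diagonal (1 + δ) (1 + 3 * δ)).comp (cmul x)) y := by
  simp [expansion, cmul_comm y x]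

theorem expansion_apply_zero (δ : ℝ) (y x : Plane) :
    expansion δ y x 0 = (1 + δ) * (x 0 + δ / 8 * (y 0 * x 0 - y 1 * x 1)) := by
  simp [expansion]; ring

theorem expansion_apply_one (δ : ℝ) (y x : Plane) :
    expansion δ y x 1 = (1 + 3 * δ) * (x 1 + δ / 8 * (y 0 * x 1 + y 1 * x 0)) := by
  simp [expansion]; ring

theorem continuous_expansion :
    Continuous fun p : ℝ × Plane => expansion p.1 p.2 := by
  unfold expansion diagonal
  fun_prop

theorem expansion_zero (y : Plane) : expansion 0 y = 1 := by
  ext x i; fin_cases i <;> simp [expansion_apply_zero, expansion_apply_one]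

theorem det_diagonal_comp_cmul (a b : ℝ) (x : Plane) (c : ℝ) :
    (c • (diagonal a b).comp (cmul x)).det = c ^ 2 * a * b * ‖x‖ ^ 2 := by
  rw [ContinuousLinearMap.det,
    ← LinearMap.det_toMatrix (EuclideanSpace.basisFun (Fin 2) ℝ).toBasis, Matrix.det_fin_two,
    norm_sq_eq]
  simp [LinearMap.toMatrix_apply]
  ring

section Geometry

variable {δ : ℝ} (hδ : 0 < δ) (hδ1 : δ ≤ 1) {y : Plane} (hy : ‖y‖ ≤ 1)

include hδ hδ1 hy

/-- In the cone the term with `y` moves either coordinate by at most `δ / 4 * |x 1|`. The stronger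
stretch along the second axis outweighs this: `(1 + δ) (1 + δ/4) ≤ (1 + 3δ) (1 - δ/4)` for `δ ≤ 1`.
-/
theorem weight_le_weight_expansion (x : Plane) : weight x ≤ weight (expansion δ y x) := by
  unfold weight
  split_ifs with h1 h2 h2
  · exact le_rfl
  · exfalso
    refine h2 ?_
    rw [expansion_apply_zero, expansion_apply_one, abs_mul, abs_mul,
      abs_of_pos (by linarith : 0 < 1 + δ), abs_of_pos (by linarith : 0 < 1 + 3 * δ)]
    have hy0 := (abs_apply_le_norm y 0).trans hy
    have hy1 := (abs_apply_le_norm y 1).trans hy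
    have h00 : |y 0 * x 0| ≤ |x 1| := by
      rw [abs_mul]; nlinarith [abs_nonneg (y 0), abs_nonneg (x 0)]
    have h11 : |y 1 * x 1| ≤ |x 1| := by
      rw [abs_mul]; nlinarith [abs_nonneg (y 1), abs_nonneg (x 1)]
    have h01 : |y 0 * x 1| ≤ |x 1| := by
      rw [abs_mul]; nlinarith [abs_nonneg (y 0), abs_nonneg (x 1)]
    have h10 : |y 1 * x 0| ≤ |x 1| := by
      rw [abs_mul]; nlinarith [abs_nonneg (y 1), abs_nonneg (x 0)]
    have e0 : |x 0 + δ / 8 * (y 0 * x 0 - y 1 * x 1)| ≤ |x 0| + δ / 8 * (2 * |x 1|) := by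
      refine (abs_add_le _ _).trans (add_le_add le_rfl ?_)
      rw [abs_mul, abs_of_pos (by linarith : 0 < δ / 8)]
      have := abs_sub (y 0 * x 0) (y 1 * x 1)
      gcongr; linarith
    have e1 : |x 1| - δ / 8 * (2 * |x 1|) ≤ |x 1 + δ / 8 * (y 0 * x 1 + y 1 * x 0)| := by
      have h3 : |δ / 8 * (y 0 * x 1 + y 1 * x 0)| ≤ δ / 8 * (2 * |x 1|) := by
        rw [abs_mul, abs_of_pos (by linarith : 0 < δ / 8)]
        have := abs_add_le (y 0 * x 1) (y 1 * x 0)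
        gcongr; linarith
      have h4 := abs_sub_abs_le_abs_sub (x 1) (-(δ / 8 * (y 0 * x 1 + y 1 * x 0)))
      rw [abs_neg, sub_neg_eq_add] at h4
      linarith
    have hx : 0 < |x 1| := (abs_nonneg _).trans_lt h1
    calc (1 + δ) * |x 0 + δ / 8 * (y 0 * x 0 - y 1 * x 1)|
        ≤ (1 + δ) * (|x 0| + δ / 8 * (2 * |x 1|)) := by gcongr
      _ < (1 + δ) * (|x 1| + δ / 8 * (2 * |x 1|)) := by gcongr
      _ ≤ (1 + 3 * δ) * (|x 1| - δ / 8 * (2 * |x 1|)) := by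
        have : (1 + δ) * (1 + δ / 4) ≤ (1 + 3 * δ) * (1 - δ / 4) := by nlinarith
        nlinarith
      _ ≤ _ := by gcongr
  · exact zero_le_one
  · exact le_rfl

/-- It suffices to follow the coordinate of larger modulus: the perturbation keeps at least the
fraction `1 - δ/4` of it, and `(1 + δ) (1 - δ/4) ≥ 1 + δ/2`. This places the support of the averages
in a compact subset of the square. -/
theorem expansion_notMem_square {x : Plane} {i : Fin 2} (hx : 1 / (1 + δ / 2) < |x i|) :
    expansion δ y x ∉ square := by
  have hy0 := (abs_apply_le_norm y 0).trans hy
  have hy1 := (abs_apply_le_norm y 1).trans hy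
  have key : ∀ s t a b c : ℝ, |a| ≤ 1 → |b| ≤ 1 → |t| ≤ |s| → 1 / (1 + δ / 2) < |s| →
      1 + δ ≤ c → 1 ≤ |c * (s + δ / 8 * (a * s + b * t))| := by
    intro s t a b c ha hb hts hs hc
    have h1 : |a * s| ≤ |s| := by rw [abs_mul]; nlinarith [abs_nonneg a, abs_nonneg s]
    have h2 : |b * t| ≤ |s| := by
      rw [abs_mul]; nlinarith [abs_nonneg b, abs_nonneg s, abs_nonneg t]
    have h3 : |δ / 8 * (a * s + b * t)| ≤ δ / 8 * (2 * |s|) := by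
      rw [abs_mul, abs_of_pos (by linarith : 0 < δ / 8)]
      have := abs_add_le (a * s) (b * t)
      gcongr; linarith
    have h4 := abs_sub_abs_le_abs_sub s (-(δ / 8 * (a * s + b * t)))
    rw [abs_neg, sub_neg_eq_add] at h4
    rw [abs_mul, abs_of_pos (by linarith : 0 < c)]
    rw [div_lt_iff₀ (by linarith)] at hs
    calc (1 : ℝ) ≤ |s| * (1 + δ / 2) := hs.le
      _ ≤ (1 + δ) * (|s| - δ / 8 * (2 * |s|)) := by
        have : 1 + δ / 2 ≤ (1 + δ) * (1 - δ / 4) := by nlinarith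
        nlinarith [abs_nonneg s]
      _ ≤ c * |s + δ / 8 * (a * s + b * t)| := by
        refine mul_le_mul hc (by linarith) ?_ (by linarith)
        have : 0 ≤ |s| * (1 - δ / 4) := mul_nonneg (abs_nonneg _) (by linarith)
        linarith
  intro hmem
  have hb : ∀ j, |expansion δ y x j| < 1 := fun j => abs_lt.2 (hmem j)
  have b0 := hb 0
  have b1 := hb 1
  rw [expansion_apply_zero] at b0
  rw [expansion_apply_one] at b1
  rcases le_total |x 0| |x 1| with h | h
  · have h1 : 1 / (1 + δ / 2) < |x 1| := by
      fin_cases i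
      · exact hx.trans_le h
      · exact hx
    exact absurd (key (x 1) (x 0) (y 0) (y 1) (1 + 3 * δ) hy0 hy1 h h1 (by linarith)) (not_le.2 b1)
  · have h1 : 1 / (1 + δ / 2) < |x 0| := by
      fin_cases i
      · exact hx
      · exact hx.trans_le h
    have := key (x 0) (x 1) (y 0) (-y 1) (1 + δ) hy0 (by rwa [abs_neg]) h h1 le_rfl
    rw [neg_mul, ← sub_eq_add_neg] at this
    exact absurd this (not_le.2 b0)

end Geometry

/-- The constant in the change of variables `y ↦ expansion δ y x`. -/
def expansionConst (δ : ℝ) : ℝ := ((δ / 8) ^ 2 * (1 + δ) * (1 + 3 * δ))⁻¹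

section ChangeOfVariables

variable {δ : ℝ} (hδ : 0 < δ) {x : Plane} (hx : x ≠ 0)

include hδ hx

theorem det_expansion_ne_zero :
    ((δ / 8) • (diagonal (1 + δ) (1 + 3 * δ)).comp (cmul x)).det ≠ 0 := by
  rw [det_diagonal_comp_cmul]
  have := norm_pos_iff.2 hx
  positivity

theorem map_expansion_eq :
    Measure.map (fun y => expansion δ y x) (volume : Measure Plane) =
      ENNReal.ofReal (expansionConst δ / ‖x‖ ^ 2) • volume := by
  set L := (δ / 8) • (diagonal (1 + δ) (1 + 3 * δ)).comp (cmul x)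
  have h : (fun y => expansion δ y x) = (fun z => diagonal (1 + δ) (1 + 3 * δ) x + z) ∘ L := by
    ext1 y; exact expansion_apply δ y x
  rw [h, ← Measure.map_map (measurable_const_add _) L.continuous.measurable,
    map_volume_eq L (det_expansion_ne_zero hδ hx), Measure.map_smul, map_add_left_eq_self,
    det_diagonal_comp_cmul, abs_of_nonneg (by positivity)]
  congr 2
  rw [mul_inv, ← div_eq_mul_inv, expansionConst]

theorem quasiMeasurePreserving_expansion :
    Measure.QuasiMeasurePreserving (fun y => expansion δ y x) (volume : Measure Plane) volume := by
  refine ⟨?_, ?_⟩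
  · have := continuous_expansion
    have : Continuous fun y => expansion δ y x := by fun_prop
    exact this.measurable
  · rw [map_expansion_eq hδ hx]; exact Measure.smul_absolutelyContinuous

theorem lintegral_comp_expansion {f : Plane → ℝ≥0∞} (hf : AEMeasurable f) :
    ∫⁻ y, f (expansion δ y x) =
      ENNReal.ofReal (expansionConst δ / ‖x‖ ^ 2) * ∫⁻ z, f z := by
  have h1 : AEMeasurable f (Measure.map (fun y => expansion δ y x) volume) := by
    rw [map_expansion_eq hδ hx]; exact hf.smul_measure _
  rw [← lintegral_map' h1 (quasiMeasurePreserving_expansion hδ hx).measurable.aemeasurable,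
    map_expansion_eq hδ hx, lintegral_smul_measure, smul_eq_mul]

theorem integral_comp_expansion {f : Plane → ℝ} (hf : AEStronglyMeasurable f) :
    ∫ y, f (expansion δ y x) = expansionConst δ / ‖x‖ ^ 2 * ∫ z, f z := by
  have h1 : AEStronglyMeasurable f (Measure.map (fun y => expansion δ y x) volume) := by
    rw [map_expansion_eq hδ hx]; exact hf.smul_measure _
  rw [← integral_map (quasiMeasurePreserving_expansion hδ hx).measurable.aemeasurable h1,
    map_expansion_eq hδ hx, integral_smul_measure, smul_eq_mul, ENNReal.toReal_ofReal]
  unfold expansionConst; positivity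

/-- The inverse of `y ↦ expansion δ y x`. -/
theorem expansion_left_inverse (y : Plane) :
    (8 / δ / ‖x‖ ^ 2) • cmul (diagonal 1 (-1) x)
      (diagonal (1 + δ)⁻¹ (1 + 3 * δ)⁻¹ (expansion δ y x) - x) = y := by
  have h1 : (1 + δ) ≠ 0 := by positivity
  have h2 : (1 + 3 * δ) ≠ 0 := by positivity
  have h3 : x 0 ^ 2 + x 1 ^ 2 ≠ 0 := by
    rw [← norm_sq_eq]; exact pow_ne_zero 2 (norm_ne_zero_iff.2 hx)
  ext i
  fin_cases i <;> simp [expansion_apply_zero, expansion_apply_one, norm_sq_eq, h1, h2] <;>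
    field_simp <;> ring

end ChangeOfVariables

end

end Checkerboard

/-! ### Averages over the expansions and their derivatives -/

namespace Checkerboard

noncomputable section

/-- A smooth bump function supported in the unit ball of the plane. -/
def unitBump : ContDiffBump (0 : Plane) := ⟨1 / 2, 1, by norm_num, by norm_num⟩

/-- A probability measure on the unit ball with a smooth density. -/
def bumpMeasure : Measure Plane :=
  (volume : Measure Plane).withDensity fun y => ENNReal.ofReal (unitBump.normed volume y)

instance : IsProbabilityMeasure bumpMeasure := ⟨by
  rw [bumpMeasure, withDensity_apply _ MeasurableSet.univ, setLIntegral_univ,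
    ← ofReal_integral_eq_lintegral_ofReal unitBump.integrable_normed
      (ae_of_all _ unitBump.nonneg_normed), unitBump.integral_normed, ENNReal.ofReal_one]⟩

theorem bumpMeasure_absolutelyContinuous : bumpMeasure ≪ volume :=
  withDensity_absolutelyContinuous _ _

theorem ae_bumpMeasure_norm_le : ∀ᵐ y ∂bumpMeasure, ‖y‖ ≤ 1 := by
  rw [bumpMeasure, ae_withDensity_iff (unitBump.continuous_normed.measurable.ennreal_ofReal)]
  refine ae_of_all _ fun y hy => ?_
  have h : y ∈ Function.support (unitBump.normed volume) := by
    intro h0; exact hy (by simp [h0])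
  rw [unitBump.support_normed_eq] at h
  have := mem_ball_zero_iff.1 h
  exact this.le

theorem integral_bumpMeasure (f : Plane → ℝ) :
    ∫ y, f y ∂bumpMeasure = ∫ y, unitBump.normed volume y * f y := by
  rw [bumpMeasure, integral_withDensity_eq_integral_toReal_smul
    (unitBump.continuous_normed.measurable.ennreal_ofReal) (ae_of_all _ fun _ => ENNReal.ofReal_lt_top)]
  simp [ENNReal.toReal_ofReal (unitBump.nonneg_normed _)]

theorem exists_lintegral_bumpMeasure_le :
    ∃ M : ℝ≥0∞, M ≠ ∞ ∧ ∀ f : Plane → ℝ≥0∞, ∫⁻ y, f y ∂bumpMeasure ≤ M * ∫⁻ y, f y := by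
  obtain ⟨M, hM⟩ := unitBump.continuous_normed (μ := volume).bounded_above_of_compact_support
    unitBump.hasCompactSupport_normed
  refine ⟨ENNReal.ofReal M, ENNReal.ofReal_ne_top, fun f => ?_⟩
  have h : bumpMeasure ≤ ENNReal.ofReal M • volume := by
    rw [← withDensity_const]
    exact withDensity_mono (ae_of_all _ fun y =>
      ENNReal.ofReal_le_ofReal ((le_abs_self _).trans (hM y)))
  calc _ ≤ ∫⁻ y, f y ∂(ENNReal.ofReal M • volume) := lintegral_mono' h le_rfl
    _ = _ := by rw [lintegral_smul_measure, smul_eq_mul]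

/-- The average of `u` along the expansions. -/
def smoothing (δ : ℝ) (u : Plane → ℝ) (x : Plane) : ℝ :=
  ∫ y, u (expansion δ y x) ∂bumpMeasure

/-- The average of the pullbacks of the `1`-form `g` along the expansions. -/
def smoothingForm (δ : ℝ) (g : Plane → Plane →L[ℝ] ℝ) (x : Plane) : Plane →L[ℝ] ℝ :=
  ∫ y, (g (expansion δ y x)).comp (expansion δ y) ∂bumpMeasure

theorem continuous_expansion_left (δ : ℝ) : Continuous fun y => expansion δ y := by
  have := continuous_expansion
  fun_prop

theorem exists_norm_expansion_le (δ : ℝ) : ∃ R, 0 ≤ R ∧ ∀ y, ‖y‖ ≤ 1 → ‖expansion δ y‖ ≤ R := by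
  obtain ⟨R, hR⟩ := (isCompact_closedBall (0 : Plane) 1).exists_bound_of_continuousOn
    (continuous_expansion_left δ).continuousOn
  exact ⟨max R 0, le_max_right _ _, fun y hy => (hR y (by simpa using hy)).trans (le_max_left _ _)⟩

section Estimates

variable {δ : ℝ} (hδ : 0 < δ)

include hδ

theorem aestronglyMeasurable_comp_expansion {E : Type*} [NormedAddCommGroup E] {f : Plane → E}
    (hf : AEStronglyMeasurable f) {x : Plane} (hx : x ≠ 0) :
    AEStronglyMeasurable (fun y => f (expansion δ y x)) bumpMeasure :=
  (hf.comp_quasiMeasurePreserving (quasiMeasurePreserving_expansion hδ hx)).mono_ac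
    bumpMeasure_absolutelyContinuous

/-- The density of `bumpMeasure` is bounded and the Jacobian of `y ↦ expansion δ y x` is
proportional to `‖x‖ ^ 2`, so an average over `y` is controlled by an integral over the plane, with
a constant that blows up only at the origin. -/
theorem exists_lintegral_comp_expansion_le :
    ∃ C : ℝ, 0 ≤ C ∧ ∀ x : Plane, x ≠ 0 → ∀ f : Plane → ℝ≥0∞, AEMeasurable f →
      ∫⁻ y, f (expansion δ y x) ∂bumpMeasure ≤ ENNReal.ofReal (C / ‖x‖ ^ 2) * ∫⁻ z, f z := by
  obtain ⟨M, hM, hle⟩ := exists_lintegral_bumpMeasure_le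
  have h0 : 0 ≤ expansionConst δ := by unfold expansionConst; positivity
  refine ⟨M.toReal * expansionConst δ, by positivity, fun x hx f hf => ?_⟩
  refine (hle _).trans_eq ?_
  rw [lintegral_comp_expansion hδ hx hf, ← mul_assoc, mul_div_assoc,
    ENNReal.ofReal_mul ENNReal.toReal_nonneg, ENNReal.ofReal_toReal hM]

theorem integrable_comp_expansion {E : Type*} [NormedAddCommGroup E] {f : Plane → E}
    (hf : Integrable f) {x : Plane} (hx : x ≠ 0) :
    Integrable (fun y => f (expansion δ y x)) bumpMeasure := by
  obtain ⟨C, hC, h⟩ := exists_lintegral_comp_expansion_le hδ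
  refine ⟨aestronglyMeasurable_comp_expansion hδ hf.aestronglyMeasurable hx, ?_⟩
  exact (h x hx _ hf.aestronglyMeasurable.enorm).trans_lt
    (ENNReal.mul_lt_top ENNReal.ofReal_lt_top hf.2)

theorem integrable_comp_expansion_comp {g : Plane → Plane →L[ℝ] ℝ} (hg : Integrable g)
    {x : Plane} (hx : x ≠ 0) :
    Integrable (fun y => (g (expansion δ y x)).comp (expansion δ y)) bumpMeasure := by
  obtain ⟨R, hR0, hR⟩ := exists_norm_expansion_le δ
  have h1 := integrable_comp_expansion hδ hg hx
  refine (h1.norm.const_mul R).mono' ?_ ?_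
  · have hc : Continuous fun p : (Plane →L[ℝ] ℝ) × (Plane →L[ℝ] Plane) => p.1.comp p.2 := by
      fun_prop
    exact hc.comp_aestronglyMeasurable (h1.aestronglyMeasurable.prodMk
      (continuous_expansion_left δ).aestronglyMeasurable)
  · filter_upwards [ae_bumpMeasure_norm_le] with y hy
    refine (ContinuousLinearMap.opNorm_comp_le _ _).trans ?_
    rw [mul_comm]
    exact mul_le_mul_of_nonneg_right (hR y hy) (norm_nonneg _)

theorem exists_smoothing_sub_le :
    ∃ C : ℝ, 0 ≤ C ∧ ∀ x : Plane, x ≠ 0 →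
      (∀ u u' : Plane → ℝ, Integrable u → Integrable u' →
        ‖smoothing δ u x - smoothing δ u' x‖ₑ ≤
          ENNReal.ofReal (C / ‖x‖ ^ 2) * ∫⁻ z, ‖u z - u' z‖ₑ) ∧
      (∀ g g' : Plane → Plane →L[ℝ] ℝ, Integrable g → Integrable g' →
        ‖smoothingForm δ g x - smoothingForm δ g' x‖ₑ ≤
          ENNReal.ofReal (C / ‖x‖ ^ 2) * ∫⁻ z, ‖g z - g' z‖ₑ) := by
  obtain ⟨C, hC, h⟩ := exists_lintegral_comp_expansion_le hδ
  obtain ⟨R, hR0, hR⟩ := exists_norm_expansion_le δ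
  refine ⟨max 1 R * C, by positivity, fun x hx => ⟨fun u u' hu hu' => ?_, fun g g' hg hg' => ?_⟩⟩
  · rw [smoothing, smoothing, ← integral_sub (integrable_comp_expansion hδ hu hx)
      (integrable_comp_expansion hδ hu' hx)]
    refine (enorm_integral_le_lintegral_enorm _).trans ?_
    refine (h x hx (fun z => ‖u z - u' z‖ₑ) (hu.sub hu').aestronglyMeasurable.enorm).trans ?_
    gcongr
    exact le_mul_of_one_le_left hC (le_max_left _ _)
  · rw [smoothingForm, smoothingForm, ← integral_sub (integrable_comp_expansion_comp hδ hg hx)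
      (integrable_comp_expansion_comp hδ hg' hx)]
    refine (enorm_integral_le_lintegral_enorm _).trans ?_
    have hm : AEMeasurable fun z => ‖g z - g' z‖ₑ := (hg.sub hg').aestronglyMeasurable.enorm
    calc _ ≤ ∫⁻ y, ENNReal.ofReal R *
            ‖g (expansion δ y x) - g' (expansion δ y x)‖ₑ ∂bumpMeasure := by
          refine lintegral_mono_ae ?_
          filter_upwards [ae_bumpMeasure_norm_le] with y hy
          rw [← ContinuousLinearMap.sub_comp, ← ofReal_norm, ← ofReal_norm,
            ← ENNReal.ofReal_mul hR0]
          refine ENNReal.ofReal_le_ofReal ((ContinuousLinearMap.opNorm_comp_le _ _).trans ?_)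
          rw [mul_comm]
          exact mul_le_mul_of_nonneg_right (hR y hy) (norm_nonneg _)
      _ ≤ ENNReal.ofReal R * (ENNReal.ofReal (C / ‖x‖ ^ 2) * ∫⁻ z, ‖g z - g' z‖ₑ) := by
          rw [lintegral_const_mul' _ _ ENNReal.ofReal_ne_top]
          gcongr
          exact h x hx _ hm
      _ ≤ _ := by
          rw [← mul_assoc, ← ENNReal.ofReal_mul hR0, ← mul_div_assoc]
          gcongr
          exact le_max_right _ _

end Estimates

theorem hasFDerivAt_smoothing_of_contDiff (δ : ℝ) {η : Plane → ℝ} (hη : ContDiff ℝ 1 η)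
    (hc : HasCompactSupport η) (x : Plane) :
    HasFDerivAt (smoothing δ η) (smoothingForm δ (fderiv ℝ η) x) x := by
  obtain ⟨R, hR0, hR⟩ := exists_norm_expansion_le δ
  have hd := hη.continuous_fderiv one_ne_zero
  obtain ⟨M, hM⟩ := hd.bounded_above_of_compact_support (hc.fderiv ℝ)
  have he := continuous_expansion_left δ
  obtain ⟨M', hM'⟩ := hη.continuous.bounded_above_of_compact_support hc
  refine hasFDerivAt_integral_of_dominated_of_fderiv_le (𝕜 := ℝ) (bound := fun _ => M * R)
    (F := fun z y => η (expansion δ y z))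
    (F' := fun z y => (fderiv ℝ η (expansion δ y z)).comp (expansion δ y)) (s := univ) (μ := bumpMeasure) univ_mem ?_ ?_ ?_ ?_ (integrable_const _) ?_
  · exact Eventually.of_forall fun z => by
      have : Continuous fun y => η (expansion δ y z) := hη.continuous.comp (by fun_prop)
      exact this.aestronglyMeasurable
  · have : Continuous fun y => η (expansion δ y x) := hη.continuous.comp (by fun_prop)
    exact (integrable_const (μ := bumpMeasure) M').mono' this.aestronglyMeasurable (ae_of_all _ fun y => hM' _)
  · have h1 : Continuous fun y => fderiv ℝ η (expansion δ y x) := hd.comp (by fun_prop)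
    have : Continuous fun y => (fderiv ℝ η (expansion δ y x)).comp (expansion δ y) := by fun_prop
    exact this.aestronglyMeasurable
  · filter_upwards [ae_bumpMeasure_norm_le] with y hy z _
    refine (ContinuousLinearMap.opNorm_comp_le _ _).trans ?_
    exact mul_le_mul (hM _) (hR y hy) (norm_nonneg _) ((norm_nonneg _).trans (hM 0))
  · refine ae_of_all _ fun y z _ => ?_
    exact (hη.differentiable one_ne_zero _).hasFDerivAt.comp z (expansion δ y).hasFDerivAt

/-- `u` with the weak gradient `g` is the limit in `W^{1,1}` of smooth functions. -/
def IsLimitOfSmooth (u : Plane → ℝ) (g : Plane → Plane →L[ℝ] ℝ) : Prop :=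
  ∀ ε : ℝ≥0∞, 0 < ε → ∃ η : Plane → ℝ, ContDiff ℝ 1 η ∧ HasCompactSupport η ∧
    ∫⁻ x, ‖u x - η x‖ₑ ≤ ε ∧ ∫⁻ x, ‖g x - fderiv ℝ η x‖ₑ ≤ ε

/-- For smooth approximations in `W^{1,1}` one differentiates under the integral. The bound with `C
/ ‖x‖ ^ 2` makes the averages of the functions and of their derivatives converge, the latter locally
uniformly off the origin, and the derivative passes to the limit. -/
theorem hasFDerivAt_smoothing {δ : ℝ} (hδ : 0 < δ) {u : Plane → ℝ} {g : Plane → Plane →L[ℝ] ℝ}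
    (hu : Integrable u) (hg : Integrable g) (hug : IsLimitOfSmooth u g) {x : Plane} (hx : x ≠ 0) :
    HasFDerivAt (smoothing δ u) (smoothingForm δ g x) x := by
  obtain ⟨C, hC, h⟩ := exists_smoothing_sub_le hδ
  choose η hη hηc hηu hηg using fun n : ℕ =>
    hug (ENNReal.ofReal (1 / ((n : ℝ) + 1))) (ENNReal.ofReal_pos.2 (by positivity))
  have hηi : ∀ n, Integrable (η n) := fun n => (hη n).continuous.integrable_of_hasCompactSupport
    (hηc n)
  have hηi' : ∀ n, Integrable (fderiv ℝ (η n)) := fun n =>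
    ((hη n).continuous_fderiv one_ne_zero).integrable_of_hasCompactSupport ((hηc n).fderiv ℝ)
  have hb : ∀ z : Plane, z ≠ 0 → ∀ n : ℕ,
      dist (smoothing δ u z) (smoothing δ (η n) z) ≤ C / ‖z‖ ^ 2 * (1 / ((n : ℝ) + 1)) ∧
      dist (smoothingForm δ g z) (smoothingForm δ (fderiv ℝ (η n)) z) ≤
        C / ‖z‖ ^ 2 * (1 / ((n : ℝ) + 1)) := by
    intro z hz n
    constructor
    · have h1 := ((h z hz).1 u (η n) hu (hηi n)).trans (mul_le_mul_right (hηu n) _)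
      rw [← ofReal_norm, ← ENNReal.ofReal_mul (by positivity),
        ENNReal.ofReal_le_ofReal_iff (by positivity)] at h1
      rwa [dist_eq_norm]
    · have h1 := ((h z hz).2 g _ hg (hηi' n)).trans (mul_le_mul_right (hηg n) _)
      rw [← ofReal_norm, ← ENNReal.ofReal_mul (by positivity),
        ENNReal.ofReal_le_ofReal_iff (by positivity)] at h1
      rwa [dist_eq_norm]
  have hlim : ∀ c : ℝ, Tendsto (fun n : ℕ => c * (1 / ((n : ℝ) + 1))) atTop (𝓝 0) := fun c => by
    simpa using (tendsto_one_div_add_atTop_nhds_zero_nat (𝕜 := ℝ)).const_mul c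
  refine hasFDerivAt_of_tendstoLocallyUniformlyOn (l := atTop)
    (f := fun n => smoothing δ (η n)) (f' := fun n => smoothingForm δ (fderiv ℝ (η n)))
    (s := {0}ᶜ) isOpen_compl_singleton ?_ (fun n z _ =>
      hasFDerivAt_smoothing_of_contDiff δ (hη n) (hηc n) z) ?_ hx
  · rw [Metric.tendstoLocallyUniformlyOn_iff]
    intro ε hε z hz
    have hz0 : 0 < ‖z‖ := norm_pos_iff.2 hz
    refine ⟨{y | ‖z‖ / 2 < ‖y‖}, mem_nhdsWithin_of_mem_nhds
      ((isOpen_lt continuous_const continuous_norm).mem_nhds (show ‖z‖ / 2 < ‖z‖ by linarith)), ?_⟩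
    filter_upwards [(hlim (C / (‖z‖ / 2) ^ 2)).eventually_lt_const hε] with n hn y hy
    have hy' : ‖z‖ / 2 < ‖y‖ := hy
    have hy0 : y ≠ 0 := norm_pos_iff.1 (by linarith)
    refine ((hb y hy0 n).2.trans ?_).trans_lt hn
    gcongr
  · intro z hz
    rw [tendsto_iff_dist_tendsto_zero]
    refine squeeze_zero (fun _ => dist_nonneg) (fun n => ?_) (hlim (C / ‖z‖ ^ 2))
    rw [dist_comm]
    exact (hb z hz n).1

end

end Checkerboard

/-! ### Smoothness off the origin and the mean value bound -/

namespace Checkerboard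

noncomputable section

/-- The parameter `y` with `expansion δ y x = z`. -/
def expansionInv (δ : ℝ) (x z : Plane) : Plane :=
  (8 / δ / ‖x‖ ^ 2) • cmul (diagonal 1 (-1) x) (diagonal (1 + δ)⁻¹ (1 + 3 * δ)⁻¹ z - x)

theorem expansion_expansionInv {δ : ℝ} (hδ : 0 < δ) {x : Plane} (hx : x ≠ 0) (z : Plane) :
    expansion δ (expansionInv δ x z) x = z := by
  have h1 : (1 + δ) ≠ 0 := by positivity
  have h2 : (1 + 3 * δ) ≠ 0 := by positivity
  have h3 : x 0 ^ 2 + x 1 ^ 2 ≠ 0 := by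
    rw [← norm_sq_eq]; exact pow_ne_zero 2 (norm_ne_zero_iff.2 hx)
  ext i
  fin_cases i <;>
    simp [expansionInv, expansion_apply_zero, expansion_apply_one, norm_sq_eq] <;>
    field_simp <;> ring

/-- The kernel of the operator `smoothing δ`. -/
def smoothingKernel (δ : ℝ) (x z : Plane) : ℝ :=
  expansionConst δ / ‖x‖ ^ 2 * unitBump.normed volume (expansionInv δ x z)

theorem smoothing_eq_integral_kernel {δ : ℝ} (hδ : 0 < δ) {u : Plane → ℝ}
    (hu : AEStronglyMeasurable u) {x : Plane} (hx : x ≠ 0) :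
    smoothing δ u x = ∫ z, u z * smoothingKernel δ x z := by
  have hY : Continuous (expansionInv δ x) := by unfold expansionInv; fun_prop
  have hm : AEStronglyMeasurable
      (fun z => unitBump.normed volume (expansionInv δ x z) * u z) :=
    (unitBump.continuous_normed.comp hY).aestronglyMeasurable.mul hu
  rw [smoothing, integral_bumpMeasure]
  have h1 := integral_comp_expansion hδ hx hm
  have h2 : ∀ y, expansionInv δ x (expansion δ y x) = y := expansion_left_inverse hδ hx
  simp only [h2] at h1
  rw [h1, ← integral_const_mul]
  congr 1; ext z
  rw [smoothingKernel]; ring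

/-- After the change of variables `x` enters only through the kernel, which is smooth in both
variables for `x ≠ 0` and, for bounded `x`, vanishes for `z` outside a fixed ball. -/
theorem contDiffOn_smoothing {δ : ℝ} (hδ : 0 < δ) {u : Plane → ℝ} (hu : Integrable u) :
    ContDiffOn ℝ (⊤ : ℕ∞) (smoothing δ u) {0}ᶜ := by
  obtain ⟨R, hR0, hR⟩ := exists_norm_expansion_le δ
  intro x₀ hx₀
  set s : Set Plane := Metric.ball 0 (‖x₀‖ + 1) ∩ {0}ᶜ with hs
  have hso : IsOpen s := Metric.isOpen_ball.inter isOpen_compl_singleton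
  have hxs : x₀ ∈ s := ⟨by simp, hx₀⟩
  suffices h : ContDiffOn ℝ (⊤ : ℕ∞) (smoothing δ u) s from
    (h.contDiffAt (hso.mem_nhds hxs)).contDiffWithinAt
  have hk : ContDiffOn ℝ (⊤ : ℕ∞) (fun p : Plane × Plane => smoothingKernel δ p.1 (-p.2))
      (s ×ˢ univ) := by
    have hn : ∀ p ∈ s ×ˢ (univ : Set Plane), ‖p.1‖ ^ 2 ≠ 0 := fun p hp =>
      pow_ne_zero 2 (norm_ne_zero_iff.2 hp.1.2)
    have hn2 : ContDiffOn ℝ (⊤ : ℕ∞) (fun p : Plane × Plane => ‖p.1‖ ^ 2) (s ×ˢ univ) :=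
      ((contDiff_norm_sq ℝ).comp contDiff_fst).contDiffOn
    have h1 : ContDiff ℝ (⊤ : ℕ∞) (fun p : Plane × Plane => cmul (diagonal 1 (-1) p.1)
        (diagonal (1 + δ)⁻¹ (1 + 3 * δ)⁻¹ (-p.2) - p.1)) := by fun_prop
    have h2 : ContDiffOn ℝ (⊤ : ℕ∞) (fun p : Plane × Plane => expansionInv δ p.1 (-p.2))
        (s ×ˢ univ) := (contDiffOn_const.div hn2 hn).smul h1.contDiffOn
    exact (contDiffOn_const.div hn2 hn).mul (unitBump.contDiff_normed.comp_contDiffOn h2)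
  -- The integral is read as a convolution with parameter `x`, evaluated at the point `0`; hence the
  -- reflected argument `-z` of the kernel.
  have key := contDiffOn_convolution_right_with_param_comp (μ := (volume : Measure Plane))
    (ContinuousLinearMap.mul ℝ ℝ)
    (s := s) (v := fun _ => (0 : Plane)) contDiffOn_const (f := u)
    (g := fun x z => smoothingKernel δ x (-z)) hso
    (isCompact_closedBall (0 : Plane) (R * (‖x₀‖ + 1))) ?_ hu.locallyIntegrable hk
  · refine key.congr fun x hx => ?_
    rw [smoothing_eq_integral_kernel hδ hu.aestronglyMeasurable hx.2]
    simp [convolution_def]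
  · intro x z hx hz
    by_contra hne
    refine hz ?_
    have h1 : unitBump.normed volume (expansionInv δ x (-z)) ≠ 0 := right_ne_zero_of_mul hne
    have h2 : expansionInv δ x (-z) ∈ Function.support (unitBump.normed volume) := h1
    rw [unitBump.support_normed_eq] at h2
    have h3 : ‖expansionInv δ x (-z)‖ ≤ 1 := (mem_ball_zero_iff.1 h2).le
    have h4 := expansion_expansionInv hδ hx.2 (-z)
    have h5 : ‖x‖ < ‖x₀‖ + 1 := mem_ball_zero_iff.1 hx.1
    rw [mem_closedBall_zero_iff, ← norm_neg, ← h4]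
    refine (ContinuousLinearMap.le_opNorm _ _).trans ?_
    exact mul_le_mul (hR _ h3) h5.le (norm_nonneg _) hR0

variable {Φ : Plane → ℝ → ℝ} {K : ℝ}

/-- Jensen's inequality and Fubini's theorem for the smoothing of a form. -/
theorem YoungFamily.lintegral_smoothingForm_sub_le (hΦ : YoungFamily Φ K) {δ : ℝ} (hδ : 0 < δ)
    {g : Plane → Plane →L[ℝ] ℝ} (hgm : StronglyMeasurable g) (hg : Integrable g) {ε : ℝ≥0∞}
    (h : ∀ y, ‖y‖ ≤ 1 → ∫⁻ x, ENNReal.ofReal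
      (Φ x ‖(g (expansion δ y x)).comp (expansion δ y) - g x‖) ≤ ε) :
    ∫⁻ x, ENNReal.ofReal (Φ x ‖smoothingForm δ g x - g x‖) ≤ ε := by
  have hA : Continuous fun p : Plane × Plane => expansion δ p.2 :=
    (continuous_expansion_left δ).comp continuous_snd
  have hAx : Continuous fun p : Plane × Plane => expansion δ p.2 p.1 := hA.clm_apply continuous_fst
  have hm1 : StronglyMeasurable fun p : Plane × Plane =>
      (g (expansion δ p.2 p.1)).comp (expansion δ p.2) - g p.1 := by
    have hc : Continuous fun p : (Plane →L[ℝ] ℝ) × (Plane →L[ℝ] Plane) => p.1.comp p.2 := by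
      fun_prop
    exact (hc.comp_stronglyMeasurable ((hgm.comp_measurable hAx.measurable).prodMk
      hA.stronglyMeasurable)).sub (hgm.comp_measurable measurable_fst)
  have hm : Measurable fun p : Plane × Plane => ENNReal.ofReal
      (Φ p.1 ‖(g (expansion δ p.2 p.1)).comp (expansion δ p.2) - g p.1‖) :=
    (hΦ.meas.comp (measurable_fst.prodMk hm1.norm.measurable)).ennreal_ofReal
  calc ∫⁻ x, ENNReal.ofReal (Φ x ‖smoothingForm δ g x - g x‖)
      ≤ ∫⁻ x, ∫⁻ y, ENNReal.ofReal
        (Φ x ‖(g (expansion δ y x)).comp (expansion δ y) - g x‖) ∂bumpMeasure := by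
        refine lintegral_mono_ae ?_
        have h0 : ∀ᵐ x : Plane, x ≠ 0 := by
          simp [ae_iff, measure_singleton]
        filter_upwards [h0] with x hx
        have hi := integrable_comp_expansion_comp hδ hg hx
        have h1 : smoothingForm δ g x - g x =
            ∫ y, ((g (expansion δ y x)).comp (expansion δ y) - g x) ∂bumpMeasure := by
          rw [integral_sub hi (integrable_const _)]; simp [smoothingForm]
        rw [h1]
        exact (hΦ.young x).ofReal_norm_integral_le (hi.sub (integrable_const _))
    _ = ∫⁻ y, (∫⁻ x, ENNReal.ofReal
        (Φ x ‖(g (expansion δ y x)).comp (expansion δ y) - g x‖)) ∂bumpMeasure :=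
        lintegral_lintegral_swap hm.aemeasurable
    _ ≤ ∫⁻ _, ε ∂bumpMeasure := by
        refine lintegral_mono_ae ?_
        filter_upwards [ae_bumpMeasure_norm_le] with y hy using h y hy
    _ = ε := by simp

/-- At `z = expansion δ y x` the pulled-back form has norm at most `2 ‖g z‖ ≤ 4 ‖x‖ ‖g z‖ / ‖z‖`,
because `‖z‖ ≤ 2 ‖x‖`; moreover `z` has no smaller weight than `x`. The change of variables
contributes `C / ‖x‖ ^ 2`, so all powers of `‖x‖` cancel. -/
theorem exists_enorm_smoothingForm_le {δ : ℝ} (hδ : 0 < δ) (hδ1 : δ ≤ 1)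
    (hnorm : ∀ y, ‖y‖ ≤ 1 → ‖expansion δ y‖ ≤ 2)
    {g : Plane → Plane →L[ℝ] ℝ} (hg : Integrable g) :
    ∃ B : ℝ≥0∞, B ≠ ∞ ∧ ∀ x : Plane, x ≠ 0 →
      ‖x‖ₑ * ‖smoothingForm δ g x‖ₑ ≤
        B * ∫⁻ z in {z | ‖z‖ ≤ 2 * ‖x‖ ∧ weight x ≤ weight z}, ENNReal.ofReal (‖g z‖ / ‖z‖) := by
  obtain ⟨C, hC, hle⟩ := exists_lintegral_comp_expansion_le hδ
  refine ⟨ENNReal.ofReal (4 * C), ENNReal.ofReal_ne_top, fun x hx => ?_⟩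
  set S : Set Plane := {z | ‖z‖ ≤ 2 * ‖x‖ ∧ weight x ≤ weight z}
  have hS : MeasurableSet S :=
    (measurableSet_le measurable_norm measurable_const).inter
      (measurableSet_le measurable_const measurable_weight)
  have hx0 : 0 < ‖x‖ := norm_pos_iff.2 hx
  have hf : AEMeasurable (S.indicator fun z => ENNReal.ofReal (‖g z‖ / ‖z‖)) := by
    refine AEMeasurable.indicator ?_ hS
    exact (hg.aestronglyMeasurable.norm.aemeasurable.div
      measurable_norm.aemeasurable).ennreal_ofReal
  have hne : ∀ᵐ y ∂bumpMeasure, expansion δ y x ≠ 0 := by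
    have h0 : ∀ᵐ z : Plane, z ≠ 0 := by simp [ae_iff, measure_singleton]
    exact bumpMeasure_absolutelyContinuous.ae_le
      ((quasiMeasurePreserving_expansion hδ hx).ae h0)
  have h1 : ‖smoothingForm δ g x‖ₑ ≤ ∫⁻ y, ENNReal.ofReal (4 * ‖x‖) *
      (S.indicator fun z => ENNReal.ofReal (‖g z‖ / ‖z‖)) (expansion δ y x) ∂bumpMeasure := by
    refine (enorm_integral_le_lintegral_enorm _).trans (lintegral_mono_ae ?_)
    filter_upwards [ae_bumpMeasure_norm_le, hne] with y hy hy0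
    have hz : ‖expansion δ y x‖ ≤ 2 * ‖x‖ := (ContinuousLinearMap.le_opNorm _ _).trans
      (mul_le_mul_of_nonneg_right (hnorm y hy) (norm_nonneg _))
    have hmem : expansion δ y x ∈ S := ⟨hz, weight_le_weight_expansion hδ hδ1 hy x⟩
    rw [indicator_of_mem hmem, ← ofReal_norm, ← ENNReal.ofReal_mul (by positivity)]
    refine ENNReal.ofReal_le_ofReal ((ContinuousLinearMap.opNorm_comp_le _ _).trans ?_)
    have hz0 := norm_pos_iff.2 hy0
    calc ‖g (expansion δ y x)‖ * ‖expansion δ y‖ ≤ ‖g (expansion δ y x)‖ * 2 := by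
          gcongr; exact hnorm y hy
      _ = 2 * ‖expansion δ y x‖ * (‖g (expansion δ y x)‖ / ‖expansion δ y x‖) := by
          field_simp
      _ ≤ _ := by
          refine mul_le_mul_of_nonneg_right ?_ (by positivity)
          linarith
  rw [lintegral_const_mul' _ _ ENNReal.ofReal_ne_top] at h1
  calc ‖x‖ₑ * ‖smoothingForm δ g x‖ₑ
      ≤ ‖x‖ₑ * (ENNReal.ofReal (4 * ‖x‖) * (ENNReal.ofReal (C / ‖x‖ ^ 2) *
          ∫⁻ z, (S.indicator fun z => ENNReal.ofReal (‖g z‖ / ‖z‖)) z)) := by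
        gcongr; exact h1.trans (mul_le_mul_right (hle x hx _ hf) _)
    _ = _ := by
        rw [lintegral_indicator hS, ← mul_assoc, ← mul_assoc, ← ofReal_norm,
          ← ENNReal.ofReal_mul (by positivity), ← ENNReal.ofReal_mul (by positivity)]
        congr 2
        field_simp

/-- Functions in the energy space are approximated by functions which are smooth away from
the origin. -/
theorem YoungFamily.exists_smoothing (hΦ : YoungFamily Φ K)
    (hw : ∀ x y, weight x ≤ weight y → ∀ t, Φ x t ≤ Φ y t)
    {u : Plane → ℝ} {g : Plane → Plane →L[ℝ] ℝ} (hu : Integrable u) (hg : Integrable g)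
    (hgm : StronglyMeasurable g) (hus : ∀ x, x ∉ square → u x = 0) (hug : IsLimitOfSmooth u g)
    (hgΦ : ∫⁻ x, ENNReal.ofReal (Φ x ‖g x‖) ≠ ∞) {ε : ℝ≥0∞} (hε : 0 < ε) :
    ∃ v : Plane → ℝ, ContDiffOn ℝ (⊤ : ℕ∞) v {0}ᶜ ∧
      (∃ r : ℝ, 0 < r ∧ r < 1 ∧ ∀ x : Plane, (∃ i, r < |x i|) → v x = 0) ∧
      ∫⁻ x, ENNReal.ofReal (Φ x ‖fderiv ℝ v x - g x‖) ≤ ε ∧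
      ∃ B : ℝ≥0∞, B ≠ ∞ ∧ ∀ x : Plane, x ≠ 0 → ‖x‖ₑ * ‖fderiv ℝ v x‖ₑ ≤
        B * ∫⁻ z in {z | ‖z‖ ≤ 2 * ‖x‖ ∧ weight x ≤ weight z}, ENNReal.ofReal (‖g z‖ / ‖z‖) := by
  have h1 := ENNReal.tendsto_nhds_zero.1 (hΦ.tendsto_lintegral_comp_clm_sub hg hgΦ) ε hε
  rw [eventually_inf_principal] at h1
  have h2 := h1.and eventually_det_bounds
  -- At `δ = 0` every expansion is the identity, so compactness of the unit ball provides one `δ`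
  -- that serves all `y`.
  have h3 : ∀ᶠ δ : ℝ in 𝓝 0, ∀ y ∈ Metric.closedBall (0 : Plane) 1, _ :=
    (isCompact_closedBall (0 : Plane) 1).eventually_forall_of_forall_eventually
      (P := fun (δ : ℝ) (y : Plane) => (expansion δ y ∈ {A | ∀ x t, Φ x t ≤ Φ (A x) t} →
        ∫⁻ x, ENNReal.ofReal (Φ x ‖(g (expansion δ y x)).comp (expansion δ y) - g x‖) ≤ ε) ∧
        ‖expansion δ y‖ ≤ 2) (x₀ := 0) fun y _ => by
      have hc := continuous_expansion.tendsto ((0 : ℝ), y)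
      simp only [expansion_zero] at hc
      filter_upwards [hc.eventually h2] with p hp using ⟨hp.1, hp.2.2.2.1⟩
  obtain ⟨d, hd, hball⟩ := Metric.eventually_nhds_iff.1 h3
  set δ := min (d / 2) 1
  have hδ : 0 < δ := lt_min (by linarith) one_pos
  have hδ1 : δ ≤ 1 := min_le_right _ _
  have hP := hball (y := δ) (by
    rw [Real.dist_eq, sub_zero, abs_of_pos hδ]
    exact (min_le_left _ _).trans_lt (by linarith))
  have hfd : ∀ x : Plane, x ≠ 0 → fderiv ℝ (smoothing δ u) x = smoothingForm δ g x := fun x hx =>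
    (hasFDerivAt_smoothing hδ hu hg hug hx).fderiv
  refine ⟨smoothing δ u, contDiffOn_smoothing hδ hu, ⟨1 / (1 + δ / 2), by positivity, ?_, ?_⟩,
    ?_, ?_⟩
  · rw [div_lt_one (by positivity)]; linarith
  · rintro x ⟨i, hi⟩
    rw [smoothing]
    refine integral_eq_zero_of_ae ?_
    filter_upwards [ae_bumpMeasure_norm_le] with y hy
    exact hus _ (expansion_notMem_square hδ hδ1 hy hi)
  · have h0 : ∀ᵐ x : Plane, x ≠ 0 := by simp [ae_iff, measure_singleton]
    calc _ = ∫⁻ x, ENNReal.ofReal (Φ x ‖smoothingForm δ g x - g x‖) := by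
          refine lintegral_congr_ae ?_
          filter_upwards [h0] with x hx
          rw [hfd x hx]
      _ ≤ ε := hΦ.lintegral_smoothingForm_sub_le hδ hgm hg fun y hy =>
          (hP y (by simpa using hy)).1 fun x t => hw _ _ (weight_le_weight_expansion hδ hδ1 hy x) t
  · obtain ⟨B, hB, h⟩ := exists_enorm_smoothingForm_le hδ hδ1
      (fun y hy => (hP y (by simpa using hy)).2) hg
    exact ⟨B, hB, fun x hx => by rw [hfd x hx]; exact h x hx⟩

end

end Checkerboard

/-! ### Cutoff functions of small energy -/

namespace Checkerboard

theorem HasGrowth.conj_ne_top {pm pp : ℝ} {φ : ℝ → ℝ} (h : HasGrowth pm pp φ) (hpm : 1 < pm)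
    (s : ℝ) : conj φ s ≠ ∞ := by
  obtain ⟨c₀, c₁, c₂, hc₀, hc₁, -, hg⟩ := h
  -- Beyond `T` the term `c₁ * t ^ pm` dominates `|s| * t`.
  set T := (|s| / c₁) ^ (1 / (pm - 1)) with hT
  have hT0 : 0 ≤ T := by positivity
  refine ne_top_of_le_ne_top (ENNReal.ofReal_ne_top (r := |s| * T + c₀)) ?_
  refine iSup₂_le fun t ht => ENNReal.ofReal_le_ofReal ?_
  have h1 := (hg t ht).1
  have h2 : s * t ≤ |s| * t := mul_le_mul_of_nonneg_right (le_abs_self s) ht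
  rcases le_total t T with h3 | h3
  · have h4 : |s| * t ≤ |s| * T := mul_le_mul_of_nonneg_left h3 (abs_nonneg s)
    have h5 : 0 ≤ c₁ * t ^ pm := by positivity
    linarith
  · have h4 : |s| * t ≤ c₁ * t ^ pm := by
      rcases eq_or_lt_of_le ht with h0 | h0
      · rw [← h0]; simp; positivity
      have h5 : |s| / c₁ ≤ t ^ (pm - 1) := by
        have h6 := Real.rpow_le_rpow hT0 h3 (by linarith : 0 ≤ pm - 1)
        rwa [hT, ← Real.rpow_mul (by positivity), one_div_mul_cancel (by linarith),
          Real.rpow_one] at h6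
      have h7 : t ^ pm = t ^ (pm - 1) * t := by
        rw [Real.rpow_sub_one h0.ne']; field_simp
      rw [div_le_iff₀ hc₁] at h5
      rw [h7]
      nlinarith
    have : 0 ≤ |s| * T := by positivity
    linarith

/-- A point where half of the supremum is reached serves in place of a maximiser. -/
theorem exists_conj_le {ψ : ℝ → ℝ} (h0 : ψ 0 = 0) {s : ℝ} (hfin : conj ψ s ≠ ∞) :
    ∃ b, 0 ≤ b ∧ ψ b ≤ s * b ∧ conj ψ s ≤ ENNReal.ofReal (2 * (s * b - ψ b)) := by
  rcases eq_or_ne (conj ψ s) 0 with h | h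
  · exact ⟨0, le_rfl, by simp [h0], by simp [h]⟩
  · have h1 : conj ψ s / 2 < conj ψ s := ENNReal.half_lt_self h hfin
    conv_rhs at h1 => unfold conj
    obtain ⟨b, h2⟩ := lt_iSup_iff.1 h1
    obtain ⟨hb, h3⟩ := lt_iSup_iff.1 h2
    refine ⟨b, hb, ?_, ?_⟩
    · have := ENNReal.ofReal_pos.1 ((zero_le).trans_lt h3)
      linarith
    · rw [ENNReal.ofReal_mul (by norm_num), ENNReal.ofReal_ofNat]
      calc conj ψ s = 2 * (conj ψ s / 2) := by
            rw [ENNReal.mul_div_cancel (by norm_num) (by norm_num)]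
        _ ≤ _ := mul_le_mul_right h3.le _

/-- On the interval between `(1/2)^(k+1)` and `(1/2)^k`, with `k = n + j`, monotonicity of the
conjugate bounds the integrand by `conj ψ (2^(k+1)) * (1/2)^k`. -/
theorem DivergesAtZero.tsum_eq_top {ψ : ℝ → ℝ}
    (hdiv : DivergesAtZero fun r => conj ψ (1 / r) * ENNReal.ofReal r) (n : ℕ) :
    ∑' j : ℕ, conj ψ (2 ^ (n + j + 1)) * ENNReal.ofReal (4 * (1 / 4) ^ (n + j + 1)) = ∞ := by
  rw [← top_le_iff, ← hdiv ((1 / 2) ^ n) (by positivity)]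
  have hsub : Ioo (0 : ℝ) ((1 / 2) ^ n) ⊆
      ⋃ j : ℕ, Ico ((1 / 2) ^ (n + j + 1)) ((1 / 2) ^ (n + j)) := by
    intro r hr
    obtain ⟨m, hm1, hm2⟩ := exists_nat_pow_near_of_lt_one hr.1
      (hr.2.le.trans (pow_le_one₀ (by norm_num) (by norm_num))) (by norm_num : (0 : ℝ) < 1 / 2)
      (by norm_num)
    have hnm : n ≤ m := by
      by_contra hlt
      have : (1 / 2 : ℝ) ^ n ≤ (1 / 2) ^ (m + 1) :=
        pow_le_pow_of_le_one (by norm_num) (by norm_num) (by omega)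
      linarith [hr.2]
    rcases eq_or_lt_of_le hm2 with h | h
    · have hnm' : n < m := by
        rcases eq_or_lt_of_le hnm with h' | h'
        · rw [h, h'] at hr; exact absurd hr.2 (lt_irrefl _)
        · exact h'
      refine mem_iUnion.2 ⟨m - 1 - n, ?_⟩
      rw [show n + (m - 1 - n) + 1 = m by omega, show n + (m - 1 - n) = m - 1 by omega]
      refine ⟨h.ge, h.trans_lt ?_⟩
      exact pow_lt_pow_right_of_lt_one₀ (by norm_num) (by norm_num) (by omega)
    · refine mem_iUnion.2 ⟨m - n, ?_⟩
      rw [show n + (m - n) = m by omega]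
      exact ⟨hm1.le, h⟩
  refine (lintegral_mono_set hsub).trans ((lintegral_iUnion_le _ _).trans ?_)
  refine ENNReal.tsum_le_tsum fun j => ?_
  set k := n + j
  calc ∫⁻ r in Ico ((1 / 2 : ℝ) ^ (k + 1)) ((1 / 2) ^ k), conj ψ (1 / r) * ENNReal.ofReal r
      ≤ ∫⁻ _ in Ico ((1 / 2 : ℝ) ^ (k + 1)) ((1 / 2) ^ k),
          conj ψ (2 ^ (k + 1)) * ENNReal.ofReal ((1 / 2) ^ k) := by
        refine setLIntegral_mono' measurableSet_Ico fun r hr => ?_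
        have hr0 : 0 < r := (by positivity : (0 : ℝ) < (1 / 2) ^ (k + 1)).trans_le hr.1
        refine mul_le_mul' (conj_mono ψ ?_) (ENNReal.ofReal_le_ofReal hr.2.le)
        rw [div_le_iff₀ hr0]
        calc (1 : ℝ) = 2 ^ (k + 1) * (1 / 2) ^ (k + 1) := by rw [← mul_pow]; norm_num
          _ ≤ _ := by gcongr; exact hr.1
    _ = conj ψ (2 ^ (k + 1)) * (ENNReal.ofReal ((1 / 2) ^ k) *
          ENNReal.ofReal ((1 / 2) ^ k - (1 / 2) ^ (k + 1))) := by
        rw [setLIntegral_const, Real.volume_Ico, mul_assoc]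
    _ ≤ _ := by
        rw [← ENNReal.ofReal_mul (by positivity)]
        refine mul_le_mul_right (ENNReal.ofReal_le_ofReal ?_) _
        have h1 : (1 / 4 : ℝ) ^ (k + 1) = (1 / 2) ^ (k + 1) * (1 / 2) ^ (k + 1) := by
          rw [← mul_pow]; norm_num
        rw [h1, pow_succ]
        nlinarith [sq_nonneg ((1 / 2 : ℝ) ^ k)]

/-- The derivative vanishes at maxima and minima. Hence the gradients of the dyadic rescalings of
the bump live on pairwise disjoint annuli. -/
theorem fderiv_unitBump_ne_zero {z : Plane} (h : fderiv ℝ unitBump z ≠ 0) :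
    1 / 2 < ‖z‖ ∧ ‖z‖ < 1 := by
  constructor
  · by_contra hz
    refine h (IsLocalMax.fderiv_eq_zero (Eventually.of_forall fun y => ?_))
    rw [unitBump.one_of_mem_closedBall (mem_closedBall_zero_iff.2 (not_lt.1 hz))]
    exact unitBump.le_one
  · by_contra hz
    refine h (IsLocalMin.fderiv_eq_zero (Eventually.of_forall fun y => ?_))
    rw [unitBump.zero_of_le_dist (by rw [dist_zero_right]; exact not_lt.1 hz)]
    exact unitBump.nonneg

/-- If the integral of `ψ^*(1/r) r` diverges at zero, then points have capacity zero. -/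
theorem IsOrlicz.exists_cutoff {ψ : ℝ → ℝ} (h : IsOrlicz ψ) {K : ℝ}
    (hy : Young (fun t => ψ (max t 0)) K) (h2 : DeltaTwo (conj ψ)) (hfin : ∀ s, conj ψ s ≠ ∞)
    (hdiv : DivergesAtZero fun r => conj ψ (1 / r) * ENNReal.ofReal r)
    {δ : ℝ} (hδ : 0 < δ) {ε : ℝ≥0∞} (hε : 0 < ε) :
    ∃ η : Plane → ℝ, ContDiff ℝ (⊤ : ℕ∞) η ∧ (∀ x, 0 ≤ η x ∧ η x ≤ 1) ∧
      (∀ᶠ x in 𝓝 0, η x = 1) ∧ (∀ x, δ ≤ ‖x‖ → η x = 0) ∧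
      ∫⁻ x, ENNReal.ofReal (ψ (max ‖fderiv ℝ η x‖ 0)) ≤ ε := by
  obtain ⟨c, hc, hpow⟩ := h.exists_pow_mul_le h2
  obtain ⟨M, hM⟩ := ((unitBump.contDiff (n := 1)).continuous_fderiv
    one_ne_zero).bounded_above_of_compact_support (unitBump.hasCompactSupport.fderiv ℝ)
  obtain ⟨Q, hQ1, hQ⟩ := hy.exists_map_mul_le M
  set V := (volume (Metric.ball (0 : Plane) 1)).toReal with hV
  have hVtop : volume (Metric.ball (0 : Plane) 1) ≠ ∞ := measure_ball_lt_top.ne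
  obtain ⟨n, hn⟩ : ∃ n : ℕ, (1 / 2 : ℝ) ^ n < δ := exists_pow_lt_of_lt_one hδ (by norm_num)
  -- The energy of the cutoff will be at most `V * Q * (1 / 2) ^ m`.
  obtain ⟨m, hm⟩ : ∃ m : ℕ, ENNReal.ofReal (V * Q * (1 / 2) ^ m) ≤ ε := by
    have h1 : Tendsto (fun m : ℕ => ENNReal.ofReal (V * Q * (1 / 2) ^ m)) atTop (𝓝 0) := by
      have := (tendsto_pow_atTop_nhds_zero_of_lt_one (by norm_num : (0 : ℝ) ≤ 1 / 2)
        (by norm_num)).const_mul (V * Q)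
      simpa using ENNReal.tendsto_ofReal this
    exact (h1.eventually_le_const hε).exists
  -- Since `conj ψ (2 ^ k) ≤ 2 * (2 ^ k * b k)`, divergence of the dyadic series of conjugates
  -- forces the series of `b k * (1 / 2) ^ k` to diverge.
  choose b hb0 hb1 hb2 using fun k : ℕ => exists_conj_le h.map_zero (hfin (2 ^ k))
  have hsum : ∑' j : ℕ, ENNReal.ofReal (8 * (b (n + j + 1) * (1 / 2) ^ (n + j + 1))) = ∞ := by
    rw [← top_le_iff, ← hdiv.tsum_eq_top n]
    refine ENNReal.tsum_le_tsum fun j => ?_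
    set k := n + j + 1
    refine (mul_le_mul_left (hb2 k) _).trans ?_
    rw [← ENNReal.ofReal_mul (by have := hb1 k; linarith)]
    refine ENNReal.ofReal_le_ofReal ?_
    have h1 : (1 / 4 : ℝ) ^ k = (1 / 2) ^ k * (1 / 2) ^ k := by rw [← mul_pow]; norm_num
    have h3 : (2 : ℝ) ^ k * (1 / 2) ^ k = 1 := by rw [← mul_pow]; norm_num
    have h4 : 0 ≤ ψ (b k) := h.nonneg _ (hb0 k)
    calc 2 * (2 ^ k * b k - ψ (b k)) * (4 * (1 / 4) ^ k)
        ≤ 2 * (2 ^ k * b k) * (4 * (1 / 4) ^ k) := by gcongr; linarith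
      _ = 8 * (b k * (1 / 2) ^ k) * (2 ^ k * (1 / 2) ^ k) := by rw [h1]; ring
      _ = _ := by rw [h3, mul_one]
  obtain ⟨s, hs⟩ : ∃ s : Finset ℕ, ENNReal.ofReal (8 * (c / 2) ^ m) <
      ∑ j ∈ s, ENNReal.ofReal (8 * (b (n + j + 1) * (1 / 2) ^ (n + j + 1))) := by
    have : ENNReal.ofReal (8 * (c / 2) ^ m) <
      ∑' j : ℕ, ENNReal.ofReal (8 * (b (n + j + 1) * (1 / 2) ^ (n + j + 1))) := by
      rw [hsum]; exact ENNReal.ofReal_lt_top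
    rw [ENNReal.tsum_eq_iSup_sum] at this
    exact lt_iSup_iff.1 this
  have hbn : ∀ k, 0 ≤ b k * (1 / 2) ^ k := fun k => mul_nonneg (hb0 k) (by positivity)
  rw [← ENNReal.ofReal_sum_of_nonneg fun j _ => mul_nonneg (by norm_num) (hbn _),
    ← Finset.mul_sum] at hs
  set S := ∑ j ∈ s, b (n + j + 1) * (1 / 2) ^ (n + j + 1) with hSdef
  have hcm : 0 < (c / 2) ^ m := by positivity
  have hS : (c / 2) ^ m < S := by
    have := (ENNReal.ofReal_lt_ofReal_iff_of_nonneg (by positivity)).1 hs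
    linarith
  have hS0 : 0 < S := hcm.trans hS
  -- With these convex weights the gradient of the cutoff is at most `M * (b k / S)` on the annulus
  -- of index `k`.
  set β : ℕ → ℝ := fun j => b (n + j + 1) * (1 / 2) ^ (n + j + 1) / S with hβ
  have hβ0 : ∀ j, 0 ≤ β j := fun j => div_nonneg (hbn _) hS0.le
  have hβ1 : ∑ j ∈ s, β j = 1 := by
    rw [hβ, ← Finset.sum_div]; exact div_self hS0.ne'
  have hpk : ∀ k : ℕ, (2 : ℝ) ^ k * (1 / 2) ^ k = 1 := fun k => by rw [← mul_pow]; norm_num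
  set θ : ℕ → Plane → ℝ := fun j x => unitBump ((2 : ℝ) ^ (n + j + 1) • x) with hθ
  have hθc : ∀ j, ContDiff ℝ (⊤ : ℕ∞) (θ j) := fun j =>
    unitBump.contDiff.comp (contDiff_const_smul _)
  have hθd : ∀ j x, fderiv ℝ (θ j) x =
      (2 : ℝ) ^ (n + j + 1) • fderiv ℝ unitBump ((2 : ℝ) ^ (n + j + 1) • x) := fun j x => by
    rw [hθ]; exact fderiv_comp_smul _
  refine ⟨fun x => ∑ j ∈ s, β j * θ j x, ?_, ?_, ?_, ?_, ?_⟩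
  · exact ContDiff.sum fun j _ => contDiff_const.mul (hθc j)
  · intro x
    refine ⟨Finset.sum_nonneg fun j _ => mul_nonneg (hβ0 j) unitBump.nonneg, ?_⟩
    calc _ ≤ ∑ j ∈ s, β j := Finset.sum_le_sum fun j _ =>
          mul_le_of_le_one_right (hβ0 j) unitBump.le_one
      _ = 1 := hβ1
  · have h1 : ∀ᶠ x : Plane in 𝓝 0, ∀ j ∈ s, θ j x = 1 := by
      rw [Filter.eventually_all_finset]
      intro j _
      have h3 : Tendsto (fun x : Plane => (2 : ℝ) ^ (n + j + 1) • x) (𝓝 0) (𝓝 0) := by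
        have : Continuous fun x : Plane => (2 : ℝ) ^ (n + j + 1) • x := by fun_prop
        simpa using this.tendsto 0
      exact h3.eventually unitBump.eventuallyEq_one
    filter_upwards [h1] with x hx
    rw [← hβ1]
    exact Finset.sum_congr rfl fun j hj => by rw [hx j hj, mul_one]
  · intro x hx
    refine Finset.sum_eq_zero fun j _ => ?_
    have : θ j x = 0 := by
      refine unitBump.zero_of_le_dist ?_
      rw [dist_zero_right, norm_smul, norm_pow, Real.norm_ofNat]
      change 1 ≤ _
      have h3 : (1 / 2 : ℝ) ^ (n + j + 1) ≤ ‖x‖ :=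
        (pow_le_pow_of_le_one (by norm_num) (by norm_num) (by omega)).trans (hn.le.trans hx)
      calc (1 : ℝ) = 2 ^ (n + j + 1) * (1 / 2) ^ (n + j + 1) := (hpk _).symm
        _ ≤ _ := by gcongr
    rw [this, mul_zero]
  · have hder : ∀ x, fderiv ℝ (fun x => ∑ j ∈ s, β j * θ j x) x =
        ∑ j ∈ s, β j • fderiv ℝ (θ j) x := by
      intro x
      have hd : ∀ j, DifferentiableAt ℝ (θ j) x := fun j =>
        (hθc j).differentiable (by simp) x
      rw [fderiv_fun_sum fun j _ => (hd j).const_mul _]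
      exact Finset.sum_congr rfl fun j _ => fderiv_const_mul (hd j) _
    set f : ℝ → ℝ := fun t => ψ (max t 0) with hf
    have hpt : ∀ x, ENNReal.ofReal (f ‖∑ j ∈ s, β j • fderiv ℝ (θ j) x‖) ≤
        ∑ j ∈ s, (Metric.ball (0 : Plane) ((1 / 2) ^ (n + j + 1))).indicator
          (fun _ => ENNReal.ofReal (f (M * (b (n + j + 1) / S)))) x := by
      intro x
      by_cases hex : ∃ i ∈ s, fderiv ℝ (θ i) x ≠ 0
      · obtain ⟨i, his, hi⟩ := hex
        have hloc : ∀ j, fderiv ℝ (θ j) x ≠ 0 → 1 / 2 < 2 ^ (n + j + 1) * ‖x‖ ∧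
            2 ^ (n + j + 1) * ‖x‖ < 1 := by
          intro j hj
          rw [hθd] at hj
          have := fderiv_unitBump_ne_zero (right_ne_zero_of_smul hj)
          rwa [norm_smul, norm_pow, Real.norm_ofNat] at this
        have hlt : ∀ i j, i < j → 1 / 2 < (2 : ℝ) ^ (n + i + 1) * ‖x‖ →
            (2 : ℝ) ^ (n + j + 1) * ‖x‖ < 1 → False := by
          intro i j hij h1 h3
          have h4 : (2 : ℝ) ^ (n + i + 1 + 1) ≤ 2 ^ (n + j + 1) :=
            pow_le_pow_right₀ (by norm_num) (by omega)
          have h5 := mul_le_mul_of_nonneg_right h4 (norm_nonneg x)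
          rw [pow_succ] at h5
          linarith
        have huniq : ∀ j ∈ s, j ≠ i → β j • fderiv ℝ (θ j) x = 0 := by
          intro j _ hji
          by_contra hne
          have h1 := hloc j (right_ne_zero_of_smul hne)
          have h3 := hloc i hi
          rcases lt_or_gt_of_ne hji with hlt' | hlt'
          · exact hlt j i hlt' h1.1 h3.2
          · exact hlt i j hlt' h3.1 h1.2
        rw [Finset.sum_eq_single_of_mem i his huniq]
        have hxi : x ∈ Metric.ball (0 : Plane) ((1 / 2) ^ (n + i + 1)) := by
          rw [mem_ball_zero_iff]
          have h1 := (hloc i hi).2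
          have h3 := mul_lt_mul_of_pos_left h1 (by positivity : (0 : ℝ) < (1 / 2) ^ (n + i + 1))
          rwa [← mul_assoc, mul_comm ((1 / 2 : ℝ) ^ (n + i + 1)), hpk, one_mul, mul_one] at h3
        refine le_trans ?_ (Finset.single_le_sum (fun _ _ => zero_le) his)
        rw [indicator_of_mem hxi]
        refine ENNReal.ofReal_le_ofReal (hy.mono ?_)
        rw [hθd, norm_smul, norm_smul, norm_pow, Real.norm_ofNat, Real.norm_of_nonneg (hβ0 i)]
        calc β i * (2 ^ (n + i + 1) * ‖fderiv ℝ unitBump ((2 : ℝ) ^ (n + i + 1) • x)‖)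
            ≤ β i * (2 ^ (n + i + 1) * M) := by
              gcongr
              · exact hβ0 i
              · exact hM _
          _ = M * (b (n + i + 1) / S) * (2 ^ (n + i + 1) * (1 / 2) ^ (n + i + 1)) := by
              rw [hβ]; ring
          _ = _ := by rw [hpk, mul_one]
      · push Not at hex
        rw [Finset.sum_eq_zero fun j hj => by rw [hex j hj, smul_zero]]
        simp [hf, h.map_zero]
    have hval : ∀ k, f (M * (b k / S)) ≤ Q * (1 / 2) ^ m * (2 ^ k * b k / S) := by
      intro k
      have hbS : 0 ≤ b k / S := div_nonneg (hb0 k) hS0.le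
      have hq1 : (c / 2) ^ m / S ≤ 1 := div_le_one_of_le₀ hS.le hS0.le
      have hfe : ∀ t, 0 ≤ t → f t = ψ t := fun t ht => by rw [hf]; simp [ht]
      -- The `∇₂`-condition is applied at `b k / S`, then convexity with the factor `(c / 2) ^ m / S
      -- ≤ 1`, which is why `S` was taken large. The gain over `ψ (b k) / S` is the factor `(1 / 2)
      -- ^ m`.
      have h1 : c ^ m * ψ (b k / S) ≤ (c / 2) ^ m / S * ψ (b k) := by
        have h3 := hy.map_mul_le_of_le_one (by positivity) hq1 (hb0 k)
        rw [hfe _ (mul_nonneg (by positivity) (hb0 k)), hfe _ (hb0 k)] at h3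
        refine (hpow m _ hbS).trans (le_of_eq_of_le ?_ h3)
        congr 1; ring
      have h3 : ψ (b k / S) ≤ (1 / 2) ^ m * (2 ^ k * b k / S) := by
        have hcm' : (c / 2) ^ m = c ^ m * (1 / 2) ^ m := by rw [← mul_pow]; congr 1; ring
        rw [hcm'] at h1
        have h4 : c ^ m * (1 / 2) ^ m / S * ψ (b k) ≤ c ^ m * (1 / 2) ^ m / S * (2 ^ k * b k) := by
          gcongr; exact hb1 k
        have h5 : c ^ m * ψ (b k / S) ≤ c ^ m * ((1 / 2) ^ m * (2 ^ k * b k / S)) := by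
          refine h1.trans (h4.trans_eq ?_); ring
        exact le_of_mul_le_mul_left h5 (by positivity)
      calc f (M * (b k / S)) ≤ Q * f (b k / S) := hQ _ hbS
        _ = Q * ψ (b k / S) := by rw [hfe _ hbS]
        _ ≤ Q * ((1 / 2) ^ m * (2 ^ k * b k / S)) := by gcongr
        _ = _ := by ring
    calc ∫⁻ x, ENNReal.ofReal (f ‖fderiv ℝ (fun x => ∑ j ∈ s, β j * θ j x) x‖)
        ≤ ∫⁻ x, ∑ j ∈ s, (Metric.ball (0 : Plane) ((1 / 2) ^ (n + j + 1))).indicator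
          (fun _ => ENNReal.ofReal (f (M * (b (n + j + 1) / S)))) x := by
          refine lintegral_mono fun x => ?_
          rw [hder]; exact hpt x
      _ = ∑ j ∈ s, ENNReal.ofReal (f (M * (b (n + j + 1) / S))) *
            volume (Metric.ball (0 : Plane) ((1 / 2) ^ (n + j + 1))) := by
          rw [lintegral_finsetSum _ fun j _ => measurable_const.indicator measurableSet_ball]
          exact Finset.sum_congr rfl fun j _ => by
            rw [lintegral_indicator measurableSet_ball, setLIntegral_const]
      _ ≤ ∑ j ∈ s, ENNReal.ofReal (V * Q * (1 / 2) ^ m * β j) := by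
          refine Finset.sum_le_sum fun j _ => ?_
          rw [Measure.addHaar_ball_of_pos _ _ (by positivity : (0 : ℝ) < (1 / 2) ^ (n + j + 1)),
            finrank_euclideanSpace_fin, ← ENNReal.ofReal_toReal hVtop, ← hV,
            ← ENNReal.ofReal_mul (by positivity), ← ENNReal.ofReal_mul (hy.nonneg _)]
          refine ENNReal.ofReal_le_ofReal ?_
          calc f (M * (b (n + j + 1) / S)) * (((1 / 2) ^ (n + j + 1)) ^ 2 * V)
              ≤ Q * (1 / 2) ^ m * (2 ^ (n + j + 1) * b (n + j + 1) / S) *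
                (((1 / 2) ^ (n + j + 1)) ^ 2 * V) := by gcongr; exact hval _
            _ = V * Q * (1 / 2) ^ m * β j * (2 ^ (n + j + 1) * (1 / 2) ^ (n + j + 1)) := by
              rw [hβ]; ring
            _ = _ := by rw [hpk, mul_one]
      _ = ENNReal.ofReal (V * Q * (1 / 2) ^ m) := by
          rw [← ENNReal.ofReal_sum_of_nonneg fun j _ => mul_nonneg (by positivity) (hβ0 j),
            ← Finset.mul_sum, hβ1, mul_one]
      _ ≤ ε := hm

end Checkerboard

/-! ### Existence of a limit at the vertex of a cone -/

namespace Checkerboard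

theorem lintegral_plane {f : Plane → ℝ≥0∞} (hf : Measurable f) :
    ∫⁻ x, f x = ∫⁻ t : ℝ, ∫⁻ s : ℝ, f !₂[s, t] := by
  have h1 : MeasurePreserving (fun p : ℝ × ℝ => (!₂[p.1, p.2] : Plane)) volume volume := by
    have h := (PiLp.volume_preserving_toLp (Fin 2)).comp (volume_preserving_finTwoArrow ℝ).symm
    exact h
  have h2 := h1.lintegral_comp hf
  rw [← h2, Measure.volume_eq_prod]
  exact lintegral_prod_symm (fun p : ℝ × ℝ => f !₂[p.1, p.2]) (hf.comp h1.measurable).aemeasurable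

theorem lintegral_comp_mul_left {a : ℝ} (ha : 0 < a) {f : ℝ → ℝ≥0∞} (hf : Measurable f) :
    ∫⁻ s, f s = ENNReal.ofReal a * ∫⁻ s, f (a * s) := by
  conv_lhs => rw [← Real.smul_map_volume_mul_left ha.ne']
  rw [lintegral_smul_measure, lintegral_map hf (measurable_const_mul a), abs_of_pos ha, smul_eq_mul]

/-- The coordinates `(t s, t)` of the cone `|x₀| < x₁`. -/
theorem lintegral_cone {f : Plane → ℝ≥0∞} (hf : Measurable f) (δ : ℝ) :
    ∫⁻ x in {x : Plane | |x 0| < x 1 ∧ x 1 < δ}, f x =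
      ∫⁻ t in Ioo 0 δ, ∫⁻ s in Ioo (-1) 1, ENNReal.ofReal t * f !₂[t * s, t] := by
  have hS : MeasurableSet {x : Plane | |x 0| < x 1 ∧ x 1 < δ} :=
    (measurableSet_lt (f := fun x : Plane => |x 0|) (g := fun x : Plane => x 1)
      (by fun_prop) (by fun_prop)).inter
    (measurableSet_lt (f := fun x : Plane => x 1) (g := fun _ => δ) (by fun_prop) (by fun_prop))
  rw [← lintegral_indicator hS, lintegral_plane (hf.indicator hS),
    ← lintegral_indicator measurableSet_Ioo]
  refine lintegral_congr fun t => ?_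
  by_cases ht : t ∈ Ioo 0 δ
  · rw [indicator_of_mem ht]
    have hm : Continuous fun s : ℝ => (!₂[s, t] : Plane) := by
      fun_prop
    rw [lintegral_comp_mul_left ht.1 (f := fun s =>
        {x : Plane | |x 0| < x 1 ∧ x 1 < δ}.indicator f !₂[s, t])
        ((hf.indicator hS).comp hm.measurable),
      lintegral_const_mul' _ _ ENNReal.ofReal_ne_top, ← lintegral_indicator measurableSet_Ioo]
    congr 1
    refine lintegral_congr fun s => ?_
    have h1 : |t * s| < t ↔ s ∈ Ioo (-1 : ℝ) 1 := by
      rw [abs_mul, abs_of_pos ht.1, mem_Ioo, ← abs_lt]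
      exact mul_lt_iff_lt_one_right ht.1
    by_cases hs : s ∈ Ioo (-1 : ℝ) 1
    · rw [indicator_of_mem hs, indicator_of_mem]
      exact ⟨by simpa using h1.2 hs, by simpa using ht.2⟩
    · rw [indicator_of_notMem hs, indicator_of_notMem]
      intro h
      exact hs (h1.1 (by simpa using h.1))
  · rw [indicator_of_notMem ht]
    refine (lintegral_congr fun s => ?_).trans (lintegral_zero)
    rw [indicator_of_notMem]
    intro h
    refine ht ⟨?_, by simpa using h.2⟩
    have := (abs_nonneg _).trans_lt h.1
    simpa using this

theorem exists_tendsto_of_integrable_deriv {f f' : ℝ → ℝ} {δ : ℝ} (hδ : 0 < δ)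
    (hf : ∀ t, 0 < t → HasDerivAt f (f' t) t) (hi : IntegrableOn f' (Ioo 0 δ)) :
    ∃ c, Tendsto f (𝓝[>] 0) (𝓝 c) := by
  have hi' : IntegrableOn f' (Icc 0 (δ / 2)) := by
    rw [integrableOn_Icc_iff_integrableOn_Ioc]
    exact hi.mono_set fun t ht => ⟨ht.1, by linarith [ht.2]⟩
  have hI : IntegrableOn f' (uIcc 0 (δ / 2)) := by rwa [uIcc_of_le (by linarith)]
  have hc := (intervalIntegral.continuousOn_primitive_interval_left hI) 0 left_mem_uIcc
  refine ⟨f (δ / 2) - ∫ t in (0 : ℝ)..(δ / 2), f' t, ?_⟩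
  have hsub : Ioo 0 (δ / 2) ∈ 𝓝[>] (0 : ℝ) := Ioo_mem_nhdsGT (by linarith)
  have hc' : Tendsto (fun x => ∫ t in x..(δ / 2), f' t) (𝓝[>] 0)
      (𝓝 (∫ t in (0 : ℝ)..(δ / 2), f' t)) := by
    refine hc.mono_left ?_
    rw [uIcc_of_le (by linarith)]
    exact nhdsWithin_le_of_mem (mem_of_superset hsub Ioo_subset_Icc_self)
  refine (tendsto_const_nhds.sub hc').congr' ?_
  filter_upwards [hsub] with x hx
  rw [intervalIntegral.integral_eq_sub_of_hasDerivAt (f := f)]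
  · ring
  · intro t ht
    rw [uIcc_of_le hx.2.le] at ht
    exact hf t (hx.1.trans_le ht.1)
  · rw [intervalIntegrable_iff_integrableOn_Ioc_of_le hx.2.le]
    exact hi'.mono_set fun t ht => ⟨hx.1.le.trans ht.1.le, ht.2⟩

theorem norm_le_two_mul {x : Plane} {t : ℝ} (h0 : |x 0| ≤ t) (h1 : |x 1| ≤ t) : ‖x‖ ≤ 2 * t := by
  have ht : 0 ≤ t := (abs_nonneg _).trans h0
  refine abs_le_of_sq_le_sq' ?_ (by positivity) |>.2
  rw [norm_sq_eq]
  have a0 := sq_le_sq' (by linarith [(abs_le.1 h0).1]) (abs_le.1 h0).2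
  have a1 := sq_le_sq' (by linarith [(abs_le.1 h1).1]) (abs_le.1 h1).2
  nlinarith

theorem hasFDerivAt_of_contDiffOn {v : Plane → ℝ} (hv : ContDiffOn ℝ 1 v {0}ᶜ) {x : Plane}
    (hx : x ≠ 0) : HasFDerivAt v (fderiv ℝ v x) x :=
  ((hv.contDiffAt (isOpen_compl_singleton.mem_nhds hx)).differentiableAt one_ne_zero).hasFDerivAt

/-- A function whose derivative is integrable with the weight `1/|x|` and is `o(1/|x|)` in the cone
`|x₀| < x₁` has a limit at the vertex of the cone. -/
theorem exists_limit_cone {v : Plane → ℝ} (hv : ContDiffOn ℝ 1 v {0}ᶜ) {δ : ℝ} (hδ : 0 < δ)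
    (h1 : ∫⁻ x in {x : Plane | |x 0| < x 1 ∧ x 1 < δ},
      ENNReal.ofReal (‖fderiv ℝ v x‖ / ‖x‖) ≠ ∞)
    (h2 : ∀ ε > 0, ∃ r > 0, ∀ x : Plane, |x 0| < x 1 → ‖x‖ < r → ‖x‖ * ‖fderiv ℝ v x‖ ≤ ε) :
    ∃ c, ∀ ε > 0, ∃ r > 0, ∀ x : Plane, x ≠ 0 → |x 0| ≤ x 1 → ‖x‖ < r → |v x - c| ≤ ε := by
  have hDm : Measurable fun x : Plane => ‖fderiv ℝ v x‖ := (measurable_fderiv ℝ v).norm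
  have hpair : Continuous fun p : ℝ × ℝ => (!₂[p.1 * p.2, p.1] : Plane) := by fun_prop
  -- The Jacobian `t` of the cone coordinates compensates the weight `1/‖x‖ ≥ 1/(2t)`.
  have h3 : ∫⁻ s in Ioo (-1 : ℝ) 1, ∫⁻ t in Ioo 0 δ,
      ENNReal.ofReal (‖fderiv ℝ v !₂[t * s, t]‖ / 2) ≠ ∞ := by
    have hsw : ∫⁻ s in Ioo (-1 : ℝ) 1, ∫⁻ t in Ioo 0 δ,
        ENNReal.ofReal (‖fderiv ℝ v !₂[t * s, t]‖ / 2) =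
        ∫⁻ t in Ioo 0 δ, ∫⁻ s in Ioo (-1 : ℝ) 1,
        ENNReal.ofReal (‖fderiv ℝ v !₂[t * s, t]‖ / 2) := by
      refine lintegral_lintegral_swap (Measurable.aemeasurable ?_)
      have : Measurable fun p : ℝ × ℝ => ‖fderiv ℝ v !₂[p.2 * p.1, p.2]‖ :=
        hDm.comp (hpair.measurable.comp measurable_swap)
      exact (this.div_const 2).ennreal_ofReal
    rw [hsw]
    rw [lintegral_cone (f := fun x => ENNReal.ofReal (‖fderiv ℝ v x‖ / ‖x‖)) ((hDm.div measurable_norm).ennreal_ofReal)] at h1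
    refine ne_top_of_le_ne_top h1 ?_
    refine setLIntegral_mono' measurableSet_Ioo fun t ht => ?_
    refine setLIntegral_mono' measurableSet_Ioo fun s hs => ?_
    rw [← ENNReal.ofReal_mul ht.1.le]
    refine ENNReal.ofReal_le_ofReal ?_
    have ht0 : 0 < t := ht.1
    have hs1 : |s| < 1 := abs_lt.2 hs
    have hle : ‖(!₂[t * s, t] : Plane)‖ ≤ 2 * t := norm_le_two_mul
      (by simp [abs_mul, abs_of_pos ht.1]; nlinarith) (by simp [abs_of_pos ht.1])
    have hpos : 0 < ‖(!₂[t * s, t] : Plane)‖ := by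
      refine norm_pos_iff.2 fun h => ht.1.ne' ?_
      have := congrArg (fun z : Plane => z 1) h
      simpa using this
    rw [mul_div_assoc', div_le_div_iff₀ (by norm_num) hpos]
    have := norm_nonneg (fderiv ℝ v !₂[t * s, t])
    nlinarith
  -- By Fubini's theorem the derivative is integrable along almost every ray; one such ray defines
  -- the limit.
  obtain ⟨s, hs, hsfin⟩ : ∃ s ∈ Ioo (-1 : ℝ) 1, ∫⁻ t in Ioo 0 δ,
      ENNReal.ofReal (‖fderiv ℝ v !₂[t * s, t]‖ / 2) < ∞ := by
    have hm : Measurable fun s : ℝ => ∫⁻ t in Ioo 0 δ,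
        ENNReal.ofReal (‖fderiv ℝ v !₂[t * s, t]‖ / 2) := by
      refine Measurable.lintegral_prod_right' (ν := volume.restrict (Ioo 0 δ))
        (f := fun p : ℝ × ℝ => ENNReal.ofReal (‖fderiv ℝ v !₂[p.2 * p.1, p.2]‖ / 2)) ?_
      have : Measurable fun p : ℝ × ℝ => ‖fderiv ℝ v !₂[p.2 * p.1, p.2]‖ :=
        hDm.comp (hpair.measurable.comp measurable_swap)
      exact (this.div_const 2).ennreal_ofReal
    have hae := (ae_lt_top hm h3).and (ae_restrict_mem measurableSet_Ioo)
    have : NeBot (ae (volume.restrict (Ioo (-1 : ℝ) 1))) := by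
      rw [ae_restrict_neBot]; simp
    obtain ⟨s, hs1, hs2⟩ := hae.exists
    exact ⟨s, hs2, hs1⟩
  have hs1 : |s| < 1 := abs_lt.2 hs
  set p : Plane := !₂[s, 1] with hp
  have hp2 : ‖p‖ ≤ 2 := by
    have := norm_le_two_mul (x := p) (t := 1) (by simpa [hp] using hs1.le) (by simp [hp])
    linarith
  have htp : ∀ t : ℝ, t • p = !₂[t * s, t] := by
    intro t; ext i; fin_cases i <;> simp [hp]
  have hp0 : ∀ t : ℝ, 0 < t → t • p ≠ 0 := by
    intro t ht h
    have := congrArg (fun z : Plane => z 1) h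
    simp [hp] at this; exact ht.ne' this
  have hder : ∀ t : ℝ, 0 < t → HasDerivAt (fun t : ℝ => v (t • p)) (fderiv ℝ v (t • p) p) t := by
    intro t ht
    have h4 : HasDerivAt (fun t : ℝ => t • p) p t := by
      simpa using (hasDerivAt_id t).smul_const p
    exact (hasFDerivAt_of_contDiffOn hv (hp0 t ht)).comp_hasDerivAt t h4
  obtain ⟨c, hc⟩ := exists_tendsto_of_integrable_deriv hδ hder (by
    have hm : Measurable fun t : ℝ => fderiv ℝ v (t • p) p := by
      have hmt : Measurable fun t : ℝ => t • p := by fun_prop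
      exact ((measurable_fderiv_apply_const ℝ v p).comp hmt)
    refine ⟨hm.aestronglyMeasurable, ?_⟩
    calc ∫⁻ t in Ioo 0 δ, ‖fderiv ℝ v (t • p) p‖ₑ
        ≤ ∫⁻ t in Ioo 0 δ, ENNReal.ofReal 4 * ENNReal.ofReal (‖fderiv ℝ v !₂[t * s, t]‖ / 2) := by
          refine lintegral_mono fun t => ?_
          rw [← ofReal_norm, ← ENNReal.ofReal_mul (by norm_num), htp]
          refine ENNReal.ofReal_le_ofReal ((ContinuousLinearMap.le_opNorm _ _).trans ?_)
          have := norm_nonneg (fderiv ℝ v !₂[t * s, t])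
          nlinarith
      _ < ∞ := by
          rw [lintegral_const_mul' _ _ ENNReal.ofReal_ne_top]
          exact ENNReal.mul_lt_top ENNReal.ofReal_lt_top hsfin)
  have hopen : ∀ ε > 0, ∃ r > 0, ∀ x : Plane, |x 0| < x 1 → ‖x‖ < r → |v x - c| ≤ ε := by
    intro ε hε
    obtain ⟨r₁, hr₁, hD⟩ := h2 (ε / 4) (by positivity)
    obtain ⟨r₂, hr₂, hlim⟩ := mem_nhdsGT_iff_exists_Ioo_subset.1
      (hc.eventually (Metric.closedBall_mem_nhds c (by positivity : 0 < ε / 2)))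
    refine ⟨min (r₁ / 2) r₂, lt_min (by positivity) hr₂, fun x hx hxr => ?_⟩
    set t := x 1 with ht
    have ht0 : 0 < t := (abs_nonneg _).trans_lt hx
    have htx : t ≤ ‖x‖ := (le_abs_self _).trans (abs_apply_le_norm x 1)
    have hf : |v (t • p) - c| ≤ ε / 2 :=
      hlim ⟨ht0, htx.trans_lt (hxr.trans_le (min_le_right _ _))⟩
    -- The horizontal segment from the chosen ray to `x` stays in the cone at height `t`. There the
    -- derivative is at most `ε / 4 / t`, and the segment has length at most `2 * t`.
    have hseg : ∀ y ∈ segment ℝ (t • p) x, y 1 = t ∧ |y 0| < t := by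
      rintro y ⟨a, b, ha, hb, hab, rfl⟩
      refine ⟨?_, ?_⟩
      · simp [hp, ← ht, ← add_mul, hab]
      · have e : (a • t • p + b • x) 0 = a * (t * s) + b * x 0 := by simp [hp]
        rw [e]
        have h5 : |a * (t * s)| ≤ a * (t * |s|) := by
          rw [abs_mul, abs_mul, abs_of_nonneg ha, abs_of_pos ht0]
        have h6 : |b * x 0| = b * |x 0| := by rw [abs_mul, abs_of_nonneg hb]
        have h7 : t * |s| < t := by nlinarith
        have h8 := abs_add_le (a * (t * s)) (b * x 0)
        rcases eq_or_lt_of_le ha with h9 | h9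
        · have : b = 1 := by linarith
          subst this; rw [← h9] at h8 h5 ⊢; simp at *; linarith
        · nlinarith
    have hmv : ‖v x - v (t • p)‖ ≤ ε / 4 / t * ‖x - t • p‖ := by
      refine (convex_segment (𝕜 := ℝ) (t • p) x).norm_image_sub_le_of_norm_hasFDerivWithin_le
        (f' := fun y => fderiv ℝ v y) (fun y hy => ?_) (fun y hy => ?_)
        (left_mem_segment ℝ _ _) (right_mem_segment ℝ _ _)
      · obtain ⟨hy1, hy0⟩ := hseg y hy
        have : y ≠ 0 := by rintro rfl; simp at hy1; exact ht0.ne hy1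
        exact (hasFDerivAt_of_contDiffOn hv this).hasFDerivWithinAt
      · obtain ⟨hy1, hy0⟩ := hseg y hy
        have hyt : t ≤ ‖y‖ := by
          rw [← hy1]; exact (le_abs_self _).trans (abs_apply_le_norm y 1)
        have hy2 : ‖y‖ ≤ 2 * t := norm_le_two_mul hy0.le (by rw [hy1, abs_of_pos ht0])
        have hyr : ‖y‖ < r₁ := by linarith [min_le_left (r₁ / 2) r₂]
        have := hD y (by rw [hy1]; exact hy0) hyr
        rw [le_div_iff₀ ht0]
        nlinarith [norm_nonneg (fderiv ℝ v y)]
    have hxp : ‖x - t • p‖ ≤ 2 * t := by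
      have e1 : (x - t • p) 1 = 0 := by simp [hp, ← ht]
      have e0 : (x - t • p) 0 = x 0 - t * s := by simp [hp]
      have hts : |t * s| < t := by rw [abs_mul, abs_of_pos ht0]; nlinarith
      have h9 : ‖x - t • p‖ ^ 2 ≤ (2 * t) ^ 2 := by
        rw [norm_sq_eq, e1, e0]
        have := abs_sub (x 0) (t * s)
        have h10 : |x 0 - t * s| ≤ 2 * t := by linarith
        have := sq_le_sq' (by linarith [(abs_le.1 h10).1]) (abs_le.1 h10).2
        linarith
      exact (abs_le_of_sq_le_sq' h9 (by positivity)).2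
    have h11 : ε / 4 / t * ‖x - t • p‖ ≤ ε / 2 := by
      calc ε / 4 / t * ‖x - t • p‖ ≤ ε / 4 / t * (2 * t) := by gcongr
        _ = ε / 2 := by field_simp; ring
    rw [Real.norm_eq_abs] at hmv
    have := abs_sub_le (v x) (v (t • p)) c
    linarith
  refine ⟨c, fun ε hε => ?_⟩
  obtain ⟨r, hr, h⟩ := hopen ε hε
  refine ⟨r, hr, fun x hx0 hx hxr => ?_⟩
  have hx1 : 0 < x 1 := by
    rcases eq_or_lt_of_le ((abs_nonneg _).trans hx) with h4 | h4
    · exfalso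
      refine hx0 ?_
      have h5 : x 0 = 0 := abs_nonpos_iff.1 (hx.trans h4.ge)
      ext i; fin_cases i
      · exact h5
      · exact h4.symm
    · exact h4
  -- Points on the boundary of the cone are limits of interior points at the same height, and `v` is
  -- continuous off the origin.
  have hcont : Continuous fun q : ℝ => (!₂[q * x 0, x 1] : Plane) := by fun_prop
  have hx' : (!₂[1 * x 0, x 1] : Plane) = x := by ext i; fin_cases i <;> simp
  have hlim : Tendsto (fun q : ℝ => |v !₂[q * x 0, x 1] - c|) (𝓝[<] 1) (𝓝 |v x - c|) := by
    have h4 : Tendsto (fun q : ℝ => (!₂[q * x 0, x 1] : Plane)) (𝓝[<] 1) (𝓝 x) := by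
      have := hcont.tendsto 1
      rw [hx'] at this
      exact this.mono_left nhdsWithin_le_nhds
    have h5 : Tendsto v (𝓝 x) (𝓝 (v x)) := (hasFDerivAt_of_contDiffOn hv hx0).continuousAt
    exact ((h5.comp h4).sub_const c).abs
  refine le_of_tendsto hlim ?_
  have h6 : Ioo (0 : ℝ) 1 ∈ 𝓝[<] (1 : ℝ) := Ioo_mem_nhdsLT one_pos
  have h7 : ∀ᶠ q : ℝ in 𝓝[<] 1, ‖(!₂[q * x 0, x 1] : Plane)‖ < r := by
    have := hcont.norm.tendsto 1
    rw [hx'] at this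
    exact (this.mono_left nhdsWithin_le_nhds).eventually_lt_const hxr
  filter_upwards [h6, h7] with q hq hqr
  refine h _ ?_ hqr
  have : |q * x 0| < x 1 := by
    rw [abs_mul, abs_of_pos hq.1]
    have := hq.2
    have h8 := hq.1
    nlinarith [abs_nonneg (x 0)]
  simpa using this

end Checkerboard

/-! ### Limits along the four cones and their comparison -/

namespace Checkerboard

/-- The limit of `v` along the image under `R` of the closed cone `|x₀| ≤ x₁` is `c`. -/
def ConeLimit (R : Plane ≃ₗᵢ[ℝ] Plane) (v : Plane → ℝ) (c : ℝ) : Prop :=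
  ∀ ε > 0, ∃ r > 0, ∀ x : Plane, x ≠ 0 → |x 0| ≤ x 1 → ‖x‖ < r → |v (R x) - c| ≤ ε

theorem exists_limit_cone_isometry {v : Plane → ℝ} (hv : ContDiffOn ℝ 1 v {0}ᶜ)
    (R : Plane ≃ₗᵢ[ℝ] Plane) {S : Set Plane} (hRS : ∀ x : Plane, |x 0| < x 1 → R x ∈ S)
    {δ : ℝ} (hδ : 0 < δ)
    (h1 : ∫⁻ x in S ∩ Metric.ball 0 δ, ENNReal.ofReal (‖fderiv ℝ v x‖ / ‖x‖) ≠ ∞)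
    (h2 : ∀ ε > 0, ∃ r > 0, ∀ x ∈ S, x ≠ 0 → ‖x‖ < r → ‖x‖ * ‖fderiv ℝ v x‖ ≤ ε) :
    ∃ c, ConeLimit R v c := by
  have hnorm : ∀ x, ‖fderiv ℝ (v ∘ R) x‖ = ‖fderiv ℝ v (R x)‖ := by
    intro x
    have h := R.toContinuousLinearEquiv.comp_right_fderiv (f := v) (x := x)
    have h' : fderiv ℝ (v ∘ R) x = (fderiv ℝ v (R x)).comp
        (R.toContinuousLinearEquiv : Plane →L[ℝ] Plane) := h
    rw [h']
    exact ContinuousLinearMap.opNorm_comp_linearIsometryEquiv _ R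
  have hR0 : ∀ x, x ≠ 0 → R x ≠ 0 := fun x hx => by simpa using hx
  have hv' : ContDiffOn ℝ 1 (v ∘ R) {0}ᶜ :=
    hv.comp R.contDiff.contDiffOn fun x hx => hR0 x hx
  -- Points of the cone with height below `δ / 2` have norm below `δ`.
  refine exists_limit_cone hv' (half_pos hδ) ?_ ?_
  · rw [← R.measurePreserving.setLIntegral_comp_preimage_emb
      R.toHomeomorph.measurableEmbedding] at h1
    refine ne_top_of_le_ne_top h1 ?_
    refine (lintegral_mono fun x => ?_).trans (lintegral_mono_set ?_)
    · rw [R.norm_map, ← hnorm]; exact le_rfl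
    · rintro x ⟨hx, hx1⟩
      refine ⟨hRS x hx, ?_⟩
      rw [mem_ball_zero_iff, R.norm_map]
      have h0 : 0 < x 1 := (abs_nonneg _).trans_lt hx
      have := norm_le_two_mul hx.le (abs_of_pos h0).le
      linarith
  · intro ε hε
    obtain ⟨r, hr, h⟩ := h2 ε hε
    refine ⟨r, hr, fun x hx hxr => ?_⟩
    have hx0 : x ≠ 0 := by
      rintro rfl; simp at hx
    have := h (R x) (hRS x hx) (hR0 x hx0) (by rwa [R.norm_map])
    rwa [R.norm_map, ← hnorm] at this

theorem exists_setLIntegral_ball_le {S : Set Plane} {f : Plane → ℝ≥0∞} {δ : ℝ} (hδ : 0 < δ)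
    (h : ∫⁻ x in S ∩ Metric.ball 0 δ, f x ≠ ∞) {ε : ℝ≥0∞} (hε : 0 < ε) :
    ∃ r > 0, ∫⁻ x in S ∩ Metric.ball 0 r, f x ≤ ε := by
  have h1 : Tendsto (fun r : ℝ => volume (Metric.ball (0 : Plane) r)) (𝓝[>] 0) (𝓝 0) := by
    have h2 : Tendsto (fun r : ℝ => ENNReal.ofReal (r ^ 2) * volume (Metric.ball (0 : Plane) 1))
        (𝓝[>] 0) (𝓝 0) := by
      have h3 : Tendsto (fun r : ℝ => ENNReal.ofReal (r ^ 2)) (𝓝[>] 0) (𝓝 0) := by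
        have : Continuous fun r : ℝ => ENNReal.ofReal (r ^ 2) :=
          ENNReal.continuous_ofReal.comp (by fun_prop)
        simpa using (this.tendsto 0).mono_left nhdsWithin_le_nhds
      have := ENNReal.Tendsto.mul_const h3
        (Or.inr (measure_ball_lt_top (μ := (volume : Measure Plane)) (x := 0) (r := 1)).ne)
      simpa using this
    refine h2.congr' ?_
    filter_upwards [self_mem_nhdsWithin] with r hr
    rw [Measure.addHaar_ball_of_pos _ _ hr, finrank_euclideanSpace_fin]
  have h4 := tendsto_setLIntegral_zero (μ := volume.restrict (S ∩ Metric.ball 0 δ)) (f := f) h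
    (l := 𝓝[>] (0 : ℝ)) (s := fun r => Metric.ball (0 : Plane) r)
    (tendsto_of_tendsto_of_tendsto_of_le_of_le tendsto_const_nhds h1 (fun _ => zero_le)
      fun r => Measure.restrict_apply_le _ _)
  obtain ⟨r, hr, hrδ⟩ := ((h4.eventually_le_const hε).and (Ioo_mem_nhdsGT hδ)).exists
  refine ⟨r, hrδ.1, ?_⟩
  rw [Measure.restrict_restrict measurableSet_ball] at hr
  refine (lintegral_mono_set ?_).trans hr
  intro x hx
  exact ⟨hx.2, hx.1, Metric.ball_subset_ball hrδ.2.le hx.2⟩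

/-- Young's inequality for the product of `1 / ‖x‖` and `‖g x‖`. -/
theorem setLIntegral_div_norm_ne_top {ψ : ℝ → ℝ} {S : Set Plane} {δ : ℝ}
    (hconj : ∫⁻ x in Metric.ball (0 : Plane) δ, conj ψ (1 / ‖x‖) ≠ ∞)
    {g : Plane → Plane →L[ℝ] ℝ} (hg : ∫⁻ x in S, ENNReal.ofReal (ψ ‖g x‖) ≠ ∞) :
    ∫⁻ x in S ∩ Metric.ball 0 δ, ENNReal.ofReal (‖g x‖ / ‖x‖) ≠ ∞ := by
  have hm : Measurable fun x : Plane => conj ψ (1 / ‖x‖) :=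
    (conj_mono ψ).measurable.comp (by fun_prop)
  refine ne_top_of_le_ne_top (ENNReal.add_ne_top.2 ⟨hg, hconj⟩) ?_
  calc ∫⁻ x in S ∩ Metric.ball 0 δ, ENNReal.ofReal (‖g x‖ / ‖x‖)
      ≤ ∫⁻ x in S ∩ Metric.ball 0 δ, (ENNReal.ofReal (ψ ‖g x‖) + conj ψ (1 / ‖x‖)) := by
        refine lintegral_mono fun x => ?_
        have := ofReal_mul_le ψ (1 / ‖x‖) (norm_nonneg (g x))
        rwa [one_div_mul_eq_div] at this
    _ = (∫⁻ x in S ∩ Metric.ball 0 δ, ENNReal.ofReal (ψ ‖g x‖)) +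
          ∫⁻ x in S ∩ Metric.ball 0 δ, conj ψ (1 / ‖x‖) := lintegral_add_right _ hm
    _ ≤ _ := add_le_add (lintegral_mono_set inter_subset_left)
        (lintegral_mono_set inter_subset_right)

/-- In polar coordinates the area element supplies the factor `r`. -/
theorem exists_setLIntegral_conj_ne_top {ψ : ℝ → ℝ} (hfin : ∀ s, conj ψ s ≠ ∞)
    (h : ¬ DivergesAtZero fun r => conj ψ (1 / r) * ENNReal.ofReal r) :
    ∃ δ > 0, ∫⁻ x in Metric.ball (0 : Plane) δ, conj ψ (1 / ‖x‖) ≠ ∞ := by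
  unfold DivergesAtZero at h
  push Not at h
  obtain ⟨δ, hδ, h⟩ := h
  refine ⟨δ, hδ, ?_⟩
  have hm : Measurable fun r : ℝ => conj ψ (1 / r) :=
    (conj_mono ψ).measurable.comp (by fun_prop)
  have hi : IntegrableOn (fun r : ℝ => r ^ (Module.finrank ℝ Plane - 1) •
      (conj ψ (1 / r)).toReal) (Ioo 0 δ) := by
    rw [finrank_euclideanSpace_fin]
    refine ⟨((measurable_id.pow_const _).smul hm.ennreal_toReal).aestronglyMeasurable, ?_⟩
    rw [hasFiniteIntegral_iff_enorm]
    refine (lt_of_eq_of_lt (setLIntegral_congr_fun measurableSet_Ioo fun r hr => ?_)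
      (lt_top_iff_ne_top.2 h))
    rw [← ofReal_norm, norm_smul, Real.norm_of_nonneg ENNReal.toReal_nonneg, pow_one,
      Real.norm_of_nonneg hr.1.le, ENNReal.ofReal_mul hr.1.le, ENNReal.ofReal_toReal (hfin _),
      mul_comm]
  have h2 := ((integrableOn_fun_norm_addHaar (E := Plane) volume).2 hi).2
  rw [hasFiniteIntegral_iff_enorm] at h2
  refine (lt_of_eq_of_lt (lintegral_congr fun x => ?_) h2).ne
  rw [← ofReal_norm, Real.norm_of_nonneg ENNReal.toReal_nonneg, ENNReal.ofReal_toReal (hfin _)]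

/-- Existence of the limit at the vertex of a cone for a function with a mean value bound on its
derivative, if the conjugate function is integrable at zero. -/
theorem exists_coneLimit {v : Plane → ℝ} (hv : ContDiffOn ℝ 1 v {0}ᶜ) {ψ : ℝ → ℝ}
    (R : Plane ≃ₗᵢ[ℝ] Plane) {S : Set Plane}
    (hRS : ∀ x : Plane, |x 0| < x 1 → R x ∈ S)
    (hS : ∀ x ∈ S, ∀ z, weight x ≤ weight z → z ∈ S) {δ : ℝ} (hδ : 0 < δ)
    (hconj : ∫⁻ x in Metric.ball (0 : Plane) δ, conj ψ (1 / ‖x‖) ≠ ∞)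
    (hDv : ∫⁻ x in S, ENNReal.ofReal (ψ ‖fderiv ℝ v x‖) ≠ ∞)
    {g : Plane → Plane →L[ℝ] ℝ} (hg : ∫⁻ x in S, ENNReal.ofReal (ψ ‖g x‖) ≠ ∞)
    {B : ℝ≥0∞} (hB : B ≠ ∞) (hbound : ∀ x : Plane, x ≠ 0 → ‖x‖ₑ * ‖fderiv ℝ v x‖ₑ ≤
      B * ∫⁻ z in {z | ‖z‖ ≤ 2 * ‖x‖ ∧ weight x ≤ weight z}, ENNReal.ofReal (‖g z‖ / ‖z‖)) :
    ∃ c, ConeLimit R v c := by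
  refine exists_limit_cone_isometry hv R hRS hδ (setLIntegral_div_norm_ne_top hconj hDv)
    fun ε hε => ?_
  -- With a point `x`, the set `S` contains all points of no smaller weight, so the integral in the
  -- mean value bound runs over a small part of `S` and is small by absolute continuity. The
  -- denominator `B + 1` avoids division by zero.
  obtain ⟨r, hr, h⟩ := exists_setLIntegral_ball_le hδ (setLIntegral_div_norm_ne_top hconj hg)
    (ε := ENNReal.ofReal ε / (B + 1))
    (ENNReal.div_pos (ENNReal.ofReal_pos.2 hε).ne' (ENNReal.add_ne_top.2 ⟨hB, by simp⟩))
  refine ⟨r / 2, half_pos hr, fun x hxS hx0 hxr => ?_⟩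
  have h1 : ‖x‖ₑ * ‖fderiv ℝ v x‖ₑ ≤ ENNReal.ofReal ε := by
    refine (hbound x hx0).trans ?_
    calc _ ≤ B * (ENNReal.ofReal ε / (B + 1)) := by
          gcongr
          refine (lintegral_mono_set ?_).trans h
          rintro z ⟨hz, hw⟩
          exact ⟨hS x hxS z hw, by rw [mem_ball_zero_iff]; linarith⟩
      _ ≤ (B + 1) * (ENNReal.ofReal ε / (B + 1)) := by gcongr; exact le_self_add
      _ ≤ _ := ENNReal.mul_div_le
  rw [← ofReal_norm, ← ofReal_norm, ← ENNReal.ofReal_mul (norm_nonneg _)] at h1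
  exact (ENNReal.ofReal_le_ofReal_iff hε.le).1 h1

/-- The reflection at the diagonal. -/
noncomputable def swap : Plane ≃ₗᵢ[ℝ] Plane :=
  LinearIsometryEquiv.piLpCongrLeft 2 ℝ ℝ (Equiv.swap 0 1)

theorem swap_apply (s t : ℝ) : swap !₂[s, t] = !₂[t, s] := by
  ext i
  fin_cases i <;> simp [swap, LinearIsometryEquiv.piLpCongrLeft_apply, Equiv.piCongrLeft']

theorem diagonal_point {t : ℝ} (ht : 0 < t) :
    (!₂[t, t] : Plane) ≠ 0 ∧ ‖(!₂[t, t] : Plane)‖ ≤ 2 * t := by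
  refine ⟨fun h => ht.ne' ?_, norm_le_two_mul ?_ ?_⟩
  · simpa using congrArg (fun z : Plane => z 0) h
  · simp [abs_of_pos ht]
  · simp [abs_of_pos ht]

/-- The cones of `ConeLimit` are closed, so neighbouring ones share a diagonal ray, on which both
limits can be read off. -/
theorem ConeLimit.unique {R R' : Plane ≃ₗᵢ[ℝ] Plane} {v : Plane → ℝ} {c c' : ℝ}
    (h : ConeLimit R v c) (h' : ConeLimit R' v c')
    (hR : ∀ t : ℝ, R !₂[t, t] = R' !₂[t, t]) : c = c' := by
  refine eq_of_forall_dist_le fun ε hε => ?_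
  obtain ⟨r, hr, h⟩ := h (ε / 2) (half_pos hε)
  obtain ⟨r', hr', h'⟩ := h' (ε / 2) (half_pos hε)
  set t := min r r' / 4
  have hm : 0 < min r r' := lt_min hr hr'
  have ht : 0 < t := by positivity
  obtain ⟨h0, hn⟩ := diagonal_point ht
  have hlt : ‖(!₂[t, t] : Plane)‖ < min r r' := hn.trans_lt (by simp only [t]; linarith)
  have a := h !₂[t, t] h0 (by simp [abs_of_pos ht]) (hlt.trans_le (min_le_left _ _))
  have b := h' !₂[t, t] h0 (by simp [abs_of_pos ht]) (hlt.trans_le (min_le_right _ _))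
  rw [hR] at a
  rw [Real.dist_eq]
  have := abs_sub_le c (v (R' !₂[t, t])) c'
  rw [abs_sub_comm c (v _)] at this
  linarith

/-- If the integral of `φ(1/r) r` diverges at zero, then the limits of a function with finite
`φ`-energy along opposite cones agree. -/
theorem ConeLimit.eq_of_diverges {φ : ℝ → ℝ} {K : ℝ} (hφ : Young φ K)
    (hdiv : ∀ δ : ℝ, 0 < δ → ∫⁻ r in Ioo 0 δ, ENNReal.ofReal (φ (1 / r) * r) = ∞)
    {v : Plane → ℝ} (hv : ContDiffOn ℝ 1 v {0}ᶜ)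
    (hDv : ∫⁻ x, ENNReal.ofReal (φ ‖fderiv ℝ v x‖) ≠ ∞) {c c' : ℝ}
    (h : ConeLimit (.refl ℝ Plane) v c) (h' : ConeLimit (.neg ℝ) v c') : c = c' := by
  by_contra hne
  set ε := |c - c'| / 4 with hε
  have hε0 : 0 < ε := by have := abs_pos.2 (sub_ne_zero.2 hne); positivity
  obtain ⟨r, hr, h⟩ := h ε hε0
  obtain ⟨r', hr', h'⟩ := h' ε hε0
  set δ := min r r' / 2 with hδ
  have hδ0 : 0 < δ := half_pos (lt_min hr hr')
  -- By doubling, `φ (1 / t)` is at most `Q * φ (ε / t)`.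
  obtain ⟨Q, hQ1, hQ⟩ := hφ.exists_map_mul_le (1 / ε)
  set f : Plane → ℝ≥0∞ := fun x => ENNReal.ofReal (φ ‖fderiv ℝ v x‖) with hf
  have hfm : Measurable f := (hφ.cont.measurable.comp (measurable_fderiv ℝ v).norm).ennreal_ofReal
  have hfin : ∫⁻ t in Ioo 0 δ, ∫⁻ s in Ioo (-1) 1, ENNReal.ofReal t * f !₂[t, t * s] ≠ ∞ := by
    -- The reflection turns the cone formula into one for the side cone `|x₁| < x₀` with coordinates
    -- `(t, t s)`.
    have h1 := lintegral_cone (f := fun x => f (swap x)) (hfm.comp swap.continuous.measurable) δ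
    simp only [swap_apply] at h1
    rw [← h1]
    refine ne_top_of_le_ne_top ?_ (setLIntegral_le_lintegral _ _)
    rwa [swap.measurePreserving.lintegral_comp hfm]
  have key : ∀ t ∈ Ioo 0 δ, ENNReal.ofReal (φ (1 / t) * t) ≤
      ENNReal.ofReal Q * ∫⁻ s in Ioo (-1) 1, ENNReal.ofReal t * f !₂[t, t * s] := by
    intro t ht
    have ht0 := ht.1
    have hne0 : ∀ s : ℝ, (!₂[t, t * s] : Plane) ≠ 0 := fun s h0 => ht0.ne' (by
      simpa using congrArg (fun z : Plane => z 0) h0)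
    have hcurve : Continuous fun s : ℝ => (!₂[t, t * s] : Plane) := by fun_prop
    set e : Plane := !₂[0, 1] with he
    have hen : ‖e‖ = 1 := by
      have : ‖e‖ ^ 2 = 1 := by rw [norm_sq_eq]; simp [he]
      exact (sq_eq_sq₀ (norm_nonneg _) zero_le_one).1 (by simpa using this)
    set F : ℝ → ℝ := fun s => fderiv ℝ v !₂[t, t * s] e with hF
    have hder : ∀ s : ℝ, HasDerivAt (fun s : ℝ => v !₂[t, t * s]) (t * F s) s := by
      intro s
      have h1 : HasDerivAt (fun s : ℝ => (!₂[t, t * s] : Plane)) (t • e) s := by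
        have h2 : (fun s : ℝ => (!₂[t, t * s] : Plane)) = fun s => (!₂[t, 0] : Plane) + s • t • e := by
          ext s i; fin_cases i <;> simp [he, mul_comm]
        rw [h2]
        simpa using ((hasDerivAt_id s).smul_const (t • e)).const_add (!₂[t, 0] : Plane)
      have h3 := (hasFDerivAt_of_contDiffOn hv (hne0 s)).comp_hasDerivAt s h1
      simpa [hF, Function.comp_def] using h3
    have hFc : Continuous F := by
      have h1 : ContinuousOn (fderiv ℝ v) {0}ᶜ :=
        hv.continuousOn_fderiv_of_isOpen isOpen_compl_singleton le_rfl
      have h2 : Continuous fun s : ℝ => fderiv ℝ v !₂[t, t * s] :=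
        h1.comp_continuous hcurve fun s => hne0 s
      exact h2.clm_apply continuous_const
    have hint : ∫ s in (-1 : ℝ)..1, t * F s = v !₂[t, t * 1] - v !₂[t, t * (-1)] :=
      intervalIntegral.integral_eq_sub_of_hasDerivAt (fun s _ => hder s)
        ((continuous_const.mul hFc).intervalIntegrable _ _)
    -- The endpoints of the segment lie on the boundaries of the upper and the lower cone, where `v`
    -- is within `ε` of limits at distance `4 * ε`.
    have hjump : 2 * ε ≤ |v !₂[t, t * 1] - v !₂[t, t * (-1)]| := by
      have htδ : 2 * t < min r r' := by have := ht.2; rw [hδ] at this; linarith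
      have n1 : ‖(!₂[t, t] : Plane)‖ ≤ 2 * t := (diagonal_point ht0).2
      have n2 : ‖(!₂[-t, t] : Plane)‖ ≤ 2 * t :=
        norm_le_two_mul (by simp [abs_of_pos ht0]) (by simp [abs_of_pos ht0])
      have a := h !₂[t, t] (diagonal_point ht0).1 (by simp [abs_of_pos ht0])
        (n1.trans_lt (htδ.trans_le (min_le_left _ _)))
      have b := h' !₂[-t, t] (fun h0 => ht0.ne' (by
        simpa using congrArg (fun z : Plane => z 1) h0)) (by simp [abs_of_pos ht0])
        (n2.trans_lt (htδ.trans_le (min_le_right _ _)))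
      have e1 : (LinearIsometryEquiv.neg ℝ : Plane ≃ₗᵢ[ℝ] Plane) !₂[-t, t] = !₂[t, t * (-1)] := by
        ext i; fin_cases i <;> simp
      have e2 : (LinearIsometryEquiv.refl ℝ Plane) !₂[t, t] = !₂[t, t * 1] := by simp
      rw [e1] at b
      rw [e2] at a
      have h4 : |c - c'| = 4 * ε := by rw [hε]; ring
      have h5 := abs_sub_le c (v !₂[t, t * 1]) c'
      have h6 := abs_sub_le (v !₂[t, t * 1]) (v !₂[t, t * (-1)]) c'
      rw [abs_sub_comm c (v _)] at h5
      linarith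
    -- Normalised length on the parameter interval, for Jensen's inequality. As the jump is `t`
    -- times the integral of `F`, the mean of `F` has modulus at least `ε / t`.
    set μ : Measure ℝ := (2⁻¹ : ℝ≥0∞) • volume.restrict (Ioo (-1 : ℝ) 1) with hμ
    have hprob : IsProbabilityMeasure μ := ⟨by
      rw [hμ, Measure.smul_apply, Measure.restrict_apply_univ, Real.volume_Ioo]
      norm_num
      exact ENNReal.inv_mul_cancel (by norm_num) (by norm_num)⟩
    have hFi : Integrable F μ :=
      ((hFc.integrableOn_Icc (a := -1) (b := 1)).mono_set Ioo_subset_Icc_self).smul_measure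
        (by norm_num)
    have hJ := hφ.ofReal_norm_integral_le hFi
    have hIμ : ε / t ≤ ‖∫ s, F s ∂μ‖ := by
      rw [hμ, integral_smul_measure, ← integral_Ioc_eq_integral_Ioo,
        ← intervalIntegral.integral_of_le (by norm_num), norm_smul, Real.norm_eq_abs,
        Real.norm_eq_abs, div_le_iff₀ ht0]
      rw [intervalIntegral.integral_const_mul] at hint
      rw [← hint, abs_mul, abs_of_pos ht0] at hjump
      have : |(2⁻¹ : ℝ≥0∞).toReal| = 2⁻¹ := by simp
      rw [this]
      linarith
    have h1 : φ (1 / t) ≤ Q * φ (ε / t) := by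
      have := hQ (ε / t) (by positivity)
      rwa [show 1 / ε * (ε / t) = 1 / t by field_simp] at this
    calc ENNReal.ofReal (φ (1 / t) * t) ≤ ENNReal.ofReal (Q * (t * φ ‖∫ s, F s ∂μ‖)) := by
          refine ENNReal.ofReal_le_ofReal ?_
          have h2 := hφ.mono hIμ
          calc φ (1 / t) * t ≤ Q * φ (ε / t) * t := by gcongr
            _ = Q * (t * φ (ε / t)) := by ring
            _ ≤ _ := by gcongr
      _ = ENNReal.ofReal Q * (ENNReal.ofReal t * ENNReal.ofReal (φ ‖∫ s, F s ∂μ‖)) := by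
          rw [ENNReal.ofReal_mul (by linarith), ENNReal.ofReal_mul ht0.le]
      _ ≤ ENNReal.ofReal Q * (ENNReal.ofReal t * ∫⁻ s in Ioo (-1) 1, f !₂[t, t * s]) := by
          gcongr
          refine hJ.trans ?_
          rw [hμ, lintegral_smul_measure, smul_eq_mul]
          calc _ ≤ 1 * ∫⁻ s in Ioo (-1) 1, ENNReal.ofReal (φ ‖F s‖) := by
                gcongr; norm_num
            _ ≤ _ := by
                rw [one_mul]
                refine lintegral_mono fun s => ENNReal.ofReal_le_ofReal (hφ.mono ?_)
                have := (fderiv ℝ v !₂[t, t * s]).le_opNorm e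
                rwa [hen, mul_one] at this
      _ = _ := by rw [lintegral_const_mul' _ _ ENNReal.ofReal_ne_top]
  refine ENNReal.mul_ne_top (ENNReal.ofReal_ne_top (r := Q)) hfin ?_
  rw [← top_le_iff, ← hdiv δ hδ0, ← lintegral_const_mul' _ _ ENNReal.ofReal_ne_top]
  exact setLIntegral_mono' measurableSet_Ioo key

/-- Limits along all four cones give a limit at the origin. -/
theorem exists_forall_abs_sub_le_of_coneLimit {v : Plane → ℝ} {c : ℝ}
    (h₁ : ConeLimit (.refl ℝ Plane) v c) (h₂ : ConeLimit (.neg ℝ) v c)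
    (h₃ : ConeLimit swap v c) (h₄ : ConeLimit (swap.trans (.neg ℝ)) v c) {ε : ℝ} (hε : 0 < ε) :
    ∃ r > 0, ∀ x : Plane, x ≠ 0 → ‖x‖ < r → |v x - c| ≤ ε := by
  obtain ⟨r₁, hr₁, h₁⟩ := h₁ ε hε
  obtain ⟨r₂, hr₂, h₂⟩ := h₂ ε hε
  obtain ⟨r₃, hr₃, h₃⟩ := h₃ ε hε
  obtain ⟨r₄, hr₄, h₄⟩ := h₄ ε hε
  refine ⟨min (min r₁ r₂) (min r₃ r₄), by positivity, fun x hx hxr => ?_⟩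
  simp only [lt_min_iff] at hxr
  have hsw : ∀ x : Plane, swap x = !₂[x 1, x 0] := fun x => by
    rw [← swap_apply]; congr 1; ext i; fin_cases i <;> rfl
  have hx' : !₂[x 0, x 1] = x := by ext i; fin_cases i <;> rfl
  rcases le_total |x 0| |x 1| with hle | hle
  · rcases le_total 0 (x 1) with h0 | h0
    · exact h₁ x hx (by rwa [abs_of_nonneg h0] at hle) hxr.1.1
    · have := h₂ (-x) (neg_ne_zero.2 hx) (by simpa [abs_of_nonpos h0] using hle)
        (by simpa using hxr.1.2)
      simpa using this
  · have hn : ∀ y : Plane, swap y ≠ 0 ↔ y ≠ 0 := fun y => by simp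
    rcases le_total 0 (x 0) with h0 | h0
    · have := h₃ (swap x) ((hn x).2 hx) (by simpa [hsw, abs_of_nonneg h0] using hle)
        (by simpa using hxr.2.1)
      simpa [hsw, hx'] using this
    · have := h₄ (-swap x) (neg_ne_zero.2 ((hn x).2 hx))
        (by simpa [hsw, abs_of_nonpos h0] using hle) (by simpa using hxr.2.2)
      have e : (swap.trans (.neg ℝ)) (-swap x) = x := by
        ext i; fin_cases i <;> simp [hsw]
      rwa [e] at this

end Checkerboard

/-! ### Approximable functions and removal of the singularity -/

namespace Checkerboard

variable {Φ : Plane → ℝ → ℝ} {K : ℝ}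

theorem ae_ne_zero : ∀ᵐ x : Plane, x ≠ 0 := by simp [ae_iff, measure_singleton]

/-- `v` vanishes outside a compact subset of the square. -/
def CompactlySupported (v : Plane → ℝ) : Prop :=
  ∃ r : ℝ, 0 < r ∧ r < 1 ∧ ∀ x : Plane, (∃ i, r < |x i|) → v x = 0

/-- Functions of finite energy which are smooth away from the origin. -/
structure Admissible (Φ : Plane → ℝ → ℝ) (v : Plane → ℝ) : Prop where
  smooth : ContDiffOn ℝ (⊤ : ℕ∞) v {0}ᶜ
  supp : CompactlySupported v
  energy : ∫⁻ x, ENNReal.ofReal (Φ x ‖fderiv ℝ v x‖) ≠ ∞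

/-- `v` is the limit of smooth functions with compact support in the square. -/
def Approximable (Φ : Plane → ℝ → ℝ) (v : Plane → ℝ) : Prop :=
  ∀ ε : ℝ≥0∞, 0 < ε → ∃ η : Plane → ℝ, ContDiff ℝ (⊤ : ℕ∞) η ∧ CompactlySupported η ∧
    ∫⁻ x, ENNReal.ofReal (Φ x ‖fderiv ℝ v x - fderiv ℝ η x‖) ≤ ε

theorem YoungFamily.lintegral_add_le (hΦ : YoungFamily Φ K) {f g : Plane → Plane →L[ℝ] ℝ}
    (hf : AEMeasurable fun x => ENNReal.ofReal (Φ x ‖f x‖)) :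
    ∫⁻ x, ENNReal.ofReal (Φ x ‖f x + g x‖) ≤ ENNReal.ofReal K *
      ((∫⁻ x, ENNReal.ofReal (Φ x ‖f x‖)) + ∫⁻ x, ENNReal.ofReal (Φ x ‖g x‖)) := by
  have hK := (hΦ.young 0).one_le
  rw [← lintegral_add_left' hf, ← lintegral_const_mul' _ _ ENNReal.ofReal_ne_top]
  refine lintegral_mono fun x => ?_
  rw [← ENNReal.ofReal_add ((hΦ.young x).nonneg _) ((hΦ.young x).nonneg _),
    ← ENNReal.ofReal_mul (by linarith)]
  exact ENNReal.ofReal_le_ofReal (((hΦ.young x).mono (norm_add_le _ _)).trans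
    ((hΦ.young x).map_add_le _ _))

theorem YoungFamily.measurable_fderiv_sub (hΦ : YoungFamily Φ K) (v w : Plane → ℝ) :
    Measurable fun x => ENNReal.ofReal (Φ x ‖fderiv ℝ v x - fderiv ℝ w x‖) :=
  (hΦ.meas.comp (measurable_id.prodMk ((_root_.measurable_fderiv ℝ v).sub
    (_root_.measurable_fderiv ℝ w)).norm)).ennreal_ofReal

theorem approximable_of_forall (hΦ : YoungFamily Φ K) {v : Plane → ℝ}
    (h : ∀ ε : ℝ≥0∞, 0 < ε → ∃ w : Plane → ℝ, Approximable Φ w ∧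
      ∫⁻ x, ENNReal.ofReal (Φ x ‖fderiv ℝ v x - fderiv ℝ w x‖) ≤ ε) : Approximable Φ v := by
  intro ε hε
  have hK := (hΦ.young 0).one_le
  have hK0 : ENNReal.ofReal K ≠ 0 := (ENNReal.ofReal_pos.2 (by linarith)).ne'
  -- The modular satisfies the triangle inequality only up to the factor `K`, which is compensated
  -- in advance.
  set ε' := ε / ENNReal.ofReal K / 2 with hε'
  have hε0 : 0 < ε' := ENNReal.half_pos (ENNReal.div_pos hε.ne' ENNReal.ofReal_ne_top).ne'
  obtain ⟨w, hw, hvw⟩ := h ε' hε0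
  obtain ⟨η, hη, hs, hwη⟩ := hw ε' hε0
  refine ⟨η, hη, hs, ?_⟩
  have := hΦ.lintegral_add_le (f := fun x => fderiv ℝ v x - fderiv ℝ w x)
    (g := fun x => fderiv ℝ w x - fderiv ℝ η x) (hΦ.measurable_fderiv_sub v w).aemeasurable
  simp only [sub_add_sub_cancel] at this
  refine this.trans ?_
  calc _ ≤ ENNReal.ofReal K * (ε' + ε') := by gcongr
    _ = ε := by
      rw [ENNReal.add_halves, ENNReal.mul_div_cancel hK0 ENNReal.ofReal_ne_top]

/-- The value of `v` at the origin is immaterial: correcting it to `κ` gives a smooth function with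
the same gradient elsewhere. -/
theorem approximable_of_eventually_eq (hΦ : YoungFamily Φ K) {v : Plane → ℝ}
    (hv : ContDiffOn ℝ (⊤ : ℕ∞) v {0}ᶜ) (hs : CompactlySupported v) {κ : ℝ} (hκ : ∀ᶠ x in 𝓝[≠] 0, v x = κ) : Approximable Φ v := by
  intro ε _
  set η := Function.update v 0 κ with hη
  have heq : ∀ x, x ≠ 0 → η =ᶠ[𝓝 x] v := fun x hx => by
    filter_upwards [isOpen_compl_singleton.mem_nhds hx] with y hy
    rw [hη, Function.update_of_ne hy]
  have h0 : η =ᶠ[𝓝 0] fun _ => κ := by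
    have := eventually_nhdsWithin_iff.1 hκ
    filter_upwards [this] with y hy
    by_cases h : y = 0
    · rw [hη, h, Function.update_self]
    · rw [hη, Function.update_of_ne h, hy h]
  refine ⟨η, contDiff_iff_contDiffAt.2 fun x => ?_, ?_, ?_⟩
  · by_cases hx : x = 0
    · rw [hx]; exact contDiffAt_const.congr_of_eventuallyEq h0
    · exact (hv.contDiffAt (isOpen_compl_singleton.mem_nhds hx)).congr_of_eventuallyEq
        (heq x hx)
  · obtain ⟨r, hr0, hr1, h⟩ := hs
    refine ⟨r, hr0, hr1, fun x hx => ?_⟩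
    have : x ≠ 0 := by
      rintro rfl
      obtain ⟨i, hi⟩ := hx
      simp at hi; linarith
    rw [hη, Function.update_of_ne this, h x hx]
  · have : ∫⁻ x, ENNReal.ofReal (Φ x ‖fderiv ℝ v x - fderiv ℝ η x‖) = ∫⁻ _ : Plane, 0 := by
      refine lintegral_congr_ae ?_
      filter_upwards [ae_ne_zero] with x hx
      rw [(heq x hx).fderiv_eq, sub_self, norm_zero, (hΦ.young x).zero 0 le_rfl, ENNReal.ofReal_zero]
    rw [this]; simp

theorem fderiv_comp_real {v : Plane → ℝ} (hv : ContDiffOn ℝ (⊤ : ℕ∞) v {0}ᶜ) {F : ℝ → ℝ}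
    (hF : ContDiff ℝ (⊤ : ℕ∞) F) {x : Plane} (hx : x ≠ 0) :
    fderiv ℝ (fun x => F (v x)) x = deriv F (v x) • fderiv ℝ v x := by
  have h1 := hasFDerivAt_of_contDiffOn (hv.of_le (by simp)) hx
  have h2 : HasDerivAt F (deriv F (v x)) (v x) := (hF.differentiable (by simp) _).hasDerivAt
  exact (h2.comp_hasFDerivAt x h1).fderiv

/-- Convergence of the compositions `F n ∘ v` in the energy space. -/
theorem Admissible.tendsto_comp (hΦ : YoungFamily Φ K) {v : Plane → ℝ} (hv : Admissible Φ v)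
    {F : ℕ → ℝ → ℝ} (hF : ∀ n, ContDiff ℝ (⊤ : ℕ∞) (F n)) {M : ℝ}
    (hM : ∀ n s, |deriv (F n) s| ≤ M)
    (hlim : ∀ᵐ x : Plane, fderiv ℝ v x = 0 ∨
      Tendsto (fun n => deriv (F n) (v x)) atTop (𝓝 1)) :
    Tendsto (fun n => ∫⁻ x, ENNReal.ofReal
      (Φ x ‖fderiv ℝ v x - fderiv ℝ (fun x => F n (v x)) x‖)) atTop (𝓝 0) := by
  obtain ⟨m, hm⟩ := pow_unbounded_of_one_lt (1 + M) (one_lt_two)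
  have hK := (hΦ.young 0).one_le
  have h0 : ∫⁻ _ : Plane, (0 : ℝ≥0∞) = 0 := by simp
  rw [← h0]
  refine tendsto_lintegral_of_dominated_convergence
    (fun x => ENNReal.ofReal (K ^ m) * ENNReal.ofReal (Φ x ‖fderiv ℝ v x‖))
    (fun n => hΦ.measurable_fderiv_sub _ _) (fun n => ?_) ?_ ?_
  · filter_upwards [ae_ne_zero] with x hx
    rw [← ENNReal.ofReal_mul (by positivity)]
    refine ENNReal.ofReal_le_ofReal (le_trans ((hΦ.young x).mono ?_)
      ((hΦ.young x).map_mul_le hm.le (norm_nonneg _)))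
    rw [fderiv_comp_real hv.smooth (hF n) hx]
    refine (norm_sub_le _ _).trans ?_
    rw [norm_smul, Real.norm_eq_abs, add_mul, one_mul]
    have := hM n (v x)
    gcongr
  · rw [lintegral_const_mul' _ _ ENNReal.ofReal_ne_top]
    exact ENNReal.mul_ne_top ENNReal.ofReal_ne_top hv.energy
  · filter_upwards [ae_ne_zero, hlim] with x hx hx'
    have h1 : Tendsto (fun n => ‖fderiv ℝ v x - fderiv ℝ (fun x => F n (v x)) x‖) atTop (𝓝 0) := by
      simp only [fderiv_comp_real hv.smooth (hF _) hx]
      rcases hx' with h | h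
      · simp [h]
      · have := (tendsto_const_nhds (x := fderiv ℝ v x)).sub (h.smul_const (fderiv ℝ v x))
        simpa using this.norm
    have h2 := ((hΦ.young x).cont.tendsto 0).comp h1
    rw [(hΦ.young x).zero 0 le_rfl] at h2
    simpa using ENNReal.tendsto_ofReal h2

theorem Admissible.comp (hΦ : YoungFamily Φ K) {v : Plane → ℝ} (hv : Admissible Φ v) {F : ℝ → ℝ}
    (hF : ContDiff ℝ (⊤ : ℕ∞) F) (hF0 : F 0 = 0) {M : ℝ} (hM : ∀ s, |deriv F s| ≤ M) :
    Admissible Φ fun x => F (v x) where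
  smooth := hF.comp_contDiffOn hv.smooth
  supp := by
    obtain ⟨r, h0, h1, h⟩ := hv.supp
    exact ⟨r, h0, h1, fun x hx => by simp only [h x hx, hF0]⟩
  energy := by
    obtain ⟨m, hm⟩ := pow_unbounded_of_one_lt M (one_lt_two)
    have hK := (hΦ.young 0).one_le
    have : ∫⁻ x, ENNReal.ofReal (K ^ m) * ENNReal.ofReal (Φ x ‖fderiv ℝ v x‖) ≠ ∞ := by
      rw [lintegral_const_mul' _ _ ENNReal.ofReal_ne_top]
      exact ENNReal.mul_ne_top ENNReal.ofReal_ne_top hv.energy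
    refine ne_top_of_le_ne_top this (lintegral_mono_ae ?_)
    filter_upwards [ae_ne_zero] with x hx
    rw [← ENNReal.ofReal_mul (by positivity), fderiv_comp_real hv.smooth hF hx, norm_smul,
      Real.norm_eq_abs]
    exact ENNReal.ofReal_le_ofReal (((hΦ.young x).mono (mul_le_mul_of_nonneg_right (hM _)
      (norm_nonneg _))).trans ((hΦ.young x).map_mul_le hm.le (norm_nonneg _)))

/-- Removal of the singularity at the origin by a cutoff function. -/
theorem Admissible.approximable_of_cutoff (hΦ : YoungFamily Φ K) {v : Plane → ℝ}
    (hv : Admissible Φ v) (κ : ℝ)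
    (h : ∀ δ > 0, ∀ ε : ℝ≥0∞, 0 < ε → ∃ η : Plane → ℝ, ContDiff ℝ (⊤ : ℕ∞) η ∧
      (∀ x, 0 ≤ η x ∧ η x ≤ 1) ∧ (∀ᶠ x in 𝓝 0, η x = 1) ∧ (∀ x, δ ≤ ‖x‖ → η x = 0) ∧
      ∫⁻ x, ENNReal.ofReal (Φ x ‖(v x - κ) • fderiv ℝ η x‖) ≤ ε) : Approximable Φ v := by
  refine approximable_of_forall hΦ fun ε hε => ?_
  have hK := (hΦ.young 0).one_le
  have hK0 : ENNReal.ofReal K ≠ 0 := (ENNReal.ofReal_pos.2 (by linarith)).ne'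
  set ε' := ε / ENNReal.ofReal K / 2 with hε'
  have hε0 : 0 < ε' := ENNReal.half_pos (ENNReal.div_pos hε.ne' ENNReal.ofReal_ne_top).ne'
  obtain ⟨r, hr0, hr1, hr⟩ := hv.supp
  -- On this ball the energy of `v` is small, which controls the term `η • Dv`.
  obtain ⟨δ, hδ, hδε⟩ := exists_setLIntegral_ball_le (S := univ) one_pos
    (ne_top_of_le_ne_top hv.energy (setLIntegral_le_lintegral _ _)) hε0
  rw [univ_inter] at hδε
  -- The bound `r` on the radius makes `η` vanish where `v` is known to vanish, so the support
  -- condition survives.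
  obtain ⟨η, hη, hη01, hη1, hη0, hηε⟩ := h (min δ r) (lt_min hδ hr0) ε' hε0
  have hder : ∀ x, x ≠ 0 → fderiv ℝ v x - fderiv ℝ (fun x => v x - (v x - κ) * η x) x =
      η x • fderiv ℝ v x + (v x - κ) • fderiv ℝ η x := by
    intro x hx
    have h1 := hasFDerivAt_of_contDiffOn (hv.smooth.of_le (by simp)) hx
    have h2 : HasFDerivAt η (fderiv ℝ η x) x := (hη.differentiable (by simp) x).hasFDerivAt
    have h3 := h1.sub ((h1.sub_const κ).mul h2)
    rw [show fderiv ℝ (fun x => v x - (v x - κ) * η x) x = _ from h3.fderiv]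
    abel
  have hclose : ∫⁻ x, ENNReal.ofReal
      (Φ x ‖fderiv ℝ v x - fderiv ℝ (fun x => v x - (v x - κ) * η x) x‖) ≤ ε := by
    have hm : Measurable fun x => ENNReal.ofReal (Φ x ‖η x • fderiv ℝ v x‖) :=
      (hΦ.meas.comp (measurable_id.prodMk (hη.continuous.measurable.smul
        (_root_.measurable_fderiv ℝ v)).norm)).ennreal_ofReal
    calc _ = ∫⁻ x, ENNReal.ofReal (Φ x ‖η x • fderiv ℝ v x + (v x - κ) • fderiv ℝ η x‖) := by
          refine lintegral_congr_ae ?_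
          filter_upwards [ae_ne_zero] with x hx
          rw [hder x hx]
      _ ≤ ENNReal.ofReal K * ((∫⁻ x, ENNReal.ofReal (Φ x ‖η x • fderiv ℝ v x‖)) +
            ∫⁻ x, ENNReal.ofReal (Φ x ‖(v x - κ) • fderiv ℝ η x‖)) :=
          hΦ.lintegral_add_le hm.aemeasurable
      _ ≤ ENNReal.ofReal K * (ε' + ε') := by
          gcongr
          refine le_trans ?_ hδε
          rw [← lintegral_indicator measurableSet_ball]
          refine lintegral_mono fun x => ?_
          by_cases hx : x ∈ Metric.ball (0 : Plane) δ
          · rw [indicator_of_mem hx]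
            refine ENNReal.ofReal_le_ofReal ((hΦ.young x).mono ?_)
            rw [norm_smul, Real.norm_of_nonneg (hη01 x).1]
            exact mul_le_of_le_one_left (norm_nonneg _) (hη01 x).2
          · rw [mem_ball_zero_iff, not_lt] at hx
            rw [hη0 x ((min_le_left _ _).trans hx), zero_smul, norm_zero,
              (hΦ.young x).zero 0 le_rfl, ENNReal.ofReal_zero]
            exact zero_le
      _ = ε := by
          rw [ENNReal.add_halves, ENNReal.mul_div_cancel hK0 ENNReal.ofReal_ne_top]
  -- The modified function equals `κ` near the origin and `v` outside the support of `η`.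
  refine ⟨fun x => v x - (v x - κ) * η x, ?_, hclose⟩
  refine approximable_of_eventually_eq hΦ (κ := κ) ?_ ?_ ?_
  · exact hv.smooth.sub ((hv.smooth.sub contDiffOn_const).mul hη.contDiffOn)
  · refine ⟨r, hr0, hr1, fun x hx => ?_⟩
    have hxr : min δ r ≤ ‖x‖ := by
      obtain ⟨i, hi⟩ := hx
      exact (min_le_right _ _).trans (hi.le.trans (abs_apply_le_norm x i))
    simp [hr x hx, hη0 x hxr]
  · refine eventually_nhdsWithin_of_eventually_nhds ?_
    filter_upwards [hη1] with x hx
    simp [hx]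

end Checkerboard

/-! ### Truncation, cutoffs and flattening -/

namespace Checkerboard

variable {φ ψ : ℝ → ℝ} {K L : ℝ}

/-- Points have capacity zero for the energy of `ψ`. -/
def HasCutoffs (ψ : ℝ → ℝ) : Prop :=
  ∀ δ : ℝ, 0 < δ → ∀ ε : ℝ≥0∞, 0 < ε → ∃ η : Plane → ℝ, ContDiff ℝ (⊤ : ℕ∞) η ∧
    (∀ x, 0 ≤ η x ∧ η x ≤ 1) ∧ (∀ᶠ x in 𝓝 0, η x = 1) ∧ (∀ x, δ ≤ ‖x‖ → η x = 0) ∧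
    ∫⁻ x, ENNReal.ofReal (ψ ‖fderiv ℝ η x‖) ≤ ε

theorem fderiv_eq_zero_of_nonneg {η : Plane → ℝ} (hη : ∀ x, 0 ≤ η x) {x : Plane} (hx : η x = 0) :
    fderiv ℝ η x = 0 :=
  IsLocalMin.fderiv_eq_zero (Eventually.of_forall fun y => by rw [hx]; exact hη y)

/-- The smooth bounded truncation at height comparable to `n`. -/
noncomputable def truncation (n : ℕ) (s : ℝ) : ℝ := (n + 1) * Real.arctan (s / (n + 1))

theorem contDiff_truncation (n : ℕ) : ContDiff ℝ (⊤ : ℕ∞) (truncation n) :=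
  contDiff_const.mul (Real.contDiff_arctan.comp (contDiff_id.div_const _))

theorem deriv_truncation (n : ℕ) (s : ℝ) : deriv (truncation n) s = 1 / (1 + (s / (n + 1)) ^ 2) := by
  have h : HasDerivAt (truncation n) ((n + 1) * (1 / (1 + (s / (n + 1)) ^ 2) * (1 / (n + 1)))) s :=
    ((hasDerivAt_id s).div_const ((n : ℝ) + 1)).arctan.const_mul _
  rw [h.deriv]; field_simp

theorem abs_deriv_truncation_le (n : ℕ) (s : ℝ) : |deriv (truncation n) s| ≤ 1 := by
  rw [deriv_truncation, abs_of_nonneg (by positivity), div_le_one (by positivity)]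
  linarith [sq_nonneg (s / ((n : ℝ) + 1))]

theorem tendsto_deriv_truncation (s : ℝ) :
    Tendsto (fun n => deriv (truncation n) s) atTop (𝓝 1) := by
  simp only [deriv_truncation]
  have h : Tendsto (fun n : ℕ => s / ((n : ℝ) + 1)) atTop (𝓝 0) := by
    simpa [div_eq_mul_inv] using (tendsto_one_div_add_atTop_nhds_zero_nat (𝕜 := ℝ)).const_mul s
  have h2 : Tendsto (fun n : ℕ => 1 / (1 + (s / ((n : ℝ) + 1)) ^ 2)) atTop (𝓝 (1 / (1 + 0 ^ 2))) :=
    tendsto_const_nhds.div ((h.pow 2).const_add 1) (by norm_num)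
  simpa using h2

theorem truncation_zero (n : ℕ) : truncation n 0 = 0 := by simp [truncation]

theorem abs_truncation_le (n : ℕ) (s : ℝ) : |truncation n s| ≤ 2 * (n + 1) := by
  rw [truncation, abs_mul, abs_of_nonneg (by positivity : (0 : ℝ) ≤ n + 1), mul_comm]
  have h := abs_le.2 ⟨(Real.neg_pi_div_two_lt_arctan (s / (n + 1))).le.trans'
    (by linarith [Real.pi_lt_four] : -(2 : ℝ) ≤ _), (Real.arctan_lt_pi_div_two (s / (n + 1))).le.trans
    (by linarith [Real.pi_lt_four] : _ ≤ (2 : ℝ))⟩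
  gcongr

/-- The derivatives of the truncations are bounded by `1` and tend to `1`, so the truncated
functions converge in energy. Boundedness is what controls the product of the function with the
gradient of a cutoff. -/
theorem approximable_of_truncation {Φ : Plane → ℝ → ℝ} (hΦ : YoungFamily Φ K) {v : Plane → ℝ}
    (hv : Admissible Φ v)
    (h : ∀ n, Admissible Φ (fun x => truncation n (v x)) →
      Approximable Φ fun x => truncation n (v x)) : Approximable Φ v := by
  refine approximable_of_forall hΦ fun ε hε => ?_
  have := hv.tendsto_comp hΦ contDiff_truncation abs_deriv_truncation_le
    (ae_of_all _ fun x => Or.inr (tendsto_deriv_truncation _))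
  obtain ⟨n, hn⟩ := (this.eventually_le_const hε).exists
  exact ⟨_, h n (hv.comp hΦ (contDiff_truncation n) (truncation_zero n)
    (abs_deriv_truncation_le n)), hn⟩

/-- If points have capacity zero for the larger phase, then all functions are approximable. -/
theorem Admissible.approximable_of_hasCutoffs (hφ : Young φ K) (hψ : Young ψ L)
    (hcut : HasCutoffs ψ) {c₃ c₄ : ℝ} (hφψ : ∀ t, 0 ≤ t → φ t ≤ c₃ * ψ t + c₄)
    {v : Plane → ℝ} (hv : Admissible (integrand φ ψ) v) : Approximable (integrand φ ψ) v := by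
  have hΦ := hφ.youngFamily_integrand hψ
  refine approximable_of_truncation hΦ hv fun n hw => ?_
  refine hw.approximable_of_cutoff hΦ 0 fun δ hδ ε hε => ?_
  obtain ⟨Q, hQ1, hQ⟩ := (hφ.add hψ).exists_map_mul_le (2 * (n + 1))
  set a := Q * (max c₃ 0 + 1) with ha
  set b := Q * max c₄ 0 with hb
  have ha0 : 0 < a := mul_pos (by linarith) (by linarith [le_max_right c₃ 0])
  have hb0 : 0 ≤ b := mul_nonneg (by linarith) (le_max_right _ _)
  have hε2 : 0 < ε / 2 := ENNReal.half_pos hε.ne'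
  -- The additive constant from comparing `φ` with `ψ` matters only on the support of the cutoff,
  -- which is shrunk until it contributes at most `ε / 2`.
  obtain ⟨δ', hδ', hsmall⟩ := exists_setLIntegral_ball_le (S := univ) (δ := 1)
    (f := fun _ => ENNReal.ofReal b) one_pos (by
      rw [univ_inter, setLIntegral_const]
      exact ENNReal.mul_ne_top ENNReal.ofReal_ne_top measure_ball_lt_top.ne) hε2
  rw [univ_inter] at hsmall
  obtain ⟨η, hη, hη01, hη1, hη0, hηε⟩ := hcut (min δ δ') (lt_min hδ hδ')
    (ε / 2 / ENNReal.ofReal a) (ENNReal.div_pos hε2.ne' ENNReal.ofReal_ne_top)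
  refine ⟨η, hη, hη01, hη1, fun x hx => hη0 x ((min_le_left _ _).trans hx), ?_⟩
  have hmψ : Measurable fun x => ENNReal.ofReal (ψ ‖fderiv ℝ η x‖) :=
    (hψ.cont.measurable.comp (measurable_fderiv ℝ η).norm).ennreal_ofReal
  calc ∫⁻ x, ENNReal.ofReal (integrand φ ψ x ‖(truncation n (v x) - 0) • fderiv ℝ η x‖)
      ≤ ∫⁻ x, (ENNReal.ofReal a * ENNReal.ofReal (ψ ‖fderiv ℝ η x‖) +
          (Metric.ball (0 : Plane) δ').indicator (fun _ => ENNReal.ofReal b) x) := by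
        refine lintegral_mono fun x => ?_
        by_cases hx : x ∈ Metric.ball (0 : Plane) δ'
        · rw [indicator_of_mem hx, ← ENNReal.ofReal_mul ha0.le,
            ← ENNReal.ofReal_add (mul_nonneg ha0.le (hψ.nonneg _)) hb0]
          refine ENNReal.ofReal_le_ofReal ?_
          set t := ‖fderiv ℝ η x‖
          have ht : 0 ≤ t := norm_nonneg _
          calc integrand φ ψ x ‖(truncation n (v x) - 0) • fderiv ℝ η x‖
              ≤ integrand φ ψ x (2 * (n + 1) * t) := by
                refine (hΦ.young x).mono ?_
                rw [sub_zero, norm_smul, Real.norm_eq_abs]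
                exact mul_le_mul_of_nonneg_right (abs_truncation_le n _) ht
            _ ≤ φ (2 * (n + 1) * t) + ψ (2 * (n + 1) * t) := by
                unfold integrand
                have := mul_le_of_le_one_left (hψ.nonneg (2 * (n + 1) * t)) (weight_le_one x)
                linarith
            _ ≤ Q * (φ t + ψ t) := hQ t ht
            _ ≤ Q * ((max c₃ 0 + 1) * ψ t + max c₄ 0) := by
                have h1 := hφψ t ht
                have h2 := mul_le_mul_of_nonneg_right (le_max_left c₃ 0) (hψ.nonneg t)
                have h3 := le_max_left c₄ 0
                refine mul_le_mul_of_nonneg_left ?_ (by linarith)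
                rw [add_mul]
                linarith
            _ = _ := by rw [ha, hb]; ring
        · rw [mem_ball_zero_iff, not_lt] at hx
          rw [fderiv_eq_zero_of_nonneg (fun x => (hη01 x).1) (hη0 x ((min_le_right _ _).trans hx)),
            smul_zero, norm_zero, (hΦ.young x).zero 0 le_rfl, ENNReal.ofReal_zero]
          exact zero_le
    _ = ENNReal.ofReal a * (∫⁻ x, ENNReal.ofReal (ψ ‖fderiv ℝ η x‖)) +
          ∫⁻ _ in Metric.ball (0 : Plane) δ', ENNReal.ofReal b := by
        rw [lintegral_add_left (hmψ.const_mul _), lintegral_const_mul' _ _ ENNReal.ofReal_ne_top,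
          lintegral_indicator measurableSet_ball]
    _ ≤ ENNReal.ofReal a * (ε / 2 / ENNReal.ofReal a) + ε / 2 := by gcongr
    _ ≤ ε / 2 + ε / 2 := by gcongr; exact ENNReal.mul_div_le
    _ = ε := ENNReal.add_halves ε

/-- If points have capacity zero for the smaller phase, then functions which are constant near
the origin in the region of the larger phase are approximable. -/
theorem Admissible.approximable_of_eq_on_cone (hφ : Young φ K) (hψ : Young ψ L)
    (hcut : HasCutoffs φ) {v : Plane → ℝ} (hv : Admissible (integrand φ ψ) v) {κ r : ℝ}
    (hr : 0 < r) (hκ : ∀ x, weight x = 1 → ‖x‖ < r → v x = κ) :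
    Approximable (integrand φ ψ) v := by
  have hΦ := hφ.youngFamily_integrand hψ
  refine approximable_of_truncation hΦ hv fun n hw => ?_
  refine hw.approximable_of_cutoff hΦ (truncation n κ) fun δ hδ ε hε => ?_
  obtain ⟨Q, hQ1, hQ⟩ := hφ.exists_map_mul_le (4 * (n + 1))
  have hQ0 : 0 ≤ Q := by linarith
  obtain ⟨η, hη, hη01, hη1, hη0, hηε⟩ := hcut (min δ r) (lt_min hδ hr)
    (ε / ENNReal.ofReal Q) (ENNReal.div_pos hε.ne' ENNReal.ofReal_ne_top)
  refine ⟨η, hη, hη01, hη1, fun x hx => hη0 x ((min_le_left _ _).trans hx), ?_⟩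
  calc ∫⁻ x, ENNReal.ofReal
        (integrand φ ψ x ‖(truncation n (v x) - truncation n κ) • fderiv ℝ η x‖)
      ≤ ∫⁻ x, ENNReal.ofReal Q * ENNReal.ofReal (φ ‖fderiv ℝ η x‖) := by
        refine lintegral_mono fun x => ?_
        rw [← ENNReal.ofReal_mul hQ0]
        refine ENNReal.ofReal_le_ofReal ?_
        rcases weight_eq x with hx | hx
        · have h1 : integrand φ ψ x = φ := by ext t; simp [integrand, hx]
          rw [h1]
          refine (hφ.mono ?_).trans (hQ _ (norm_nonneg _))
          rw [norm_smul, Real.norm_eq_abs]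
          refine mul_le_mul_of_nonneg_right ?_ (norm_nonneg _)
          have := abs_sub (truncation n (v x)) (truncation n κ)
          linarith [abs_truncation_le n (v x), abs_truncation_le n κ]
        · have h0 : (truncation n (v x) - truncation n κ) • fderiv ℝ η x = 0 := by
            rcases lt_or_ge ‖x‖ r with h | h
            · rw [hκ x hx h, sub_self, zero_smul]
            · rw [fderiv_eq_zero_of_nonneg (fun x => (hη01 x).1)
                (hη0 x ((min_le_right _ _).trans h)), smul_zero]
          rw [h0, norm_zero, (hΦ.young x).zero 0 le_rfl]
          exact mul_nonneg hQ0 (hφ.nonneg _)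
    _ ≤ ENNReal.ofReal Q * (ε / ENNReal.ofReal Q) := by
        rw [lintegral_const_mul' _ _ ENNReal.ofReal_ne_top]
        gcongr
    _ ≤ ε := ENNReal.mul_div_le

/-- Smooth functions which are constant near `c` and converge to the identity up to a constant. -/
theorem exists_flattening (c : ℝ) : ∃ (F : ℕ → ℝ → ℝ) (M : ℝ),
    (∀ n, ContDiff ℝ (⊤ : ℕ∞) (F n)) ∧ (∀ n, F n 0 = 0) ∧ (∀ n s, |deriv (F n) s| ≤ M) ∧
    (∀ s, s ≠ c → Tendsto (fun n => deriv (F n) s) atTop (𝓝 1)) ∧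
    ∀ n : ℕ, ∃ κ, ∀ s, |s - c| ≤ 1 / ((n : ℝ) + 1) → F n s = κ := by
  set χ : ContDiffBump (0 : ℝ) := ⟨1, 2, one_pos, one_lt_two⟩ with hχ
  set H : ℝ → ℝ := fun z => z * χ z with hH
  have hHs : ContDiff ℝ (⊤ : ℕ∞) H := contDiff_id.mul χ.contDiff
  have hHc : HasCompactSupport H := χ.hasCompactSupport.mul_left
  obtain ⟨M, hM⟩ := (hHs.continuous_deriv (by simp)).bounded_above_of_compact_support hHc.deriv
  have hH0 : ∀ z, 2 < |z| → deriv H z = 0 := by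
    intro z hz
    have : H =ᶠ[𝓝 z] fun _ => 0 := by
      filter_upwards [(isOpen_lt continuous_const continuous_abs).mem_nhds hz] with y hy
      have hy' : (2 : ℝ) < |y| := hy
      rw [hH]; simp only
      rw [χ.zero_of_le_dist (by rw [Real.dist_eq, sub_zero]; exact hy'.le), mul_zero]
    rw [this.deriv_eq, deriv_const]
  have hH1 : ∀ z, |z| ≤ 1 → H z = z := by
    intro z hz
    rw [hH]; simp only
    rw [χ.one_of_mem_closedBall (by rw [mem_closedBall_zero_iff]; exact hz), mul_one]
  -- Near `c` the rescaled `H` is the identity and cancels `s`, while beyond distance `2 / (n + 1)`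
  -- it vanishes. The last summand normalises `F n 0 = 0`, which preserves the support under
  -- composition.
  set F : ℕ → ℝ → ℝ := fun n s => s - H ((n + 1) * (s - c)) / (n + 1) +
    H ((n + 1) * (0 - c)) / (n + 1) with hF
  have hder : ∀ n s, deriv (F n) s = 1 - deriv H ((n + 1) * (s - c)) := by
    intro n s
    have h1 : HasDerivAt (fun s : ℝ => ((n : ℝ) + 1) * (s - c)) ((n : ℝ) + 1) s := by
      simpa using ((hasDerivAt_id s).sub_const c).const_mul ((n : ℝ) + 1)
    have h2 : HasDerivAt H (deriv H ((n + 1) * (s - c))) ((n + 1) * (s - c)) :=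
      (hHs.differentiable (by simp) _).hasDerivAt
    have h3 := ((hasDerivAt_id s).sub ((h2.comp s h1).div_const ((n : ℝ) + 1))).add_const
      (H ((n + 1) * (0 - c)) / (n + 1))
    have h4 := h3.deriv
    rw [mul_div_cancel_right₀ _ (by positivity : (n : ℝ) + 1 ≠ 0)] at h4
    exact h4
  refine ⟨F, 1 + M, ?_, ?_, ?_, ?_, ?_⟩
  · intro n
    exact (contDiff_id.sub ((hHs.comp (contDiff_const.mul (contDiff_id.sub contDiff_const))).div_const
      _)).add contDiff_const
  · intro n; simp [hF]
  · intro n s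
    rw [hder]
    have := hM ((n + 1) * (s - c))
    rw [Real.norm_eq_abs] at this
    have h2 := abs_sub (1 : ℝ) (deriv H ((n + 1) * (s - c)))
    rw [abs_one] at h2
    linarith
  · intro s hs
    have hpos : 0 < |s - c| := abs_pos.2 (sub_ne_zero.2 hs)
    refine tendsto_const_nhds.congr' ?_
    obtain ⟨N, hN⟩ := exists_nat_gt (2 / |s - c|)
    filter_upwards [eventually_ge_atTop N] with n hn
    rw [hder, hH0, sub_zero]
    rw [abs_mul, abs_of_nonneg (by positivity)]
    rw [div_lt_iff₀ hpos] at hN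
    have : (N : ℝ) ≤ n := by exact_mod_cast hn
    nlinarith
  · intro n
    refine ⟨c + H ((n + 1) * (0 - c)) / (n + 1), fun s hs => ?_⟩
    have hn : (0 : ℝ) < n + 1 := by positivity
    have h1 : H ((n + 1) * (s - c)) = (n + 1) * (s - c) := by
      refine hH1 _ ?_
      rw [abs_mul, abs_of_pos hn]
      rwa [le_div_iff₀ hn, mul_comm] at hs
    rw [hF]; simp only
    rw [h1, mul_div_cancel_left₀ _ hn.ne']; ring

/-- On the level set `v - c` is approximated by the zero map without error, so almost everywhere on
it the derivative is zero. This covers the set `v = c`, where the flattenings do not have derivative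
tending to one. -/
theorem ae_fderiv_eq_zero_of_eq {v : Plane → ℝ} (hv : ContDiffOn ℝ 1 v {0}ᶜ) (c : ℝ) :
    ∀ᵐ x : Plane, v x = c → fderiv ℝ v x = 0 := by
  set s : Set Plane := {0}ᶜ ∩ v ⁻¹' {c} with hs
  have hsm : MeasurableSet s := by
    have h1 : IsOpen ({0}ᶜ ∩ v ⁻¹' {c}ᶜ) :=
      hv.continuousOn.isOpen_inter_preimage isOpen_compl_singleton isOpen_compl_singleton
    have h2 : s = {0}ᶜ \ ({0}ᶜ ∩ v ⁻¹' {c}ᶜ) := by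
      ext x; simp [hs]
    rw [h2]
    exact (isOpen_compl_singleton.measurableSet).diff h1.measurableSet
  set e : Plane := EuclideanSpace.single 0 1
  -- Multiplication by a fixed unit vector turns the function into a map of the plane to itself.
  have happ : ApproximatesLinearOn (fun x => (v x - c) • e) (0 : Plane →L[ℝ] Plane) s 0 := by
    intro x hx y hy
    have hx' : v x = c := hx.2
    have hy' : v y = c := hy.2
    simp [hx', hy']
  have h := happ.norm_fderiv_sub_le (μ := volume) hsm (fun x => (fderiv ℝ v x).smulRight e)
    fun x hx => (((hasFDerivAt_of_contDiffOn hv hx.1).sub_const c).smul_const e).hasFDerivWithinAt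
  rw [ae_restrict_iff' hsm] at h
  filter_upwards [h, ae_ne_zero] with x hx hx0 hvx
  have h1 := hx ⟨hx0, hvx⟩
  rw [sub_zero] at h1
  have h2 : (fderiv ℝ v x).smulRight e = 0 := by
    rw [← nnnorm_eq_zero]; exact le_antisymm h1 zero_le
  ext y
  have h3 := congrArg (fun A : Plane →L[ℝ] Plane => A y 0) h2
  simpa [e] using h3

/-- Reduction to functions which are constant where the given function is close to `c`. -/
theorem Admissible.approximable_of_flattening {Φ : Plane → ℝ → ℝ} (hΦ : YoungFamily Φ K)
    {v : Plane → ℝ} (hv : Admissible Φ v) (c : ℝ)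
    (h : ∀ w : Plane → ℝ, Admissible Φ w →
      (∃ d > 0, ∃ κ, ∀ x, |v x - c| ≤ d → w x = κ) → Approximable Φ w) : Approximable Φ v := by
  obtain ⟨F, M, hF, hF0, hM, hlim, hκ⟩ := exists_flattening c
  refine approximable_of_forall hΦ fun ε hε => ?_
  have := hv.tendsto_comp hΦ hF hM (by
    filter_upwards [ae_fderiv_eq_zero_of_eq (hv.smooth.of_le (by simp)) c] with x hx
    by_cases hvx : v x = c
    · exact Or.inl (hx hvx)
    · exact Or.inr (hlim _ hvx))
  obtain ⟨n, hn⟩ := (this.eventually_le_const hε).exists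
  obtain ⟨κ, hκ⟩ := hκ n
  exact ⟨_, h _ (hv.comp hΦ (hF n) (hF0 n) (hM n))
    ⟨1 / ((n : ℝ) + 1), by positivity, κ, fun x hx => hκ _ hx⟩, hn⟩

end Checkerboard

/-! ### The case distinction and density in the modular -/

namespace Checkerboard

variable {φ ψ : ℝ → ℝ} {K L : ℝ}

theorem weight_eq_one_of_lt {x : Plane} (hx : |x 0| < |x 1|) : weight x = 1 := if_pos hx

theorem exists_coneLimit_of_weight_eq_one {v : Plane → ℝ} {c : ℝ}
    (h₁ : ConeLimit (.refl ℝ Plane) v c) (h₂ : ConeLimit (.neg ℝ) v c) {ε : ℝ} (hε : 0 < ε) :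
    ∃ r > 0, ∀ x : Plane, weight x = 1 → ‖x‖ < r → |v x - c| ≤ ε := by
  obtain ⟨r₁, hr₁, h₁⟩ := h₁ ε hε
  obtain ⟨r₂, hr₂, h₂⟩ := h₂ ε hε
  refine ⟨min r₁ r₂, lt_min hr₁ hr₂, fun x hx hxr => ?_⟩
  rw [lt_min_iff] at hxr
  have hlt : |x 0| < |x 1| := by
    by_contra h
    simp [weight, h] at hx
  have hx0 : x ≠ 0 := by rintro rfl; simp at hlt
  rcases le_total 0 (x 1) with h0 | h0
  · exact h₁ x hx0 (abs_of_nonneg h0 ▸ hlt.le) hxr.1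
  · have := h₂ (-x) (neg_ne_zero.2 hx0) (by simpa [abs_of_nonpos h0] using hlt.le)
      (by simpa using hxr.2)
    simpa using this

theorem lintegral_le_integrand_left (hψ : Young ψ L) (f : Plane → Plane →L[ℝ] ℝ) :
    ∫⁻ x, ENNReal.ofReal (φ ‖f x‖) ≤ ∫⁻ x, ENNReal.ofReal (integrand φ ψ x ‖f x‖) :=
  lintegral_mono fun x => ENNReal.ofReal_le_ofReal <|
    le_add_of_nonneg_right (mul_nonneg (weight_nonneg x) (hψ.nonneg _))

theorem setLIntegral_le_integrand_right (hφ : Young φ K) (f : Plane → Plane →L[ℝ] ℝ) :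
    ∫⁻ x in {x | weight x = 1}, ENNReal.ofReal (ψ ‖f x‖) ≤
      ∫⁻ x, ENNReal.ofReal (integrand φ ψ x ‖f x‖) := by
  refine le_trans (setLIntegral_mono' (measurable_weight (measurableSet_singleton 1))
    fun x hx => ?_) (setLIntegral_le_lintegral _ _)
  refine ENNReal.ofReal_le_ofReal ?_
  have hx' : weight x = 1 := hx
  simp only [integrand, hx', one_mul]
  exact le_add_of_nonneg_left (hφ.nonneg _)

/-- An admissible function whose derivative has a mean value bound is approximable, if points have
capacity zero for the larger phase, or if functions with finite energy for the smaller phase have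
equal limits along opposite cones. -/
theorem Admissible.approximable_of_bound (hφ : Young φ K) (hψ : Young ψ L)
    (hφc : (DivergesAtZero fun r => conj φ (1 / r) * ENNReal.ofReal r) → HasCutoffs φ)
    (hψc : (DivergesAtZero fun r => conj ψ (1 / r) * ENNReal.ofReal r) → HasCutoffs ψ)
    (hφf : ∀ s, conj φ s ≠ ∞) (hψf : ∀ s, conj ψ s ≠ ∞)
    {c₃ c₄ : ℝ} (hφψ : ∀ t, 0 ≤ t → φ t ≤ c₃ * ψ t + c₄)
    (hdiv : (DivergesAtZero fun r => conj ψ (1 / r) * ENNReal.ofReal r) ∨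
      DivergesAtZero fun r => ENNReal.ofReal (φ (1 / r) * r))
    {v : Plane → ℝ} (hv : Admissible (integrand φ ψ) v) {g : Plane → Plane →L[ℝ] ℝ}
    (hg : ∫⁻ x, ENNReal.ofReal (integrand φ ψ x ‖g x‖) ≠ ∞) {B : ℝ≥0∞} (hB : B ≠ ∞)
    (hbound : ∀ x : Plane, x ≠ 0 → ‖x‖ₑ * ‖fderiv ℝ v x‖ₑ ≤
      B * ∫⁻ z in {z | ‖z‖ ≤ 2 * ‖x‖ ∧ weight x ≤ weight z}, ENNReal.ofReal (‖g z‖ / ‖z‖)) :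
    Approximable (integrand φ ψ) v := by
  have hΦ := hφ.youngFamily_integrand hψ
  by_cases hψd : DivergesAtZero fun r => conj ψ (1 / r) * ENNReal.ofReal r
  · exact hv.approximable_of_hasCutoffs hφ hψ (hψc hψd) hφψ
  have hφd := hdiv.resolve_left hψd
  obtain ⟨δ, hδ, hconj⟩ := exists_setLIntegral_conj_ne_top hψf hψd
  have hv1 := hv.smooth.of_le (show (1 : WithTop ℕ∞) ≤ (⊤ : ℕ∞) by simp)
  have hvφ := ne_top_of_le_ne_top hv.energy (lintegral_le_integrand_left hψ _)
  have hgφ := ne_top_of_le_ne_top hg (lintegral_le_integrand_left hψ _)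
  have hcone (R : Plane ≃ₗᵢ[ℝ] Plane) (hR : ∀ x : Plane, |x 0| < x 1 → weight (R x) = 1) :
      ∃ c, ConeLimit R v c := by
    refine exists_coneLimit hv1 R (S := {x | weight x = 1}) hR (fun x hx z hz => ?_) hδ hconj
      (ne_top_of_le_ne_top hv.energy (setLIntegral_le_integrand_right hφ _))
      (ne_top_of_le_ne_top hg (setLIntegral_le_integrand_right hφ _)) hB hbound
    have hx' : weight x = 1 := hx
    rw [hx'] at hz
    exact le_antisymm (weight_le_one z) hz
  obtain ⟨c, h₁⟩ := hcone (.refl ℝ Plane) fun x hx =>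
    weight_eq_one_of_lt (hx.trans_le (le_abs_self _))
  obtain ⟨c', h₂⟩ := hcone (.neg ℝ) fun x hx =>
    weight_eq_one_of_lt (by simpa using hx.trans_le (le_abs_self _))
  obtain rfl := h₁.eq_of_diverges hφ hφd hv1 hvφ h₂
  -- The flattened `w` is constant where `v` is close to `c`, so limits of `v` suffice and no mean
  -- value bound for `w` is needed.
  refine hv.approximable_of_flattening hΦ c fun w hw ⟨d, hd, κ, hκ⟩ => ?_
  by_cases hφd' : DivergesAtZero fun r => conj φ (1 / r) * ENNReal.ofReal r
  · obtain ⟨r, hr, hvr⟩ := exists_coneLimit_of_weight_eq_one h₁ h₂ hd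
    exact hw.approximable_of_eq_on_cone hφ hψ (hφc hφd') hr fun x hx hxr => hκ x (hvr x hx hxr)
  -- Otherwise the phase `φ`, present in the whole plane, gives limits along the side cones as well.
  obtain ⟨δ', hδ', hconj'⟩ := exists_setLIntegral_conj_ne_top hφf hφd'
  have hcone' (R : Plane ≃ₗᵢ[ℝ] Plane) : ∃ c, ConeLimit R v c :=
    exists_coneLimit hv1 R (S := univ) (fun _ _ => mem_univ _) (fun _ _ _ _ => mem_univ _) hδ'
      hconj' (by simpa using hvφ) (by simpa using hgφ) hB hbound
  obtain ⟨c₁, h₃⟩ := hcone' swap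
  obtain ⟨c₂, h₄⟩ := hcone' (swap.trans (.neg ℝ))
  obtain rfl : c = c₁ := h₁.unique h₃ fun t => by simp [swap_apply]
  obtain rfl : c = c₂ := h₂.unique h₄ fun t => by simp [swap_apply]
  obtain ⟨r, hr, hvr⟩ := exists_forall_abs_sub_le_of_coneLimit h₁ h₂ h₃ h₄ hd
  refine approximable_of_eventually_eq hΦ hw.smooth hw.supp (κ := κ) ?_
  rw [eventually_nhdsWithin_iff]
  filter_upwards [Metric.ball_mem_nhds 0 hr] with x hx hx0
  exact hκ x (hvr x hx0 (by simpa using hx))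

/-- Density of smooth functions in terms of the energy. -/
theorem exists_smooth_approximation (hφ : Young φ K) (hψ : Young ψ L)
    (hφc : (DivergesAtZero fun r => conj φ (1 / r) * ENNReal.ofReal r) → HasCutoffs φ)
    (hψc : (DivergesAtZero fun r => conj ψ (1 / r) * ENNReal.ofReal r) → HasCutoffs ψ)
    (hφf : ∀ s, conj φ s ≠ ∞) (hψf : ∀ s, conj ψ s ≠ ∞)
    {c₃ c₄ : ℝ} (hφψ : ∀ t, 0 ≤ t → φ t ≤ c₃ * ψ t + c₄)
    (hdiv : (DivergesAtZero fun r => conj ψ (1 / r) * ENNReal.ofReal r) ∨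
      DivergesAtZero fun r => ENNReal.ofReal (φ (1 / r) * r))
    {u : Plane → ℝ} {g : Plane → Plane →L[ℝ] ℝ} (hu : Integrable u) (hg : Integrable g)
    (hus : ∀ x, x ∉ square → u x = 0) (hug : IsLimitOfSmooth u g)
    (hgΦ : ∫⁻ x, ENNReal.ofReal (integrand φ ψ x ‖g x‖) ≠ ∞) {ε : ℝ≥0∞} (hε : 0 < ε) :
    ∃ η : Plane → ℝ, ContDiff ℝ (⊤ : ℕ∞) η ∧ CompactlySupported η ∧
      ∫⁻ x, ENNReal.ofReal (integrand φ ψ x ‖g x - fderiv ℝ η x‖) ≤ ε := by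
  have hΦ := hφ.youngFamily_integrand hψ
  have hK := (hΦ.young 0).one_le
  set M := max K L
  have hK0 : ENNReal.ofReal M ≠ 0 := (ENNReal.ofReal_pos.2 (by linarith)).ne'
  -- The smoothing applies Fubini's theorem to compositions of `g` with the expansions, so `g` is
  -- replaced by a strongly measurable representative.
  wlog hgm : StronglyMeasurable g generalizing g
  · set g' := hg.1.mk g
    have hgg' : g =ᵐ[volume] g' := hg.1.ae_eq_mk
    have hc : ∀ h : Plane → Plane →L[ℝ] ℝ,
        ∫⁻ x, ENNReal.ofReal (integrand φ ψ x ‖g x - h x‖) =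
          ∫⁻ x, ENNReal.ofReal (integrand φ ψ x ‖g' x - h x‖) := fun h =>
      lintegral_congr_ae (hgg'.mono fun x hx => by simp only [hx])
    obtain ⟨η, h1, h2, h3⟩ := this (g := g') (hg.congr hgg') (fun ε hε => by
      obtain ⟨η, h1, h2, h3, h4⟩ := hug ε hε
      refine ⟨η, h1, h2, h3, le_of_eq_of_le ?_ h4⟩
      exact lintegral_congr_ae (hgg'.mono fun x hx => by simp only [hx]))
      (by have := hc fun _ => 0; simp only [sub_zero] at this; rwa [← this]) hg.1.stronglyMeasurable_mk
    exact ⟨η, h1, h2, (hc _).trans_le h3⟩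
  set ε' := ε / ENNReal.ofReal M / 2 with hε'
  have hε0 : 0 < ε' := ENNReal.half_pos (ENNReal.div_pos hε.ne' ENNReal.ofReal_ne_top).ne'
  have hmeas : ∀ v : Plane → ℝ,
      Measurable fun x => ENNReal.ofReal (integrand φ ψ x ‖g x - fderiv ℝ v x‖) := fun v =>
    (hΦ.meas.comp (measurable_id.prodMk (hgm.measurable.sub
      (_root_.measurable_fderiv ℝ v)).norm)).ennreal_ofReal
  -- A finite `ε'` is needed for `v` to have finite energy.
  by_cases hε1 : ε = ∞
  · exact ⟨0, contDiff_const, ⟨1 / 2, by norm_num, by norm_num, fun _ _ => rfl⟩, hε1 ▸ le_top⟩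
  have hεt : ε' ≠ ∞ := (ENNReal.div_lt_top (ENNReal.div_lt_top hε1 hK0).ne two_ne_zero).ne
  obtain ⟨v, hvs, hvc, hvg, B, hB, hbound⟩ := hΦ.exists_smoothing (fun x y hxy t => by
    have := mul_le_mul_of_nonneg_right hxy (hψ.nonneg t)
    simp only [integrand]; linarith) hu hg hgm hus hug hgΦ hε0
  have hvg' : ∫⁻ x, ENNReal.ofReal (integrand φ ψ x ‖g x - fderiv ℝ v x‖) ≤ ε' := by
    simpa only [norm_sub_rev] using hvg
  have hva : Admissible (integrand φ ψ) v := ⟨hvs, hvc, by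
    have := hΦ.lintegral_add_le (f := fun x => fderiv ℝ v x - g x) (g := g)
      (by simpa only [norm_sub_rev] using (hmeas v).aemeasurable)
    simp only [sub_add_cancel] at this
    exact ne_top_of_le_ne_top (ENNReal.mul_ne_top ENNReal.ofReal_ne_top
      (ENNReal.add_ne_top.2 ⟨ne_top_of_le_ne_top hεt hvg, hgΦ⟩)) this⟩
  obtain ⟨η, hη, hηs, hvη⟩ := hva.approximable_of_bound hφ hψ hφc hψc hφf hψf hφψ hdiv hgΦ hB
    hbound ε' hε0
  refine ⟨η, hη, hηs, ?_⟩
  have := hΦ.lintegral_add_le (f := fun x => g x - fderiv ℝ v x)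
    (g := fun x => fderiv ℝ v x - fderiv ℝ η x) (hmeas v).aemeasurable
  simp only [sub_add_sub_cancel] at this
  refine this.trans ?_
  calc _ ≤ ENNReal.ofReal M * (ε' + ε') := by gcongr
    _ = ε := by
      rw [ENNReal.add_halves, ENNReal.mul_div_cancel hK0 ENNReal.ofReal_ne_top]

end Checkerboard

/-! ### From the modular to the Luxemburg norm and the Sobolev spaces -/

namespace Checkerboard

variable {Φ Φ' : Plane → ℝ → ℝ} {K : ℝ} {Ω : TopologicalSpace.Opens Plane}

/-- The integrand is evaluated only at nonnegative arguments, so both phases may be altered on the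
negative axis. -/
theorem luxemburgNorm_congr (h : ∀ x t, 0 ≤ t → Φ x t = Φ' x t)
    (Ω : TopologicalSpace.Opens Plane) : luxemburgNorm Φ Ω = luxemburgNorm Φ' Ω := by
  ext f
  unfold luxemburgNorm
  refine iInf_congr fun γ => iInf_congr fun hγ => ?_
  have : ∀ x, Φ x (‖f x‖ / γ) = Φ' x (‖f x‖ / γ) := fun x => h x _ (by positivity)
  simp only [this]

theorem sobolevW_congr (h : ∀ x t, 0 ≤ t → Φ x t = Φ' x t) (Ω : TopologicalSpace.Opens Plane) :
    sobolevW Φ Ω = sobolevW Φ' Ω := by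
  simp only [sobolevW, MemLPhi, luxemburgNorm_congr h]

theorem sobolevH_congr (h : ∀ x t, 0 ≤ t → Φ x t = Φ' x t) (Ω : TopologicalSpace.Opens Plane) :
    sobolevH Φ Ω = sobolevH Φ' Ω := by
  simp only [sobolevH, MemLPhi, luxemburgNorm_congr h]

/-- By doubling, multiplying the argument by `γ` costs only a constant factor. -/
theorem YoungFamily.setLIntegral_ne_top (hΦ : YoungFamily Φ K) {f : Plane → Plane}
    (hf : luxemburgNorm Φ Ω f < ∞) : ∫⁻ x in Ω, ENNReal.ofReal (Φ x ‖f x‖) ≠ ∞ := by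
  simp only [luxemburgNorm, iInf_lt_iff] at hf
  obtain ⟨γ, hγ, h, -⟩ := hf
  obtain ⟨n, hn⟩ := pow_unbounded_of_one_lt γ one_lt_two
  have hK := (hΦ.young 0).one_le
  refine ne_top_of_le_ne_top (ENNReal.mul_ne_top (ENNReal.ofReal_ne_top (r := K ^ n))
    (ne_top_of_le_ne_top ENNReal.one_ne_top h)) ?_
  rw [← lintegral_const_mul' _ _ ENNReal.ofReal_ne_top]
  refine lintegral_mono fun x => ?_
  rw [← ENNReal.ofReal_mul (by positivity)]
  refine ENNReal.ofReal_le_ofReal ?_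
  have := (hΦ.young x).map_mul_le hn.le (t := ‖f x‖ / γ) (by positivity)
  rwa [mul_div_cancel₀ _ hγ.ne'] at this

/-- By doubling, division by `γ` costs a factor `K ^ n`, so `γ` is admissible as soon as the modular
is at most `K ^ (-n)`. Thus smallness of the modular controls the norm. -/
theorem YoungFamily.exists_luxemburgNorm_lt (hΦ : YoungFamily Φ K)
    (Ω : TopologicalSpace.Opens Plane) {ε : ℝ≥0∞} (hε : 0 < ε) :
    ∃ d : ℝ≥0∞, 0 < d ∧ ∀ f : Plane → Plane, ∫⁻ x in Ω, ENNReal.ofReal (Φ x ‖f x‖) ≤ d →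
      luxemburgNorm Φ Ω f < ε := by
  obtain ⟨γ, -, hγ, hγε⟩ := ENNReal.lt_iff_exists_real_btwn.1 hε
  rw [ENNReal.ofReal_pos] at hγ
  obtain ⟨n, hn⟩ := pow_unbounded_of_one_lt (1 / γ) one_lt_two
  have hK := (hΦ.young 0).one_le
  refine ⟨1 / ENNReal.ofReal (K ^ n), ENNReal.div_pos one_ne_zero ENNReal.ofReal_ne_top,
    fun f hf => lt_of_le_of_lt (iInf₂_le_of_le γ hγ (iInf_le_of_le ?_ le_rfl)) hγε⟩
  calc ∫⁻ x in Ω, ENNReal.ofReal (Φ x (‖f x‖ / γ))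
      ≤ ∫⁻ x in Ω, ENNReal.ofReal (K ^ n) * ENNReal.ofReal (Φ x ‖f x‖) := by
        refine lintegral_mono fun x => ?_
        rw [← ENNReal.ofReal_mul (by positivity)]
        refine ENNReal.ofReal_le_ofReal ?_
        have := (hΦ.young x).map_mul_le hn.le (norm_nonneg (f x))
        rwa [one_div_mul_eq_div] at this
    _ ≤ ENNReal.ofReal (K ^ n) * (1 / ENNReal.ofReal (K ^ n)) := by
        rw [lintegral_const_mul' _ _ ENNReal.ofReal_ne_top]
        gcongr
    _ ≤ 1 := ENNReal.mul_div_le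

/-- A smooth function with compact support in the square as a test function. -/
theorem CompactlySupported.exists_testFunction {η : Plane → ℝ} (hs : CompactlySupported η)
    (hη : ContDiff ℝ (⊤ : ℕ∞) η) : ∃ θ : TestFunction square ℝ ⊤, ⇑θ = η := by
  obtain ⟨r, hr0, hr1, hr⟩ := hs
  set C : Set Plane := {x | ∀ i, |x i| ≤ r} with hC
  have hCc : IsClosed C := by
    rw [hC, ofPred_forall]
    exact isClosed_iInter fun i => isClosed_le (by fun_prop) continuous_const
  have hCk : IsCompact C := (isCompact_closedBall (0 : Plane) (2 * r)).of_isClosed_subset hCc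
    fun x hx => mem_closedBall_zero_iff.2 (norm_le_two_mul (hx 0) (hx 1))
  have hsupp : Function.support η ⊆ C := by
    intro x hx i
    by_contra h
    exact hx (hr x ⟨i, not_le.1 h⟩)
  refine ⟨⟨η, hη, HasCompactSupport.of_support_subset_isCompact hCk hsupp, ?_⟩, rfl⟩
  refine (closure_minimal hsupp hCc).trans fun x hx i => ?_
  have := abs_le.1 (hx i)
  exact ⟨by linarith, by linarith⟩

theorem norm_toDual_sub_fderiv (p : Plane) (η : Plane → ℝ) (x : Plane) :
    ‖InnerProductSpace.toDual ℝ Plane p - fderiv ℝ η x‖ = ‖p - gradient η x‖ := by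
  rw [← (InnerProductSpace.toDual ℝ Plane).norm_map (p - gradient η x), map_sub, gradient,
    LinearIsometryEquiv.apply_symm_apply]

/-- The form dual to a vector field on `Ω`, extended by zero. -/
noncomputable def dualForm (Ω : TopologicalSpace.Opens Plane) (g : Plane → Plane) (x : Plane) :
    Plane →L[ℝ] ℝ :=
  InnerProductSpace.toDual ℝ Plane ((Ω : Set Plane).indicator g x)

theorem integrable_dualForm {g : Plane → Plane} (hg : IntegrableOn g Ω) :
    Integrable (dualForm Ω g) := by
  have h := hg.integrable_indicator Ω.isOpen.measurableSet
  exact h.mono ((InnerProductSpace.toDual ℝ Plane).continuous.comp_aestronglyMeasurable h.1)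
    (ae_of_all _ fun x => (LinearIsometryEquiv.norm_map _ _).le)

theorem testFunction_eq_zero (θ : TestFunction Ω ℝ ⊤) {x : Plane} (hx : x ∉ Ω) :
    θ x = 0 ∧ fderiv ℝ θ x = 0 := by
  have h : x ∉ tsupport θ := fun h => hx (θ.tsupport_subset h)
  exact ⟨image_eq_zero_of_notMem_tsupport h,
    Function.notMem_support.1 fun h' => h (support_fderiv_subset ℝ h')⟩

theorem lintegral_norm_dualForm_sub {F : Plane → ℝ → ℝ≥0∞} (hF : ∀ x, F x 0 = 0)
    (g : Plane → Plane) (θ : TestFunction Ω ℝ ⊤) :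
    ∫⁻ x, F x ‖dualForm Ω g x - fderiv ℝ θ x‖ = ∫⁻ x in Ω, F x ‖g x - gradient θ x‖ := by
  rw [← lintegral_indicator Ω.isOpen.measurableSet]
  refine lintegral_congr fun x => ?_
  by_cases hx : x ∈ (Ω : Set Plane)
  · rw [indicator_of_mem hx, dualForm, indicator_of_mem hx, norm_toDual_sub_fderiv]
  · rw [indicator_of_notMem hx, dualForm, indicator_of_notMem hx, (testFunction_eq_zero θ hx).2]
    simp [hF]

/-- Test functions and their derivatives vanish off `Ω`, so for the extensions by zero the errors
over the plane are the errors over `Ω`. -/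
theorem IsSobolevOneOneZero.isLimitOfSmooth {w : Plane → ℝ} {g : Plane → Plane}
    (h : IsSobolevOneOneZero Ω w g) :
    IsLimitOfSmooth ((Ω : Set Plane).indicator w) (dualForm Ω g) := by
  intro ε hε
  obtain ⟨e, -, he, hee⟩ := ENNReal.lt_iff_exists_real_btwn.1 hε
  rw [ENNReal.ofReal_pos] at he
  obtain ⟨⟨hw, hg, -⟩, h⟩ := h
  obtain ⟨θ, hθ⟩ := h e he
  have hθ1 : ContDiff ℝ 1 θ := θ.contDiff.of_le (by simp)
  have hθg : Integrable (fderiv ℝ θ) := (hθ1.continuous_fderiv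
    one_ne_zero).integrable_of_hasCompactSupport (θ.hasCompactSupport.fderiv ℝ)
  have hgθ : IntegrableOn (gradient θ) Ω := by
    have hc : Continuous (gradient θ) := (InnerProductSpace.toDual ℝ Plane).symm.continuous.comp
      (hθ1.continuous_fderiv one_ne_zero)
    exact (hθg.mono hc.aestronglyMeasurable
      (ae_of_all _ fun x => (LinearIsometryEquiv.norm_map _ _).le)).integrableOn
  have hi1 := hw.sub (hθ1.continuous.integrable_of_hasCompactSupport
    θ.hasCompactSupport).integrableOn
  have hi2 := hg.sub hgθ
  have n1 : 0 ≤ ∫ x in Ω, |w x - θ x| := integral_nonneg fun _ => abs_nonneg _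
  have n2 : 0 ≤ ∫ x in Ω, ‖g x - gradient θ x‖ := integral_nonneg fun _ => norm_nonneg _
  have e1 := ofReal_integral_norm_eq_lintegral_enorm hi1
  have e2 := ofReal_integral_norm_eq_lintegral_enorm hi2
  simp only [Pi.sub_apply, Real.norm_eq_abs] at e1 e2
  refine ⟨θ, hθ1, θ.hasCompactSupport, ?_, ?_⟩
  · have h1 : ENNReal.ofReal (∫ x in Ω, |w x - θ x|) ≤ ε :=
      (ENNReal.ofReal_le_ofReal (by linarith)).trans hee.le
    refine le_of_eq_of_le ?_ h1
    rw [e1, ← lintegral_indicator Ω.isOpen.measurableSet]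
    refine lintegral_congr fun x => ?_
    by_cases hx : x ∈ (Ω : Set Plane)
    · rw [indicator_of_mem hx, indicator_of_mem hx]
    · rw [indicator_of_notMem hx, indicator_of_notMem hx, (testFunction_eq_zero θ hx).1]
      simp
  · have := lintegral_norm_dualForm_sub (F := fun _ t => ENNReal.ofReal t) (by simp) g θ
    simp only [ofReal_norm] at this
    rw [this, ← e2]
    exact (ENNReal.ofReal_le_ofReal (by linarith)).trans hee.le

/-- Density of smooth functions in the Sobolev space of Young functions. -/
theorem sobolevH_eq_sobolevW {φ ψ : ℝ → ℝ} {L : ℝ} (hφ : Young φ K) (hψ : Young ψ L)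
    (hφc : (DivergesAtZero fun r => conj φ (1 / r) * ENNReal.ofReal r) → HasCutoffs φ)
    (hψc : (DivergesAtZero fun r => conj ψ (1 / r) * ENNReal.ofReal r) → HasCutoffs ψ)
    (hφf : ∀ s, conj φ s ≠ ∞) (hψf : ∀ s, conj ψ s ≠ ∞)
    {c₃ c₄ : ℝ} (hφψ : ∀ t, 0 ≤ t → φ t ≤ c₃ * ψ t + c₄)
    (hdiv : (DivergesAtZero fun r => conj ψ (1 / r) * ENNReal.ofReal r) ∨
      DivergesAtZero fun r => ENNReal.ofReal (φ (1 / r) * r)) :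
    sobolevH (integrand φ ψ) square = sobolevW (integrand φ ψ) square := by
  have hΦ := hφ.youngFamily_integrand hψ
  have h0 : ∀ x, ENNReal.ofReal (integrand φ ψ x 0) = 0 := fun x => by
    rw [(hΦ.young x).zero 0 le_rfl, ENNReal.ofReal_zero]
  refine Subset.antisymm (fun w ⟨g, hw, hg, _⟩ => ⟨g, hw, hg⟩) fun w ⟨g, hw, hg⟩ =>
    ⟨g, hw, hg, fun ε hε => ?_⟩
  obtain ⟨d, hd, hdε⟩ := hΦ.exists_luxemburgNorm_lt square hε
  have hgΦ : ∫⁻ x, ENNReal.ofReal (integrand φ ψ x ‖dualForm square g x‖) ≠ ∞ := by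
    -- For the zero test function the identity equates the energy of the form on the plane with that
    -- of `g` on the square.
    have := lintegral_norm_dualForm_sub
      (F := fun x t => ENNReal.ofReal (integrand φ ψ x t)) h0 g (0 : TestFunction square ℝ ⊤)
    have e : ∀ x, fderiv ℝ (0 : TestFunction square ℝ ⊤) x = 0 := fun x =>
      (hasFDerivAt_const (0 : ℝ) x).fderiv
    simp only [gradient, e, map_zero, sub_zero] at this
    rw [this]
    exact hΦ.setLIntegral_ne_top hg.2
  obtain ⟨η, hη, hηs, hηd⟩ := exists_smooth_approximation hφ hψ hφc hψc hφf hψf hφψ hdiv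
    (hw.1.1.integrable_indicator square.isOpen.measurableSet) (integrable_dualForm hw.1.2.1)
    (fun x hx => indicator_of_notMem hx _) hw.isLimitOfSmooth hgΦ hd
  obtain ⟨θ, rfl⟩ := hηs.exists_testFunction hη
  rw [lintegral_norm_dualForm_sub
    (F := fun x t => ENNReal.ofReal (integrand φ ψ x t)) h0] at hηd
  exact ⟨θ, hdε _ hηd⟩

end Checkerboard

theorem mainTheorem4 (φ ψ : ℝ → ℝ)
    (hφ : Checkerboard.IsOrlicz φ) (hψ : Checkerboard.IsOrlicz ψ)
    (hφ₂ : Checkerboard.DeltaNablaTwo φ) (hψ₂ : Checkerboard.DeltaNablaTwo ψ)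
    (pm pp : ℝ) (hpm : 1 < pm) (hpp : pm ≤ pp)
    (hφg : Checkerboard.HasGrowth pm pp φ) (hψg : Checkerboard.HasGrowth pm pp ψ)
    (c₃ c₄ : ℝ) (hφψ : ∀ t, 0 ≤ t → φ t ≤ c₃ * ψ t + c₄)
    (hlim : Tendsto (fun t => φ t / ψ t) atTop (𝓝 0))
    (hdiv :
      Checkerboard.DivergesAtZero
          (fun r => Checkerboard.conj ψ (1 / r) * ENNReal.ofReal r) ∨
        Checkerboard.DivergesAtZero (fun r => ENNReal.ofReal (φ (1 / r) * r))) :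
    Checkerboard.sobolevH (Checkerboard.integrand φ ψ) Checkerboard.square =
      Checkerboard.sobolevW (Checkerboard.integrand φ ψ) Checkerboard.square := by
  obtain ⟨K, hφy⟩ := hφ.exists_young hφ₂.1
  obtain ⟨L, hψy⟩ := hψ.exists_young hψ₂.1
  -- Both phases are replaced by `t ↦ f (max t 0)`, which changes neither the conjugates nor the
  -- spaces, nor the integrals at zero, as `1 / r ≥ 0`.
  have hpos (f : ℝ → ℝ) (t : ℝ) (ht : 0 ≤ t) : f t = f (max t 0) := by rw [max_eq_left ht]
  have hc (f : ℝ → ℝ) : Checkerboard.conj (fun t => f (max t 0)) = Checkerboard.conj f :=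
    funext fun s => (Checkerboard.conj_congr (hpos f) s).symm
  have hΦ (x : Checkerboard.Plane) (t : ℝ) (ht : 0 ≤ t) : Checkerboard.integrand φ ψ x t =
      Checkerboard.integrand (fun t => φ (max t 0)) (fun t => ψ (max t 0)) x t := by
    simp only [Checkerboard.integrand, max_eq_left ht]
  have hφf := hφg.conj_ne_top hpm
  have hψf := hψg.conj_ne_top hpm
  rw [Checkerboard.sobolevH_congr hΦ, Checkerboard.sobolevW_congr hΦ]
  refine Checkerboard.sobolevH_eq_sobolevW hφy hψy ?_ ?_ (by rwa [hc]) (by rwa [hc])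
    (c₃ := c₃) (c₄ := c₄) (fun t ht => by simpa only [max_eq_left ht] using hφψ t ht) ?_
  · rw [hc]
    exact fun h _ hδ _ hε => hφ.exists_cutoff hφy hφ₂.2 hφf h hδ hε
  · rw [hc]
    exact fun h _ hδ _ hε => hψ.exists_cutoff hψy hψ₂.2 hψf h hδ hε
  · rw [hc]
    refine hdiv.imp_right fun h δ hδ => ?_
    rw [← h δ hδ]
    refine setLIntegral_congr_fun measurableSet_Ioo fun r hr => ?_
    have : 0 ≤ 1 / r := one_div_nonneg.2 hr.1.le
    simp only [max_eq_left this]
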